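/- Let $X_1,X_2,\dots$ be i.i.d. random variables with values in a measurable space $\mathcal X$ and common distribution $\nu$, and let $f:\mathcal X^2\to\mathbb R$ be measurable with $\mathbb E|f(X_1,X_2)|^2<\infty$. Put $$U_n=\sum_{1\le i<j\le n}f(X_i,X_j),\qquad U^{\circ}_n=\sum_{i\in\mathbb Z/n\mathbb Z}\ \sum_{1\le j<n/2}f(X_i,X_{i+j})\quad(\text{indices of the } X\text{'s mod } n),$$ $$U^{--}_n=\sum_{1\le i<j\le n}(-1)^{i+j}f(X_i,X_j),\quad U^{+-}_n=\sum_{1\le i<j\le n}(-1)^{j}f(X_i,X_j),\quad U^{-+}_n=\sum_{1\le i<j\le n}(-1)^{i+1}f(X_i,X_j).$$ Let $\mu=\mathbb E f(X_1,X_2)$, $f_1(x)=\mathbb E f(x,X_1)-\mu$, $f_2(y)=\mathbb E f(X_1,y)-\mu$ and $f_{12}(x,y)=f(x,y)-f_1(x)-f_2(y)-\mu$. Suppose that $f$ is antisymmetric, $f(x,y)=-f(y,x)$, and that $f=f_{12}$ (both $\nu\otimes\nu$-a.e.). Let $T_f\varphi(x)=\int f(x,y)\varphi(y)\,d\nu(y)$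 be the integral operator on the complex Hilbert space $L^2(\mathcal X,\nu)$. Then the eigenvalues of $T_f$ with positive imaginary part, repeated according to multiplicity, can be written as a finite or infinite sequence $(\mathrm i\lambda_q)_{q=1}^{Q}$ with $\lambda_q>0$, $0\le Q\le\infty$. For every such enumeration, if $(\eta_q)_{q=1}^Q$ are independent random variables with the distribution of Lévy's stochastic area, i.e. $\mathbb E e^{\mathrm i t\eta_q}=1/\cosh t$ for $t\in\mathbb R$, then the sum $W:=\sum_{q=1}^Q\lambda_q\eta_q$ converges in $L^2$ and, as $n\to\infty$, $$n^{-1}U_n\xrightarrow{d}W,\quad n^{-1}U^{\circ}_n\xrightarrow{d}W,\quad n^{-1}U^{--}_n\xrightarrow{d}W,\quad n^{-1}U^{+-}_n\xrightarrow{d}W,\quad n^{-1}U^{-+}_n\xrightarrow{d}W.$$ -/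

import Mathlib

open MeasureTheory ProbabilityTheory Filter Topology

noncomputable section

namespace UStatistic

/-! ### The five `U`-statistics of order 2

A sequence of observations `X₁, X₂, …` is given as `x : ℕ → S`, where `x k` is `X_{k+1}`.
So `f (x i) (x j)` is the term with the labels `i + 1` and `j + 1`. -/

section Statistics

variable {S : Type*}

/-- `U_n(f) = ∑_{1 ≤ i < j ≤ n} f(X_i, X_j)`. -/
def standard (f : S → S → ℝ) (n : ℕ) (x : ℕ → S) : ℝ :=
  ∑ j ∈ Finset.range n, ∑ i ∈ Finset.range j, f (x i) (x j)

/-- The cyclic statistic `∑_{i ∈ ℤ/n} ∑_{1 ≤ j < n/2} f(X_i, X_{i+j})`,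
the indices being taken modulo `n`. -/
def cyclic (f : S → S → ℝ) (n : ℕ) (x : ℕ → S) : ℝ :=
  ∑ i ∈ Finset.range n, ∑ j ∈ (Finset.range n).filter (fun j => 1 ≤ j ∧ 2 * j < n),
    f (x i) (x ((i + j) % n))

/-- The alternating statistic `∑_{1 ≤ i < j ≤ n} (-1)^{i+1} f(X_i, X_j)` (signs `-+`). -/
def alternatingMP (f : S → S → ℝ) (n : ℕ) (x : ℕ → S) : ℝ :=
  ∑ j ∈ Finset.range n, ∑ i ∈ Finset.range j, (-1 : ℝ) ^ ((i + 1) + 1) * f (x i) (x j)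

/-- The alternating statistic `∑_{1 ≤ i < j ≤ n} (-1)^j f(X_i, X_j)` (signs `+-`). -/
def alternatingPM (f : S → S → ℝ) (n : ℕ) (x : ℕ → S) : ℝ :=
  ∑ j ∈ Finset.range n, ∑ i ∈ Finset.range j, (-1 : ℝ) ^ (j + 1) * f (x i) (x j)

/-- The bi-alternating statistic `∑_{1 ≤ i < j ≤ n} (-1)^{i+j} f(X_i, X_j)` (signs `--`). -/
def biAlternating (f : S → S → ℝ) (n : ℕ) (x : ℕ → S) : ℝ :=
  ∑ j ∈ Finset.range n, ∑ i ∈ Finset.range j, (-1 : ℝ) ^ ((i + 1) + (j + 1)) * f (x i) (x j)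

end Statistics

/-! ### The Hoeffding decomposition -/

section Hoeffding

variable {S : Type*} [MeasurableSpace S]

/-- `f_∅ = E f(X₁, X₂)`. -/
def hoeffdingMean (ν : Measure S) (f : S → S → ℝ) : ℝ :=
  ∫ p, f p.1 p.2 ∂(ν.prod ν)

/-- `f₁(x) = E f(x, X) - f_∅`. -/
def hoeffdingFst (ν : Measure S) (f : S → S → ℝ) (x : S) : ℝ :=
  (∫ y, f x y ∂ν) - hoeffdingMean ν f

/-- `f₂(y) = E f(X, y) - f_∅`. -/
def hoeffdingSnd (ν : Measure S) (f : S → S → ℝ) (y : S) : ℝ :=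
  (∫ x, f x y ∂ν) - hoeffdingMean ν f

/-- `f₁₂(x, y) = f(x, y) - f₁(x) - f₂(y) - f_∅`. -/
def hoeffdingPair (ν : Measure S) (f : S → S → ℝ) (x y : S) : ℝ :=
  f x y - hoeffdingFst ν f x - hoeffdingSnd ν f y - hoeffdingMean ν f

end Hoeffding

/-! ### The integral operator with a square integrable kernel -/

section Operator

variable {S : Type*} [MeasurableSpace S] {ν : Measure S} [IsProbabilityMeasure ν]

theorem eLpNorm_integral_mul_le {g : S → S → ℂ} (hg : MemLp (Function.uncurry g) 2 (ν.prod ν))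
    {φ : S → ℂ} (hφ : MemLp φ 2 ν) :
    eLpNorm (fun x => ∫ y, g x y * φ y ∂ν) 2 ν ≤
      eLpNorm (Function.uncurry g) 2 (ν.prod ν) * eLpNorm φ 2 ν := by
  have key : ∀ {T : Type _} [MeasurableSpace T] (μ : Measure T) (h : T → ℂ),
      eLpNorm h 2 μ = (∫⁻ x, ‖h x‖ₑ ^ (2 : ℝ) ∂μ) ^ (1 / 2 : ℝ) := by
    intro T _ μ h
    rw [eLpNorm_eq_lintegral_rpow_enorm_toReal (by norm_num) (by norm_num)]
    simp
  have key' : eLpNorm (Function.uncurry g) 2 (ν.prod ν) =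
      (∫⁻ x, ∫⁻ y, ‖g x y‖ₑ ^ (2 : ℝ) ∂ν ∂ν) ^ (1 / 2 : ℝ) := by
    rw [eLpNorm_eq_lintegral_rpow_enorm_toReal (by norm_num) (by norm_num),
      lintegral_prod _ (by simpa using hg.1.enorm.pow_const 2)]
    simp [Function.uncurry]
  rw [key, key ν φ, key', ← ENNReal.mul_rpow_of_nonneg _ _ (by norm_num)]
  refine ENNReal.rpow_le_rpow ?_ (by norm_num)
  have hmeas : AEMeasurable (fun x => ∫⁻ y, ‖g x y‖ₑ ^ (2 : ℝ) ∂ν) ν :=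
    AEMeasurable.lintegral_prod_right' (f := fun p : S × S => ‖g p.1 p.2‖ₑ ^ (2 : ℝ))
      (hg.1.enorm.pow_const 2)
  rw [← lintegral_mul_const'' _ hmeas]
  refine lintegral_mono_ae ?_
  filter_upwards [hg.1.prodMk_left] with x hx
  have hx' : AEMeasurable (fun y => ‖g x y‖ₑ) ν := hx.enorm
  have h1 : ‖∫ y, g x y * φ y ∂ν‖ₑ ≤ (∫⁻ y, ‖g x y‖ₑ ^ (2 : ℝ) ∂ν) ^ (1 / 2 : ℝ) *
      (∫⁻ y, ‖φ y‖ₑ ^ (2 : ℝ) ∂ν) ^ (1 / 2 : ℝ) := by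
    refine (enorm_integral_le_lintegral_enorm _).trans ?_
    simp_rw [enorm_mul]
    exact ENNReal.lintegral_mul_le_Lp_mul_Lq ν Real.HolderConjugate.two_two hx' hφ.1.enorm
  calc ‖∫ y, g x y * φ y ∂ν‖ₑ ^ (2 : ℝ) ≤ _ := ENNReal.rpow_le_rpow h1 (by norm_num)
    _ = _ := by
      rw [ENNReal.mul_rpow_of_nonneg _ _ (by norm_num), ← ENNReal.rpow_mul, ← ENNReal.rpow_mul]
      norm_num

theorem memLp_integral_mul {g : S → S → ℂ} (hg : MemLp (Function.uncurry g) 2 (ν.prod ν))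
    {φ : S → ℂ} (hφ : MemLp φ 2 ν) : MemLp (fun x => ∫ y, g x y * φ y ∂ν) 2 ν :=
  ⟨(hg.1.mul (hφ.comp_snd ν).1).integral_prod_right',
    (eLpNorm_integral_mul_le hg hφ).trans_lt (ENNReal.mul_lt_top hg.2 hφ.2)⟩

theorem ae_integrable_mul {g : S → S → ℂ} (hg : MemLp (Function.uncurry g) 2 (ν.prod ν))
    {φ : S → ℂ} (hφ : MemLp φ 2 ν) : ∀ᵐ x ∂ν, Integrable (fun y => g x y * φ y) ν :=
  (MemLp.integrable_mul hg (hφ.comp_snd ν)).prod_right_ae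

/-- The integral operator `(T_g φ)(x) = ∫ g(x, y) φ(y) dν(y)` on the complex space `L²(ν)`, for a
kernel `g ∈ L²(ν ⊗ ν)`. -/
def integralOperator (ν : Measure S) [IsProbabilityMeasure ν] (g : S → S → ℂ)
    (hg : MemLp (Function.uncurry g) 2 (ν.prod ν)) : Lp ℂ 2 ν →L[ℂ] Lp ℂ 2 ν :=
  LinearMap.mkContinuous
    { toFun := fun φ => (memLp_integral_mul hg (Lp.memLp φ)).toLp
        (fun x => ∫ y, g x y * φ y ∂ν)
      map_add' := fun φ ψ => by
        rw [← MemLp.toLp_add]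
        refine MemLp.toLp_congr _ _ ?_
        filter_upwards [ae_integrable_mul hg (Lp.memLp φ), ae_integrable_mul hg (Lp.memLp ψ)]
          with x h1 h2
        rw [Pi.add_apply, ← integral_add h1 h2]
        refine integral_congr_ae ?_
        filter_upwards [Lp.coeFn_add φ ψ] with y hy
        rw [hy, Pi.add_apply, mul_add]
      map_smul' := fun c φ => by
        rw [RingHom.id_apply, ← MemLp.toLp_const_smul]
        refine MemLp.toLp_congr _ _ (Eventually.of_forall fun x => ?_)
        rw [Pi.smul_apply, smul_eq_mul, ← integral_const_mul]
        refine integral_congr_ae ?_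
        filter_upwards [Lp.coeFn_smul c φ] with y hy
        rw [hy, Pi.smul_apply, smul_eq_mul]
        ring }
    (eLpNorm (Function.uncurry g) 2 (ν.prod ν)).toReal
    (fun φ => by
      rw [LinearMap.coe_mk, AddHom.coe_mk, Lp.norm_toLp, Lp.norm_def, ← ENNReal.toReal_mul]
      exact ENNReal.toReal_mono (ENNReal.mul_lt_top hg.2 (Lp.memLp φ).2).ne
        (eLpNorm_integral_mul_le hg (Lp.memLp φ)))

theorem integralOperator_apply (g : S → S → ℂ)
    (hg : MemLp (Function.uncurry g) 2 (ν.prod ν)) (φ : Lp ℂ 2 ν) :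
    integralOperator ν g hg φ =ᵐ[ν] fun x => ∫ y, g x y * φ y ∂ν :=
  MemLp.coeFn_toLp (memLp_integral_mul hg (Lp.memLp φ))

/-- The operator `T_f` on the complex space `L²(ν)` of a real kernel `f ∈ L²(ν ⊗ ν)`. -/
def realKernelOperator (ν : Measure S) [IsProbabilityMeasure ν] (f : S → S → ℝ)
    (hf : MemLp (Function.uncurry f) 2 (ν.prod ν)) : Lp ℂ 2 ν →L[ℂ] Lp ℂ 2 ν :=
  integralOperator ν (fun x y => (f x y : ℂ)) hf.ofReal

end Operator

/-- `(i lam_q)_q` is the family of all eigenvalues of `T` with positive imaginary part, each one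
repeated according to its multiplicity (the dimension of its eigenspace). -/
def EnumeratesUpperEigenvalues {E : Type*} [AddCommGroup E] [Module ℂ E] (T : Module.End ℂ E)
    {ι : Type*} (lam : ι → ℝ) : Prop :=
  (∀ q, 0 < lam q) ∧
    ∀ z : ℂ, 0 < z.im →
      {q | Complex.I * (lam q : ℂ) = z}.encard =
        Cardinal.toENat (Module.rank ℂ (Module.End.eigenspace T z))

section Limit

variable {Ω : Type*} [MeasurableSpace Ω]

/-- `η` has the distribution of Lévy's stochastic area, the law with characteristic function
`t ↦ 1 / cosh t`. -/
def IsStochasticArea (η : Ω → ℝ) (P : Measure Ω) : Prop :=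
  AEMeasurable η P ∧ ∀ t : ℝ, charFun (P.map η) t = ((1 / Real.cosh t : ℝ) : ℂ)

/-- `W = ∑_q Y_q`, a (finite or infinite) sum that converges in `L²(P)`. -/
def IsL2Sum {ι : Type*} (Y : ι → Ω → ℝ) (W : Ω → ℝ) (P : Measure Ω) : Prop :=
  MemLp W 2 P ∧
    Tendsto (fun s : Finset ι => eLpNorm (fun ω => (∑ q ∈ s, Y q ω) - W ω) 2 P) atTop (𝓝 0)

end Limit

end UStatistic

end

noncomputable section

namespace UStatistic

/-! ### Taylor estimates for the exponential function -/

/-! The proof compares characteristic functions. Four of the statistics are sums of `δ i * ε j * f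
(X i) (X j)` over `i < j` with signs `δ` and `ε`, and the cyclic one has this form after a
rearrangement of the observations, up to a negligible remainder.

Reduction to finite rank. Antisymmetry and `f = f₁₂` make both marginals of `f` vanish, so terms
with different index pairs are orthogonal. Hence `n⁻¹` times a signed sum has an L² norm bounded by
the norm of its kernel, uniformly in `n` and in the signs (`IsSample.lpNorm_weightedStat_le`), and a
change of the kernel costs at most `|t|` times its L² size. The operator `T_f` is compact,
skew-adjoint and commutes with complex conjugation. Its nonzero eigenvalues therefore come in pairs
`±iλ` with eigenvectors `e` and its conjugate. With `v = √2 Re e` and `w = √2 Im e`, which are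
centred and orthonormal, `f` is the L² sum of `λ_q (v_q(x) w_q(y) - w_q(x) v_q(y))`
(`exists_pairKernel_expansion`).

The area of a walk. For a partial sum of this series the statistic is a weighted sum of areas of
planar random walks with steps `δ_i (v_q, w_q)(X_i)`, the increment of area at time `j` carrying the
sign `δ_j ε_j`. Its characteristic function is found by a discrete form of Lévy's argument. Take the
phase `exp(i area)` times a Gaussian function of the position with precision `θ`. Averaging over the
last step gives, up to a small error, a scalar times an expression of the same kind. The precision
follows a discretised Riccati equation `θ' = τ² - θ²`, and the scalar is `(1 + h² θ)⁻¹` for each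
plane. Starting from `θ = 0` at the end and going back to time zero, the recursion is solved exactly
by a discrete `τ tanh`, and the scalars telescope to a discrete `1 / cosh τ`
(`exists_norm_integral_exp_walkArea_sub_le`). The sign of an increment enters only through its
square, so all sign patterns share one limit.

The cyclic case. For an antisymmetric kernel, listing the cycle as `0, m, 1, m + 1, …` with `m = ⌈n
/ 2⌉` turns the cyclic sum into a bi-alternating one plus at most `n` terms of neighbours
(`cyclic_eq_weightedStat`). These have norm of order `√n`.

Finally, `∑ λ_q²` is finite by Bessel's inequality, so `W` exists in L², its characteristic function
is the limit of the finite products of `1 / cosh (t λ_q)`, and the truncation can be removed. -/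

theorem mul_norm_exp_sub_taylor_le {w : ℂ} {g : ℝ} (hg0 : 0 ≤ g) (hg1 : g ≤ 1)
    (hgw : g * ‖Complex.exp w‖ ≤ 1) :
    g * ‖Complex.exp w - (1 + w + w ^ 2 / 2)‖ ≤ 4 * ‖w‖ ^ 3 := by
  -- The real part of `w` may be large and positive; the weight `g`, later a Gaussian, keeps the
  -- product with the exponential at most 1. For large `w` the trivial bound `1 + (1 + 1 + 1 / 2)
  -- ‖w‖ ^ 3` is enough.
  rcases le_total ‖w‖ 1 with h | h
  · have h1 := Complex.exp_bound h (n := 3) (by norm_num)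
    simp only [Finset.sum_range_succ, Finset.sum_range_zero] at h1
    norm_num [Nat.factorial] at h1
    have h2 : ‖Complex.exp w - (1 + w + w ^ 2 / 2)‖ ≤ ‖w‖ ^ 3 * (2 / 9) := by
      simpa using h1
    have := mul_le_mul hg1 h2 (norm_nonneg _) zero_le_one
    have h3 : 0 ≤ ‖w‖ ^ 3 := by positivity
    linarith
  · have h1 : ‖Complex.exp w - (1 + w + w ^ 2 / 2)‖ ≤
        ‖Complex.exp w‖ + (1 + ‖w‖ + ‖w‖ ^ 2 / 2) := by
      refine (norm_sub_le _ _).trans (add_le_add le_rfl ?_)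
      refine (norm_add_le _ _).trans (add_le_add ((norm_add_le _ _).trans (by simp)) ?_)
      simp
    have h2 : ‖w‖ ≤ ‖w‖ ^ 3 := by nlinarith [norm_nonneg w, sq_nonneg (‖w‖ - 1)]
    have h3 : ‖w‖ ^ 2 ≤ ‖w‖ ^ 3 := pow_le_pow_right₀ h (by norm_num)
    have h4 : 0 ≤ 1 + ‖w‖ + ‖w‖ ^ 2 / 2 := by positivity
    nlinarith [mul_le_mul_of_nonneg_left h1 hg0, mul_le_mul_of_nonneg_right hg1 h4]

theorem abs_exp_sub_one_sub_id_le_sq {v : ℝ} (hv : v ≤ 0) : |Real.exp v - 1 - v| ≤ v ^ 2 := by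
  rcases le_total (-1) v with h | h
  · exact Real.abs_exp_sub_one_sub_id_le (abs_le.2 ⟨h, hv.trans zero_le_one⟩)
  · have h1 : Real.exp v ≤ 1 := Real.exp_le_one_iff.2 hv
    have h2 := Real.add_one_le_exp v
    rw [abs_of_nonneg (by linarith)]
    nlinarith

/-- For `w = h L - h² D` the terms `h³ L D` and `h⁴ D²` of `w² / 2` have the size of the error, so
only orders up to `h²` are kept. The bound `‖w‖ ≤ 2 h K (1 + U)` yields the constant `32 = 4 * 2 ^
3`. -/
theorem mul_norm_exp_linear_sub_quadratic_le {L : ℂ} {D g h K U : ℝ} (hg0 : 0 ≤ g) (hg1 : g ≤ 1)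
    (hgw : g * ‖Complex.exp (h * L - h ^ 2 * D)‖ ≤ 1) (hL : ‖L‖ ≤ K * (1 + U)) (hD0 : 0 ≤ D)
    (hD : D ≤ K) (hh0 : 0 ≤ h) (hh1 : h ≤ 1) (hU : 0 ≤ U) :
    g * ‖Complex.exp (h * L - h ^ 2 * D) - (1 + h * L - h ^ 2 * D + h ^ 2 * L ^ 2 / 2)‖ ≤
      (32 * K ^ 3 + 2 * K ^ 2) * h ^ 3 * (1 + U) ^ 3 := by
  have hK : 0 ≤ K := hD0.trans hD
  set w : ℂ := h * L - h ^ 2 * D with hw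
  have hKU : 0 ≤ K * (1 + U) := by positivity
  have hDU : D ≤ K * (1 + U) := hD.trans (by nlinarith)
  have hwn : ‖w‖ ≤ 2 * h * K * (1 + U) := by
    have h1 : ‖w‖ ≤ h * ‖L‖ + h ^ 2 * D := by
      refine (norm_sub_le _ _).trans (le_of_eq ?_)
      simp [abs_of_nonneg hh0, abs_of_nonneg hD0]
    have h2 : h ^ 2 * D ≤ h * (K * (1 + U)) := by
      refine mul_le_mul (by nlinarith) hDU hD0 hh0
    nlinarith [mul_le_mul_of_nonneg_left hL hh0]
  have h1 := mul_norm_exp_sub_taylor_le hg0 hg1 hgw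
  have h2 : ‖w‖ ^ 3 ≤ (2 * h * K * (1 + U)) ^ 3 := pow_le_pow_left₀ (norm_nonneg _) hwn 3
  have e1 : Complex.exp w - (1 + h * L - h ^ 2 * D + h ^ 2 * L ^ 2 / 2) =
      (Complex.exp w - (1 + w + w ^ 2 / 2)) + (-(h ^ 3 * L * D) + h ^ 4 * D ^ 2 / 2) := by
    rw [hw]; ring
  have h3 : ‖(-(h ^ 3 * L * D) + h ^ 4 * D ^ 2 / 2 : ℂ)‖ ≤ 2 * K ^ 2 * h ^ 3 * (1 + U) ^ 3 := by
    have a1 : ‖(-(h ^ 3 * L * D) + h ^ 4 * D ^ 2 / 2 : ℂ)‖ ≤ h ^ 3 * ‖L‖ * D + h ^ 4 * D ^ 2 / 2 := by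
      refine (norm_add_le _ _).trans (le_of_eq ?_)
      simp [abs_of_nonneg hh0, abs_of_nonneg hD0]
    have a2 : h ^ 3 * ‖L‖ * D ≤ h ^ 3 * (K * (1 + U)) * K := by gcongr
    have a3 : h ^ 4 * D ^ 2 / 2 ≤ h ^ 3 * K ^ 2 := by
      have : h ^ 4 ≤ h ^ 3 := pow_le_pow_of_le_one hh0 hh1 (by norm_num)
      have : h ^ 4 * D ^ 2 ≤ h ^ 3 * K ^ 2 := by gcongr
      have : 0 ≤ h ^ 3 * K ^ 2 := by positivity
      linarith
    have a4 : (1 : ℝ) + U ≤ (1 + U) ^ 3 := by nlinarith [mul_nonneg hU hU, mul_nonneg hU (mul_nonneg hU hU)]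
    have a5 : (1 : ℝ) ≤ (1 + U) ^ 3 := by linarith
    have a6 : 0 ≤ h ^ 3 * K ^ 2 := by positivity
    nlinarith [mul_le_mul_of_nonneg_left a4 a6, mul_le_mul_of_nonneg_left a5 a6]
  rw [e1]
  calc g * ‖_ + _‖ ≤ g * (‖Complex.exp w - (1 + w + w ^ 2 / 2)‖ + 2 * K ^ 2 * h ^ 3 * (1 + U) ^ 3) := by
        gcongr; exact (norm_add_le _ _).trans (add_le_add le_rfl h3)
    _ ≤ 4 * (2 * h * K * (1 + U)) ^ 3 + 2 * K ^ 2 * h ^ 3 * (1 + U) ^ 3 := by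
        rw [mul_add]
        refine add_le_add (h1.trans (by gcongr)) ?_
        exact mul_le_of_le_one_left (by positivity) hg1
    _ = _ := by ring

/-! ### Gaussian functions of a planar walk -/

section Gaussian

variable {Q : Type*} [Fintype Q]

/-- The symplectic form with weights `τ`. -/
def sympForm (τ : Q → ℝ) (u z : Q ⊕ Q → ℝ) : ℝ :=
  ∑ q, τ q * (u (.inl q) * z (.inr q) - u (.inr q) * z (.inl q))

/-- The quadratic form with weights `θ`. -/
def planarForm (θ : Q → ℝ) (u : Q ⊕ Q → ℝ) : ℝ :=
  ∑ q, θ q * (u (.inl q) ^ 2 + u (.inr q) ^ 2)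

/-- The Gaussian function with precisions `θ`. -/
def gaussFun (θ : Q → ℝ) (u : Q ⊕ Q → ℝ) : ℝ := Real.exp (-(1 / 2) * planarForm θ u)

/-- The complex linear form that drives the increments of the Gaussian functions. -/
def driftVec (e : ℝ) (τ θ : Q → ℝ) (u : Q ⊕ Q → ℝ) : Q ⊕ Q → ℂ
  | .inl q => -(θ q * u (.inl q) : ℝ) - (e * τ q * u (.inr q) : ℝ) * Complex.I
  | .inr q => -(θ q * u (.inr q) : ℝ) + (e * τ q * u (.inl q) : ℝ) * Complex.I

def driftForm (e : ℝ) (τ θ : Q → ℝ) (u z : Q ⊕ Q → ℝ) : ℂ := ∑ r, driftVec e τ θ u r * z r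

theorem planarForm_nonneg {θ : Q → ℝ} (hθ : ∀ q, 0 ≤ θ q) (u : Q ⊕ Q → ℝ) : 0 ≤ planarForm θ u :=
  Finset.sum_nonneg fun q _ => mul_nonneg (hθ q) (by positivity)

theorem gaussFun_pos (θ : Q → ℝ) (u : Q ⊕ Q → ℝ) : 0 < gaussFun θ u := Real.exp_pos _

theorem gaussFun_le_one {θ : Q → ℝ} (hθ : ∀ q, 0 ≤ θ q) (u : Q ⊕ Q → ℝ) : gaussFun θ u ≤ 1 :=
  Real.exp_le_one_iff.2 (by nlinarith [planarForm_nonneg hθ u])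

/-- The square in `planarForm θ (u + h • z)` is expanded. Its cross term joins the symplectic phase
to form one complex linear form in `z`, which leaves a pure decay term. The identity is exact;
approximation starts only with the integral over `z`. -/
theorem exp_sympForm_mul_gaussFun (e h : ℝ) (τ θ : Q → ℝ) (u z : Q ⊕ Q → ℝ) :
    Complex.exp ((e * h * sympForm τ u z : ℝ) * Complex.I) * (gaussFun θ (u + h • z) : ℝ) =
      gaussFun θ u * Complex.exp (h * driftForm e τ θ u z - h ^ 2 * ((1 / 2) * planarForm θ z : ℝ)) := by
  rw [gaussFun, gaussFun, Complex.ofReal_exp, Complex.ofReal_exp, ← Complex.exp_add,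
    ← Complex.exp_add]
  congr 1
  simp only [driftForm, planarForm, sympForm, Fintype.sum_sum_type, driftVec, Finset.mul_sum,
    Complex.ofReal_sum, Complex.ofReal_mul, Pi.add_apply, Pi.smul_apply, smul_eq_mul,
    Finset.sum_mul, mul_add, ← Finset.sum_add_distrib, ← Finset.sum_sub_distrib]
  refine Finset.sum_congr rfl fun q _ => ?_
  push_cast
  ring

/-- The imaginary cross terms of the two coordinates of a plane cancel, and `e` survives only as
`e²`. For a step with identity covariance this sum is the second moment of `driftForm`, which is why
the signs do not influence the limit. -/
theorem sum_driftVec_sq {e : ℝ} (he : e ^ 2 = 1) (τ θ : Q → ℝ) (u : Q ⊕ Q → ℝ) :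
    ∑ r, driftVec e τ θ u r ^ 2 = (planarForm (fun q => θ q ^ 2 - τ q ^ 2) u : ℝ) := by
  simp only [planarForm, Fintype.sum_sum_type, driftVec, Complex.ofReal_sum,
    ← Finset.sum_add_distrib]
  refine Finset.sum_congr rfl fun q _ => ?_
  have he' : (e : ℂ) ^ 2 = 1 := by exact_mod_cast he
  push_cast
  linear_combination (-(τ q : ℂ) ^ 2 * (u (.inl q) ^ 2 + u (.inr q) ^ 2)) * he' +
    ((e : ℂ) ^ 2 * τ q ^ 2 * (u (.inl q) ^ 2 + u (.inr q) ^ 2)) * Complex.I_sq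

theorem norm_driftVec_le {e : ℝ} (he : |e| = 1) {τ θ : Q → ℝ} {Λ : ℝ} (hτ : ∀ q, |τ q| ≤ Λ)
    (hθ0 : ∀ q, 0 ≤ θ q) (hθ : ∀ q, θ q ≤ Λ) (u : Q ⊕ Q → ℝ) :
    ∑ r, ‖driftVec e τ θ u r‖ ≤ 2 * Λ * ∑ r, |u r| := by
  have key : ∀ q, ‖driftVec e τ θ u (.inl q)‖ ≤ Λ * |u (.inl q)| + Λ * |u (.inr q)| ∧
      ‖driftVec e τ θ u (.inr q)‖ ≤ Λ * |u (.inr q)| + Λ * |u (.inl q)| := by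
    intro q
    constructor
    · refine (norm_sub_le _ _).trans ?_
      rw [norm_neg, norm_mul, Complex.norm_I, mul_one, Complex.norm_real, Complex.norm_real,
        Real.norm_eq_abs, Real.norm_eq_abs, abs_mul, abs_mul, abs_mul, he, one_mul,
        abs_of_nonneg (hθ0 q)]
      exact add_le_add (mul_le_mul_of_nonneg_right (hθ q) (abs_nonneg _))
        (mul_le_mul_of_nonneg_right (hτ q) (abs_nonneg _))
    · refine (norm_add_le _ _).trans ?_
      rw [norm_neg, norm_mul, Complex.norm_I, mul_one, Complex.norm_real, Complex.norm_real,
        Real.norm_eq_abs, Real.norm_eq_abs, abs_mul, abs_mul, abs_mul, he, one_mul,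
        abs_of_nonneg (hθ0 q)]
      exact add_le_add (mul_le_mul_of_nonneg_right (hθ q) (abs_nonneg _))
        (mul_le_mul_of_nonneg_right (hτ q) (abs_nonneg _))
  rw [Fintype.sum_sum_type, Fintype.sum_sum_type, ← Finset.sum_add_distrib,
    ← Finset.sum_add_distrib, Finset.mul_sum]
  refine Finset.sum_le_sum fun q _ => ?_
  linarith [(key q).1, (key q).2]

theorem sum_sq_add_sq_le (u : Q ⊕ Q → ℝ) :
    ∑ q, (u (.inl q) ^ 2 + u (.inr q) ^ 2) ≤ (∑ r, |u r|) ^ 2 := by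
  calc _ = ∑ r, |u r| ^ 2 := by simp [Fintype.sum_sum_type, Finset.sum_add_distrib]
    _ ≤ _ := Finset.sum_sq_le_sq_sum_of_nonneg fun r _ => abs_nonneg _

theorem abs_planarForm_le {θ : Q → ℝ} {c : ℝ} (hθ : ∀ q, |θ q| ≤ c) (u : Q ⊕ Q → ℝ) (hc : 0 ≤ c) :
    |planarForm θ u| ≤ c * (∑ r, |u r|) ^ 2 := by
  refine (Finset.abs_sum_le_sum_abs _ _).trans (le_trans ?_
    (mul_le_mul_of_nonneg_left (sum_sq_add_sq_le u) hc))
  rw [Finset.mul_sum]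
  refine Finset.sum_le_sum fun q _ => ?_
  rw [abs_mul, abs_of_nonneg (by positivity : 0 ≤ u (.inl q) ^ 2 + u (.inr q) ^ 2)]
  exact mul_le_mul_of_nonneg_right (hθ q) (by positivity)

end Gaussian

/-- A probability measure on the space of planar vectors that is centred, bounded by `M` and has a
covariance matrix with distance at most `γ` from the identity. -/
structure IsNearlyIsotropic {Q : Type*} (μ : Measure (Q ⊕ Q → ℝ)) (M γ : ℝ) : Prop where
  bounded : ∀ᵐ z ∂μ, ∀ r, |z r| ≤ M
  mean : ∀ r, ∫ z, z r ∂μ = 0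
  cov_self : ∀ r, |∫ z, z r ^ 2 ∂μ - 1| ≤ γ
  cov : ∀ r s, r ≠ s → |∫ z, z r * z s ∂μ| ≤ γ

theorem IsNearlyIsotropic.integrable {Q : Type*} {μ : Measure (Q ⊕ Q → ℝ)} {M γ : ℝ} [IsProbabilityMeasure μ]
    (hμ : IsNearlyIsotropic μ M γ) (r : Q ⊕ Q) :
    Integrable (fun z : Q ⊕ Q → ℝ => z r) μ := by
  refine Integrable.of_bound (measurable_pi_apply r).aestronglyMeasurable M ?_
  filter_upwards [hμ.bounded] with z hz using hz r

theorem IsNearlyIsotropic.integrable_mul {Q : Type*} {μ : Measure (Q ⊕ Q → ℝ)} {M γ : ℝ} [IsProbabilityMeasure μ]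
    (hμ : IsNearlyIsotropic μ M γ) (r s : Q ⊕ Q) :
    Integrable (fun z : Q ⊕ Q → ℝ => z r * z s) μ := by
  refine Integrable.of_bound
    ((measurable_pi_apply r).mul (measurable_pi_apply s)).aestronglyMeasurable (M * M) ?_
  filter_upwards [hμ.bounded] with z hz
  rw [norm_mul]
  exact mul_le_mul (hz r) (hz s) (abs_nonneg _) ((abs_nonneg _).trans (hz r))

/-! ### One step of the backward recursion for Gaussian functions. -/

section Step

variable {Q : Type*} [Fintype Q]

/-- One step of the recursion for the precisions of the Gaussian functions. -/
def precisionStep (h : ℝ) (τ θ : Q → ℝ) (q : Q) : ℝ := (θ q + h ^ 2 * τ q ^ 2) / (1 + h ^ 2 * θ q)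

/-- The closed form is the exact mean that a standard Gaussian step would produce; each plane has
two coordinates, so the determinant factor carries no root. It is compared with its own expansion to
order `h²`. The condition `θ ≤ |τ|` makes the precisions increase, so the exponent below is
nonpositive and its exponential can be expanded for every `u`. -/
theorem abs_prod_mul_gaussFun_sub_le {h Λ : ℝ} {τ θ : Q → ℝ} (hτ : ∀ q, |τ q| ≤ Λ)
    (hθ0 : ∀ q, 0 ≤ θ q) (hθ : ∀ q, θ q ≤ |τ q|) (hΛ : 0 ≤ Λ) (u : Q ⊕ Q → ℝ) :
    |(∏ q, (1 + h ^ 2 * θ q)⁻¹) * gaussFun (precisionStep h τ θ) u -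
        gaussFun θ u * (1 - h ^ 2 * ∑ q, θ q +
          h ^ 2 / 2 * planarForm (fun q => θ q ^ 2 - τ q ^ 2) u)| ≤
      ((Fintype.card Q * Λ + Λ ^ 2) ^ 2 + Fintype.card Q * Λ ^ 2 + Λ ^ 3) * h ^ 4 *
        (1 + ∑ r, |u r|) ^ 4 := by
  set U := ∑ r, |u r| with hU
  have hU0 : 0 ≤ U := Finset.sum_nonneg fun r _ => abs_nonneg _
  have hx : ∀ q, 0 ≤ h ^ 2 * θ q := fun q => mul_nonneg (sq_nonneg _) (hθ0 q)
  have hx1 : ∀ q, 0 < 1 + h ^ 2 * θ q := fun q => by linarith [hx q]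
  have hθτ : ∀ q, θ q ^ 2 ≤ τ q ^ 2 := fun q => by
    rw [← sq_abs (τ q)]; exact pow_le_pow_left₀ (hθ0 q) (hθ q) 2
  have hτ2 : ∀ q, τ q ^ 2 ≤ Λ ^ 2 := fun q => by
    rw [← sq_abs (τ q)]; exact pow_le_pow_left₀ (abs_nonneg _) (hτ q) 2
  have hdiff : ∀ q, precisionStep h τ θ q - θ q = h ^ 2 * (τ q ^ 2 - θ q ^ 2) / (1 + h ^ 2 * θ q) := by
    intro q
    have := (hx1 q).ne'
    rw [precisionStep, eq_div_iff this, sub_mul, div_mul_cancel₀ _ this]; ring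
  -- `v` is the logarithm of the quotient of the closed form by `gaussFun θ u`, and `v0` is its part
  -- of order `h²`.
  set v : ℝ := -(∑ q, Real.log (1 + h ^ 2 * θ q)) -
    1 / 2 * planarForm (fun q => precisionStep h τ θ q - θ q) u with hv
  set v0 : ℝ := -(h ^ 2 * ∑ q, θ q) + h ^ 2 / 2 * planarForm (fun q => θ q ^ 2 - τ q ^ 2) u with hv0
  have e1 : (∏ q, (1 + h ^ 2 * θ q)⁻¹) * gaussFun (precisionStep h τ θ) u =
      gaussFun θ u * Real.exp v := by
    have : ∏ q, (1 + h ^ 2 * θ q)⁻¹ = Real.exp (-∑ q, Real.log (1 + h ^ 2 * θ q)) := by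
      rw [← Finset.sum_neg_distrib, Real.exp_sum]
      exact Finset.prod_congr rfl fun q _ => by rw [Real.exp_neg, Real.exp_log (hx1 q)]
    rw [this, gaussFun, gaussFun, ← Real.exp_add, ← Real.exp_add, hv]
    congr 1
    have : planarForm (fun q => precisionStep h τ θ q - θ q) u =
        planarForm (precisionStep h τ θ) u - planarForm θ u := by
      simp only [planarForm, ← Finset.sum_sub_distrib]
      exact Finset.sum_congr rfl fun q _ => by ring
    rw [this]; ring
  have hlog0 : ∀ q, 0 ≤ Real.log (1 + h ^ 2 * θ q) := fun q => Real.log_nonneg (by linarith [hx q])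
  have hlog1 : ∀ q, Real.log (1 + h ^ 2 * θ q) ≤ h ^ 2 * θ q := fun q => by
    linarith [Real.log_le_sub_one_of_pos (hx1 q)]
  have hlog2 : ∀ q, h ^ 2 * θ q - Real.log (1 + h ^ 2 * θ q) ≤ h ^ 4 * Λ ^ 2 := fun q => by
    have h1 := Real.one_sub_inv_le_log_of_pos (hx1 q)
    have h2 : 1 - (h ^ 2 * θ q) ≤ (1 + h ^ 2 * θ q)⁻¹ := by
      rw [← one_div, le_div_iff₀ (hx1 q)]; nlinarith [sq_nonneg (h ^ 2 * θ q)]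
    have h3 : h ^ 2 * θ q - (1 - (1 + h ^ 2 * θ q)⁻¹) ≤ (h ^ 2 * θ q) ^ 2 := by
      have : (1 + h ^ 2 * θ q)⁻¹ ≤ 1 - h ^ 2 * θ q + (h ^ 2 * θ q) ^ 2 := by
        rw [← one_div, div_le_iff₀ (hx1 q)]
        nlinarith [pow_nonneg (hx q) 3]
      linarith
    have h4 : (h ^ 2 * θ q) ^ 2 ≤ h ^ 4 * Λ ^ 2 := by
      have : θ q ^ 2 ≤ Λ ^ 2 := (hθτ q).trans (hτ2 q)
      have h0 : 0 ≤ h ^ 4 := by positivity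
      nlinarith [mul_le_mul_of_nonneg_left this h0]
    linarith
  have hd0 : ∀ q, 0 ≤ precisionStep h τ θ q - θ q := fun q => by
    rw [hdiff]; exact div_nonneg (mul_nonneg (sq_nonneg _) (sub_nonneg.2 (hθτ q))) (hx1 q).le
  have hd1 : ∀ q, |precisionStep h τ θ q - θ q| ≤ h ^ 2 * Λ ^ 2 := fun q => by
    rw [abs_of_nonneg (hd0 q), hdiff]
    refine (div_le_self (mul_nonneg (sq_nonneg _) (sub_nonneg.2 (hθτ q))) (by linarith [hx q])).trans ?_
    exact mul_le_mul_of_nonneg_left (by linarith [hτ2 q, sq_nonneg (θ q)]) (sq_nonneg _)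
  have hd2 : ∀ q, |(precisionStep h τ θ q - θ q) + h ^ 2 * (θ q ^ 2 - τ q ^ 2)| ≤ h ^ 4 * Λ ^ 3 := by
    intro q
    have : (precisionStep h τ θ q - θ q) + h ^ 2 * (θ q ^ 2 - τ q ^ 2) =
        -(h ^ 4 * θ q * (τ q ^ 2 - θ q ^ 2) / (1 + h ^ 2 * θ q)) := by
      have := (hx1 q).ne'
      rw [hdiff]; field_simp; ring
    have h0 : 0 ≤ h ^ 4 * θ q * (τ q ^ 2 - θ q ^ 2) :=
      mul_nonneg (mul_nonneg (by positivity) (hθ0 q)) (sub_nonneg.2 (hθτ q))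
    rw [this, abs_neg, abs_of_nonneg (div_nonneg h0 (hx1 q).le)]
    refine (div_le_self h0 (by linarith [hx q])).trans ?_
    have h1 : θ q * (τ q ^ 2 - θ q ^ 2) ≤ Λ * Λ ^ 2 :=
      mul_le_mul ((hθ q).trans (hτ q)) (by linarith [hτ2 q, sq_nonneg (θ q)])
        (sub_nonneg.2 (hθτ q)) hΛ
    have h2 : 0 ≤ h ^ 4 := by positivity
    nlinarith [mul_le_mul_of_nonneg_left h1 h2]
  have hp0 := planarForm_nonneg hd0 u
  have hp1 := abs_planarForm_le hd1 u (by positivity)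
  have hp2 := abs_planarForm_le hd2 u (by positivity)
  have hsum0 : 0 ≤ ∑ q, Real.log (1 + h ^ 2 * θ q) := Finset.sum_nonneg fun q _ => hlog0 q
  have hsum1 : ∑ q, Real.log (1 + h ^ 2 * θ q) ≤ h ^ 2 * (Fintype.card Q * Λ) := by
    calc _ ≤ ∑ _q : Q, h ^ 2 * Λ := Finset.sum_le_sum fun q _ => (hlog1 q).trans
          (mul_le_mul_of_nonneg_left ((hθ q).trans (hτ q)) (sq_nonneg _))
      _ = _ := by simp; ring
  have hvneg : v ≤ 0 := by rw [hv]; linarith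
  have hvabs : |v| ≤ h ^ 2 * (Fintype.card Q * Λ + Λ ^ 2) * (1 + U) ^ 2 := by
    rw [abs_of_nonpos hvneg, hv]
    have := (abs_le.1 hp1).2
    have h1 : h ^ 2 * (Fintype.card Q * Λ) ≤ h ^ 2 * (Fintype.card Q * Λ) * (1 + U) ^ 2 :=
      le_mul_of_one_le_right (by positivity) (by nlinarith)
    have h2 : h ^ 2 * Λ ^ 2 * U ^ 2 ≤ h ^ 2 * Λ ^ 2 * (1 + U) ^ 2 := by gcongr; linarith
    linarith
  have hvv0 : |v - v0| ≤ (Fintype.card Q * Λ ^ 2 + Λ ^ 3) * h ^ 4 * (1 + U) ^ 4 := by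
    have e2 : v - v0 = (∑ q, (h ^ 2 * θ q - Real.log (1 + h ^ 2 * θ q))) -
        1 / 2 * planarForm (fun q => (precisionStep h τ θ q - θ q) +
          h ^ 2 * (θ q ^ 2 - τ q ^ 2)) u := by
      rw [hv, hv0]
      have : planarForm (fun q => (precisionStep h τ θ q - θ q) + h ^ 2 * (θ q ^ 2 - τ q ^ 2)) u =
          planarForm (fun q => precisionStep h τ θ q - θ q) u +
            h ^ 2 * planarForm (fun q => θ q ^ 2 - τ q ^ 2) u := by
        simp only [planarForm, Finset.mul_sum, ← Finset.sum_add_distrib]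
        exact Finset.sum_congr rfl fun q _ => by ring
      rw [this, Finset.sum_sub_distrib, Finset.mul_sum]; ring
    have h1 : |∑ q, (h ^ 2 * θ q - Real.log (1 + h ^ 2 * θ q))| ≤ Fintype.card Q * Λ ^ 2 * h ^ 4 := by
      rw [abs_of_nonneg (Finset.sum_nonneg fun q _ => sub_nonneg.2 (hlog1 q))]
      calc _ ≤ ∑ _q : Q, h ^ 4 * Λ ^ 2 := Finset.sum_le_sum fun q _ => hlog2 q
        _ = _ := by simp; ring
    have h2 : Fintype.card Q * Λ ^ 2 * h ^ 4 ≤ Fintype.card Q * Λ ^ 2 * h ^ 4 * (1 + U) ^ 4 :=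
      le_mul_of_one_le_right (by positivity) (one_le_pow₀ (by linarith))
    have h3 : h ^ 4 * Λ ^ 3 * U ^ 2 ≤ h ^ 4 * Λ ^ 3 * (1 + U) ^ 4 := by
      refine mul_le_mul_of_nonneg_left ?_ (by positivity)
      calc U ^ 2 ≤ (1 + U) ^ 2 := by gcongr; linarith
        _ ≤ (1 + U) ^ 4 := pow_le_pow_right₀ (by linarith) (by norm_num)
    have h4 : 0 ≤ h ^ 4 * Λ ^ 3 * U ^ 2 := by positivity
    rw [e2]
    refine (abs_sub _ _).trans ?_
    rw [abs_mul, abs_of_nonneg (by norm_num : (0 : ℝ) ≤ 1 / 2)]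
    linarith
  have e3 : (1 - h ^ 2 * ∑ q, θ q + h ^ 2 / 2 * planarForm (fun q => θ q ^ 2 - τ q ^ 2) u) =
      1 + v0 := by rw [hv0]; ring
  have h5 := abs_exp_sub_one_sub_id_le_sq hvneg
  have h6 : v ^ 2 ≤ (Fintype.card Q * Λ + Λ ^ 2) ^ 2 * h ^ 4 * (1 + U) ^ 4 := by
    rw [← sq_abs]
    calc |v| ^ 2 ≤ (h ^ 2 * (Fintype.card Q * Λ + Λ ^ 2) * (1 + U) ^ 2) ^ 2 := by gcongr
      _ = _ := by ring
  rw [e1, e3, ← mul_sub, abs_mul, abs_of_pos (gaussFun_pos θ u)]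
  refine (mul_le_of_le_one_left (abs_nonneg _) (gaussFun_le_one hθ0 u)).trans ?_
  calc |Real.exp v - (1 + v0)| = |(Real.exp v - 1 - v) + (v - v0)| := by congr 1; ring
    _ ≤ _ := (abs_add_le _ _).trans (by linarith)

variable {μ : Measure (Q ⊕ Q → ℝ)} [IsProbabilityMeasure μ] {M γ : ℝ}

theorem IsNearlyIsotropic.norm_integral_sq_sub_le [DecidableEq Q] (hμ : IsNearlyIsotropic μ M γ)
    (c : Q ⊕ Q → ℂ) :
    ‖∫ z, (∑ r, c r * z r) ^ 2 ∂μ - ∑ r, c r ^ 2‖ ≤ γ * (∑ r, ‖c r‖) ^ 2 := by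
  have hI : ∀ r s, Integrable (fun z : Q ⊕ Q → ℝ => c r * c s * ((z r * z s : ℝ) : ℂ)) μ :=
    fun r s => ((hμ.integrable_mul r s).ofReal).const_mul _
  have e1 : ∫ z, (∑ r, c r * z r) ^ 2 ∂μ = ∑ r, ∑ s, c r * c s * ((∫ z, z r * z s ∂μ : ℝ) : ℂ) := by
    have : ∀ z : Q ⊕ Q → ℝ, (∑ r, c r * z r) ^ 2 = ∑ r, ∑ s, c r * c s * ((z r * z s : ℝ) : ℂ) := by
      intro z
      rw [sq, Finset.sum_mul_sum]
      refine Finset.sum_congr rfl fun r _ => Finset.sum_congr rfl fun s _ => ?_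
      push_cast; ring
    simp_rw [this]
    rw [integral_finsetSum _ fun r _ => integrable_finsetSum _ fun s _ => hI r s]
    refine Finset.sum_congr rfl fun r _ => ?_
    rw [integral_finsetSum _ fun s _ => hI r s]
    refine Finset.sum_congr rfl fun s _ => ?_
    rw [integral_const_mul]
    exact congrArg _ integral_ofReal
  have e2 : ∑ r, c r ^ 2 = ∑ r, ∑ s, c r * c s * (if r = s then (1 : ℂ) else 0) := by
    refine Finset.sum_congr rfl fun r _ => ?_
    simp [sq]
  rw [e1, e2, ← Finset.sum_sub_distrib, sq, Finset.sum_mul_sum, Finset.mul_sum]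
  refine (norm_sum_le _ _).trans (Finset.sum_le_sum fun r _ => ?_)
  rw [← Finset.sum_sub_distrib, Finset.mul_sum]
  refine (norm_sum_le _ _).trans (Finset.sum_le_sum fun s _ => ?_)
  rw [← mul_sub, norm_mul, norm_mul, mul_comm γ]
  refine mul_le_mul_of_nonneg_left ?_ (by positivity)
  split_ifs with hrs
  · subst hrs
    have := hμ.cov_self r
    rw [← Real.norm_eq_abs, ← Complex.norm_real] at this
    simpa [sq] using this
  · have := hμ.cov r s hrs
    rw [← Real.norm_eq_abs, ← Complex.norm_real] at this
    simpa using this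

/-- A centred step with nearly identity covariance acts on Gaussian functions almost as a Gaussian
step does. Three errors are added: the Taylor remainder of order `h³`, the covariance defect of
order `γ h²`, and the expansion of the closed form of order `h⁴`. The coefficient of the defect does
not involve `M`. -/
theorem norm_integral_gaussFun_sub_le [DecidableEq Q] (hμ : IsNearlyIsotropic μ M γ) (hM : 0 ≤ M)
    (hγ : 0 ≤ γ)
    {e h Λ : ℝ} {τ θ : Q → ℝ} (he : |e| = 1) (hh0 : 0 ≤ h) (hh1 : h ≤ 1) (hτ : ∀ q, |τ q| ≤ Λ)
    (hθ0 : ∀ q, 0 ≤ θ q) (hθ : ∀ q, θ q ≤ |τ q|) (hΛ : 0 ≤ Λ) (u : Q ⊕ Q → ℝ) :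
    ‖∫ z, Complex.exp ((e * h * sympForm τ u z : ℝ) * Complex.I) *
          (gaussFun θ (u + h • z) : ℝ) ∂μ -
        ((∏ q, (1 + h ^ 2 * θ q)⁻¹) * gaussFun (precisionStep h τ θ) u : ℝ)‖ ≤
      (Fintype.card Q * Λ + 2 * Λ ^ 2) * γ * h ^ 2 * (1 + ∑ r, |u r|) ^ 2 +
      (32 * (2 * Λ * M + 2 * Λ * (Fintype.card Q * M) ^ 2) ^ 3 +
        2 * (2 * Λ * M + 2 * Λ * (Fintype.card Q * M) ^ 2) ^ 2 +
        ((Fintype.card Q * Λ + Λ ^ 2) ^ 2 + Fintype.card Q * Λ ^ 2 + Λ ^ 3)) * h ^ 3 *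
        (1 + ∑ r, |u r|) ^ 4 := by
  have hdet := abs_prod_mul_gaussFun_sub_le (h := h) hτ hθ0 hθ hΛ u
  set K : ℝ := 2 * Λ * M + 2 * Λ * (Fintype.card Q * M) ^ 2 with hK
  set C₀ : ℝ := (Fintype.card Q * Λ + Λ ^ 2) ^ 2 + Fintype.card Q * Λ ^ 2 + Λ ^ 3
  set U := ∑ r, |u r| with hU
  have hU0 : 0 ≤ U := Finset.sum_nonneg fun r _ => abs_nonneg _
  have hC₀ : 0 ≤ C₀ := by positivity
  have hK0 : 0 ≤ K := by positivity
  have hθΛ : ∀ q, θ q ≤ Λ := fun q => (hθ q).trans (hτ q)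
  have hell := norm_driftVec_le he hτ hθ0 hθΛ u
  have he2 : e ^ 2 = 1 := by rw [← sq_abs, he, one_pow]
  set c := driftVec e τ θ u with hc
  have hsq := hμ.norm_integral_sq_sub_le c
  rw [sum_driftVec_sq he2] at hsq
  set g := gaussFun θ u with hg
  have hg0 : 0 ≤ g := (gaussFun_pos θ u).le
  have hg1 : g ≤ 1 := gaussFun_le_one hθ0 u
  -- pointwise Taylor estimate
  set T : (Q ⊕ Q → ℝ) → ℂ := fun z => 1 + h * driftForm e τ θ u z -
    h ^ 2 * ((1 / 2 * planarForm θ z : ℝ) : ℂ) + h ^ 2 * driftForm e τ θ u z ^ 2 / 2 with hT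
  have hpt : ∀ᵐ z ∂μ, ‖Complex.exp ((e * h * sympForm τ u z : ℝ) * Complex.I) *
      (gaussFun θ (u + h • z) : ℝ) - g * T z‖ ≤ (32 * K ^ 3 + 2 * K ^ 2) * h ^ 3 * (1 + U) ^ 3 := by
    filter_upwards [hμ.bounded] with z hz
    have hexp := exp_sympForm_mul_gaussFun e h τ θ u z
    rw [hexp, ← mul_sub, norm_mul, Complex.norm_real, Real.norm_of_nonneg hg0]
    refine mul_norm_exp_linear_sub_quadratic_le hg0 hg1 ?_ ?_ ?_ ?_ hh0 hh1 hU0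
    · have : ‖(g : ℂ) * Complex.exp (h * driftForm e τ θ u z -
          h ^ 2 * ((1 / 2) * planarForm θ z : ℝ))‖ ≤ 1 := by
        rw [← hexp, norm_mul, Complex.norm_exp_ofReal_mul_I, one_mul, Complex.norm_real,
          Real.norm_of_nonneg (gaussFun_pos _ _).le]
        exact gaussFun_le_one hθ0 _
      rwa [norm_mul, Complex.norm_real, Real.norm_of_nonneg hg0] at this
    · have h1 : ‖driftForm e τ θ u z‖ ≤ 2 * Λ * U * M := by
        refine (norm_sum_le _ _).trans ?_
        calc ∑ r, ‖driftVec e τ θ u r * z r‖ ≤ ∑ r, ‖c r‖ * M := by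
              refine Finset.sum_le_sum fun r _ => ?_
              rw [norm_mul, Complex.norm_real]
              exact mul_le_mul_of_nonneg_left (hz r) (norm_nonneg _)
          _ = (∑ r, ‖c r‖) * M := by rw [Finset.sum_mul]
          _ ≤ _ := mul_le_mul_of_nonneg_right hell hM
      have h2 : 0 ≤ 2 * Λ * (Fintype.card Q * M) ^ 2 := by positivity
      have h3 : 0 ≤ 2 * Λ * M := by positivity
      nlinarith [mul_nonneg h2 hU0]
    · linarith [planarForm_nonneg hθ0 z]
    · have h1 := (abs_le.1 (abs_planarForm_le
        (fun q => (abs_of_nonneg (hθ0 q)).le.trans (hθΛ q)) z hΛ)).2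
      have h2 : ∑ r, |z r| ≤ 2 * (Fintype.card Q * M) := by
        calc ∑ r, |z r| ≤ ∑ _r : Q ⊕ Q, M := Finset.sum_le_sum fun r _ => hz r
          _ = _ := by simp; ring
      have h3 : (∑ r, |z r|) ^ 2 ≤ (2 * (Fintype.card Q * M)) ^ 2 :=
        pow_le_pow_left₀ (Finset.sum_nonneg fun r _ => abs_nonneg _) h2 2
      have h4 := mul_le_mul_of_nonneg_left h3 hΛ
      have h5 : 0 ≤ 2 * Λ * M := by positivity
      linarith
  -- integral of the Taylor polynomial
  have hmeasL : Measurable fun z : Q ⊕ Q → ℝ => driftForm e τ θ u z := by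
    unfold driftForm; fun_prop
  have hmeasD : Measurable fun z : Q ⊕ Q → ℝ => planarForm θ z := by
    unfold planarForm; fun_prop
  have hIc : ∀ r, Integrable (fun z : Q ⊕ Q → ℝ => c r * (z r : ℂ)) μ :=
    fun r => (hμ.integrable r).ofReal.const_mul _
  have hIL : Integrable (fun z => driftForm e τ θ u z) μ :=
    integrable_finsetSum _ fun r _ => hIc r
  have hIL2 : Integrable (fun z => driftForm e τ θ u z ^ 2) μ := by
    have : (fun z => driftForm e τ θ u z ^ 2) =
        fun z : Q ⊕ Q → ℝ => ∑ r, ∑ s, c r * c s * ((z r * z s : ℝ) : ℂ) := by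
      funext z
      rw [driftForm, sq, Finset.sum_mul_sum]
      refine Finset.sum_congr rfl fun r _ => Finset.sum_congr rfl fun s _ => ?_
      push_cast; ring
    rw [this]
    exact integrable_finsetSum _ fun r _ => integrable_finsetSum _ fun s _ =>
      ((hμ.integrable_mul r s).ofReal).const_mul _
  have hIz : ∀ r, Integrable (fun z : Q ⊕ Q → ℝ => z r ^ 2) μ := fun r => by
    simpa [sq] using hμ.integrable_mul r r
  have hIDq : ∀ q, Integrable (fun z : Q ⊕ Q → ℝ => θ q * (z (.inl q) ^ 2 + z (.inr q) ^ 2)) μ :=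
    fun q => ((hIz _).add (hIz _)).const_mul _
  have hID : Integrable (fun z => planarForm θ z) μ := integrable_finsetSum _ fun q _ => hIDq q
  have hID' : Integrable (fun z => ((1 / 2 * planarForm θ z : ℝ) : ℂ)) μ :=
    (hID.const_mul _).ofReal
  have hL0 : ∫ z, driftForm e τ θ u z ∂μ = 0 := by
    unfold driftForm
    rw [integral_finsetSum _ fun r _ => hIc r]
    refine Finset.sum_eq_zero fun r _ => ?_
    rw [integral_const_mul]
    have : ∫ z : Q ⊕ Q → ℝ, (z r : ℂ) ∂μ = ((∫ z, z r ∂μ : ℝ) : ℂ) := integral_ofReal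
    rw [this, hμ.mean r]; simp
  have hD1 : |∫ z, planarForm θ z ∂μ - 2 * ∑ q, θ q| ≤ 2 * Fintype.card Q * Λ * γ := by
    have e1 : ∫ z, planarForm θ z ∂μ - 2 * ∑ q, θ q =
        ∑ q, θ q * ((∫ z, z (.inl q) ^ 2 ∂μ - 1) + (∫ z, z (.inr q) ^ 2 ∂μ - 1)) := by
      unfold planarForm
      rw [integral_finsetSum _ fun q _ => hIDq q, Finset.mul_sum, ← Finset.sum_sub_distrib]
      refine Finset.sum_congr rfl fun q _ => ?_
      rw [integral_const_mul, integral_add (hIz _) (hIz _)]; ring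
    rw [e1]
    calc _ ≤ ∑ _q : Q, Λ * (2 * γ) := by
          refine (Finset.abs_sum_le_sum_abs _ _).trans (Finset.sum_le_sum fun q _ => ?_)
          rw [abs_mul, abs_of_nonneg (hθ0 q)]
          refine mul_le_mul (hθΛ q) ((abs_add_le _ _).trans ?_) (abs_nonneg _) hΛ
          linarith [hμ.cov_self (.inl q), hμ.cov_self (.inr q)]
      _ = _ := by simp; ring
  have hIT : Integrable T μ := by
    refine Integrable.add (((integrable_const _).add (hIL.const_mul _)).sub (hID'.const_mul _)) ?_
    exact (hIL2.const_mul _).div_const _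
  have hT1 : ∫ z, T z ∂μ = 1 - h ^ 2 * ((1 / 2 * ∫ z, planarForm θ z ∂μ : ℝ) : ℂ) +
      h ^ 2 / 2 * ∫ z, driftForm e τ θ u z ^ 2 ∂μ := by
    have a1 : Integrable (fun z => (1 : ℂ) + h * driftForm e τ θ u z) μ :=
      (integrable_const _).add (hIL.const_mul _)
    have a2 : Integrable (fun z => (h : ℂ) ^ 2 * ((1 / 2 * planarForm θ z : ℝ) : ℂ)) μ :=
      hID'.const_mul _
    have a3 : Integrable (fun z => (h : ℂ) ^ 2 * driftForm e τ θ u z ^ 2 / 2) μ :=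
      (hIL2.const_mul _).div_const _
    have a4 : ∫ z, ((1 / 2 * planarForm θ z : ℝ) : ℂ) ∂μ =
        ((1 / 2 * ∫ z, planarForm θ z ∂μ : ℝ) : ℂ) := by
      rw [← integral_const_mul]; exact integral_ofReal
    have a12 : Integrable (fun z => (1 : ℂ) + h * driftForm e τ θ u z -
        (h : ℂ) ^ 2 * ((1 / 2 * planarForm θ z : ℝ) : ℂ)) μ := a1.sub a2
    simp only [hT]
    rw [integral_add a12 a3, integral_sub a1 a2, integral_add (integrable_const _)
      (hIL.const_mul _), integral_const_mul, integral_const_mul, hL0, a4]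
    simp only [mul_div_right_comm, integral_const_mul]
    simp
  have hT2 : ‖∫ z, T z ∂μ - ((1 - h ^ 2 * ∑ q, θ q +
      h ^ 2 / 2 * planarForm (fun q => θ q ^ 2 - τ q ^ 2) u : ℝ) : ℂ)‖ ≤
      (Fintype.card Q * Λ + 2 * Λ ^ 2) * γ * h ^ 2 * (1 + U) ^ 2 := by
    have e1 : ∫ z, T z ∂μ - ((1 - h ^ 2 * ∑ q, θ q +
        h ^ 2 / 2 * planarForm (fun q => θ q ^ 2 - τ q ^ 2) u : ℝ) : ℂ) =
        ((-(h ^ 2 / 2) * (∫ z, planarForm θ z ∂μ - 2 * ∑ q, θ q) : ℝ) : ℂ) +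
        ((h ^ 2 / 2 : ℝ) : ℂ) * (∫ z, driftForm e τ θ u z ^ 2 ∂μ -
          (planarForm (fun q => θ q ^ 2 - τ q ^ 2) u : ℝ)) := by
      rw [hT1]; push_cast; ring
    have hh : 0 ≤ h ^ 2 / 2 := by positivity
    have b1 : γ * (∑ r, ‖c r‖) ^ 2 ≤ 4 * Λ ^ 2 * γ * (1 + U) ^ 2 := by
      calc γ * (∑ r, ‖c r‖) ^ 2 ≤ γ * (2 * Λ * (1 + U)) ^ 2 := by
            gcongr
            exact hell.trans (by gcongr; linarith)
        _ = _ := by ring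
    have b2 : Fintype.card Q * Λ * γ ≤ Fintype.card Q * Λ * γ * (1 + U) ^ 2 :=
      le_mul_of_one_le_right (by linarith [(abs_nonneg _).trans hD1]) (by nlinarith)
    rw [e1]
    refine (norm_add_le _ _).trans ?_
    rw [norm_mul, Complex.norm_real, Complex.norm_real, norm_mul, Real.norm_eq_abs,
      Real.norm_eq_abs, Real.norm_eq_abs, abs_neg, abs_of_nonneg hh, ← mul_add]
    calc h ^ 2 / 2 * _ ≤ h ^ 2 / 2 * (2 * (Fintype.card Q * Λ * γ * (1 + U) ^ 2) +
          4 * Λ ^ 2 * γ * (1 + U) ^ 2) := by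
          refine mul_le_mul_of_nonneg_left ?_ hh
          exact add_le_add (by linarith) (hsq.trans b1)
      _ = _ := by ring
  have hmeasE : Measurable fun z : Q ⊕ Q → ℝ =>
      Complex.exp ((e * h * sympForm τ u z : ℝ) * Complex.I) * (gaussFun θ (u + h • z) : ℝ) := by
    unfold sympForm gaussFun planarForm; fun_prop
  have hIE : Integrable (fun z : Q ⊕ Q → ℝ =>
      Complex.exp ((e * h * sympForm τ u z : ℝ) * Complex.I) * (gaussFun θ (u + h • z) : ℝ)) μ := by
    refine Integrable.of_bound hmeasE.aestronglyMeasurable 1 (ae_of_all _ fun z => ?_)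
    rw [norm_mul, Complex.norm_exp_ofReal_mul_I, one_mul, Complex.norm_real,
      Real.norm_of_nonneg (gaussFun_pos _ _).le]
    exact gaussFun_le_one hθ0 _
  have hdiff : ‖∫ z, Complex.exp ((e * h * sympForm τ u z : ℝ) * Complex.I) *
      (gaussFun θ (u + h • z) : ℝ) ∂μ - g * ∫ z, T z ∂μ‖ ≤
      (32 * K ^ 3 + 2 * K ^ 2) * h ^ 3 * (1 + U) ^ 3 := by
    rw [← integral_const_mul, ← integral_sub hIE (hIT.const_mul _)]
    simpa using norm_integral_le_of_norm_le_const hpt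
  set P₀ : ℝ := 1 - h ^ 2 * ∑ q, θ q + h ^ 2 / 2 * planarForm (fun q => θ q ^ 2 - τ q ^ 2) u
  set R : ℝ := (∏ q, (1 + h ^ 2 * θ q)⁻¹) * gaussFun (precisionStep h τ θ) u
  have hlast : ‖((g * P₀ - R : ℝ) : ℂ)‖ ≤ C₀ * h ^ 4 * (1 + U) ^ 4 := by
    rw [Complex.norm_real, Real.norm_eq_abs, abs_sub_comm]; exact hdet
  have hmid : ‖(g : ℂ) * (∫ z, T z ∂μ - (P₀ : ℝ))‖ ≤
      (Fintype.card Q * Λ + 2 * Λ ^ 2) * γ * h ^ 2 * (1 + U) ^ 2 := by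
    rw [norm_mul, Complex.norm_real, Real.norm_of_nonneg hg0]
    exact (mul_le_of_le_one_left (norm_nonneg _) hg1).trans hT2
  have e9 : ∀ I : ℂ, I - (R : ℝ) = (I - g * ∫ z, T z ∂μ) + g * (∫ z, T z ∂μ - (P₀ : ℝ)) +
      ((g * P₀ - R : ℝ) : ℂ) := by
    intro I; push_cast; ring
  rw [e9]
  have hp3 : h ^ 4 ≤ h ^ 3 := pow_le_pow_of_le_one hh0 hh1 (by norm_num)
  have hp4 : (1 + U) ^ 3 ≤ (1 + U) ^ 4 := pow_le_pow_right₀ (by linarith) (by norm_num)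
  have f1 : (32 * K ^ 3 + 2 * K ^ 2) * h ^ 3 * (1 + U) ^ 3 ≤
      (32 * K ^ 3 + 2 * K ^ 2) * h ^ 3 * (1 + U) ^ 4 := by gcongr
  have f2 : C₀ * h ^ 4 * (1 + U) ^ 4 ≤ C₀ * h ^ 3 * (1 + U) ^ 4 := by gcongr
  refine (norm_add₃_le).trans ?_
  linarith

end Step

/-! ### Independence of the past -/

section Independence

variable {Ω : Type*} [MeasurableSpace Ω] {P : Measure Ω} [IsProbabilityMeasure P]

/-- `F` factors through the restriction to `T`, and disjoint blocks of an independent family are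
independent. -/
theorem indepFun_of_depends_on {ι E β : Type*} [MeasurableSpace E] [MeasurableSpace β]
    {z : ι → Ω → E} (hz : ∀ i, Measurable (z i)) (hind : iIndepFun z P)
    (T : Finset ι) {a : ι} (ha : a ∉ T) {F : (ι → E) → β} (hF : Measurable F)
    (hdep : ∀ x y : ι → E, (∀ i ∈ T, x i = y i) → F x = F y) :
    IndepFun (fun ω => F fun i => z i ω) (z a) P := by
  classical
  obtain ⟨ω₀⟩ : Nonempty Ω := nonempty_of_isProbabilityMeasure P
  have h := hind.indepFun_finset T {a} (Finset.disjoint_singleton_right.2 ha) hz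
  -- The value outside `T` is irrelevant by `hdep`; `z a ω₀` only serves as some point of `E`.
  let ext : (T → E) → ι → E := fun v i => if hi : i ∈ T then v ⟨i, hi⟩ else z a ω₀
  have hext : Measurable ext := by
    refine measurable_pi_lambda _ fun i => ?_
    by_cases hi : i ∈ T
    · simpa [ext, hi] using measurable_pi_apply _
    · simp [ext, hi]
  have h2 := h.comp (hF.comp hext)
    (measurable_pi_apply (⟨a, Finset.mem_singleton_self a⟩ : ({a} : Finset ι)))
  have e : (fun ω => F fun i => z i ω) = (F ∘ ext) ∘ fun ω (i : T) => z i ω := by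
    funext ω
    refine hdep _ _ fun i hi => ?_
    simp [ext, hi]
  rw [e]
  exact h2

/-- Fubini for the joint law, which is a product: the past `X` is frozen while `Y` is averaged. -/
theorem integral_eq_integral_integral_of_indepFun {β γ E : Type*} [MeasurableSpace β]
    [MeasurableSpace γ] [NormedAddCommGroup E] [NormedSpace ℝ E]
    {X : Ω → β} {Y : Ω → γ} (hX : Measurable X) (hY : Measurable Y) (hXY : IndepFun X Y P)
    {H : β × γ → E} (hHm : StronglyMeasurable H)
    (hH : Integrable (fun ω => H (X ω, Y ω)) P) :
    ∫ ω, H (X ω, Y ω) ∂P = ∫ ω, ∫ y, H (X ω, y) ∂(P.map Y) ∂P := by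
  have : IsProbabilityMeasure (P.map X) := Measure.isProbabilityMeasure_map hX.aemeasurable
  have : IsProbabilityMeasure (P.map Y) := Measure.isProbabilityMeasure_map hY.aemeasurable
  have hmap := (indepFun_iff_map_prod_eq_prod_map_map hX.aemeasurable hY.aemeasurable).1 hXY
  have hI : Integrable H ((P.map X).prod (P.map Y)) := by
    rw [← hmap]
    exact (integrable_map_measure hHm.aestronglyMeasurable (hX.prodMk hY).aemeasurable).2 hH
  have h1 : ∫ ω, H (X ω, Y ω) ∂P = ∫ p, H p ∂((P.map X).prod (P.map Y)) := by
    rw [← hmap, integral_map (hX.prodMk hY).aemeasurable hHm.aestronglyMeasurable]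
  rw [h1, integral_prod _ hI, integral_map hX.aemeasurable]
  exact hHm.integral_prod_right'.aestronglyMeasurable

/-- Second moments of sums of independent bounded centred variables. -/
theorem integral_sum_pow_two_four_le {X : ℕ → Ω → ℝ} (hX : ∀ i, Measurable (X i))
    (hind : iIndepFun X P) {M v : ℝ} (hM : ∀ i, ∀ᵐ ω ∂P, |X i ω| ≤ M)
    (hmean : ∀ i, ∫ ω, X i ω ∂P = 0) (hv : ∀ i, ∫ ω, X i ω ^ 2 ∂P ≤ v) (k : ℕ) :
    ∫ ω, (∑ i ∈ Finset.range k, X i ω) ∂P = 0 ∧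
    ∫ ω, (∑ i ∈ Finset.range k, X i ω) ^ 2 ∂P ≤ k * v ∧
    ∫ ω, (∑ i ∈ Finset.range k, X i ω) ^ 4 ∂P ≤ 3 * M ^ 4 * k ^ 2 := by
  have hSm : ∀ k, Measurable fun ω => ∑ i ∈ Finset.range k, X i ω := fun k =>
    Finset.measurable_sum _ fun i _ => hX i
  have hSb : ∀ k, ∀ᵐ ω ∂P, |∑ i ∈ Finset.range k, X i ω| ≤ k * M := fun k => by
    filter_upwards [ae_all_iff.2 hM] with ω hω
    calc _ ≤ ∑ i ∈ Finset.range k, |X i ω| := Finset.abs_sum_le_sum_abs _ _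
      _ ≤ ∑ _i ∈ Finset.range k, M := Finset.sum_le_sum fun i _ => hω i
      _ = _ := by simp
  have hpow : ∀ {Y : Ω → ℝ} {B : ℝ}, Measurable Y → (∀ᵐ ω ∂P, |Y ω| ≤ B) → ∀ m : ℕ,
      Integrable (fun ω => Y ω ^ m) P := by
    intro Y B hY hB m
    refine Integrable.of_bound (hY.pow_const m).aestronglyMeasurable (B ^ m) ?_
    filter_upwards [hB] with ω hω
    rw [norm_pow]
    exact pow_le_pow_left₀ (norm_nonneg _) hω m
  have hint : ∀ {Y : Ω → ℝ} {B : ℝ}, Measurable Y → (∀ᵐ ω ∂P, |Y ω| ≤ B) → Integrable Y P := by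
    intro Y B hY hB
    exact Integrable.of_bound hY.aestronglyMeasurable B hB
  have hX2 : ∀ i, ∫ ω, X i ω ^ 2 ∂P ≤ M ^ 2 := fun i => by
    have := integral_mono_ae (hpow (hX i) (hM i) 2) (integrable_const (M ^ 2)) (by
      filter_upwards [hM i] with ω hω
      rw [← sq_abs]; exact pow_le_pow_left₀ (abs_nonneg _) hω 2)
    simpa using this
  have hX4 : ∀ i, ∫ ω, X i ω ^ 4 ∂P ≤ M ^ 4 := fun i => by
    have := integral_mono_ae (hpow (hX i) (hM i) 4) (integrable_const (M ^ 4)) (by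
      filter_upwards [hM i] with ω hω
      have : X i ω ^ 4 = |X i ω| ^ 4 := by rw [← abs_pow, abs_of_nonneg (by positivity)]
      rw [this]; exact pow_le_pow_left₀ (abs_nonneg _) hω 4)
    simpa using this
  have hindk : ∀ k, IndepFun (fun ω => ∑ i ∈ Finset.range k, X i ω) (X k) P := fun k =>
    indepFun_of_depends_on hX hind (Finset.range k) (by simp)
      (F := fun x => ∑ i ∈ Finset.range k, x i) (by fun_prop)
      (fun x y h => Finset.sum_congr rfl h)
  have hmul : ∀ k a b, ∫ ω, (∑ i ∈ Finset.range k, X i ω) ^ a * X k ω ^ b ∂P =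
      (∫ ω, (∑ i ∈ Finset.range k, X i ω) ^ a ∂P) * ∫ ω, X k ω ^ b ∂P := by
    intro k a b
    have h := (hindk k).comp (measurable_id.pow_const a) (measurable_id.pow_const b)
    exact h.integral_fun_mul_eq_mul_integral ((hSm k).pow_const a).aestronglyMeasurable
      ((hX k).pow_const b).aestronglyMeasurable
  have hmulI : ∀ k a b, Integrable (fun ω => (∑ i ∈ Finset.range k, X i ω) ^ a * X k ω ^ b) P := by
    intro k a b
    have h := (hindk k).comp (measurable_id.pow_const a) (measurable_id.pow_const b)
    exact h.integrable_mul (hpow (hSm k) (hSb k) a) (hpow (hX k) (hM k) b)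
  -- The bound `w` is left free because it is used twice: with `v` for the claim, and with `M ^ 2`
  -- inside the fourth moment.
  have hsq : ∀ k, ∀ w, (∀ i, ∫ ω, X i ω ^ 2 ∂P ≤ w) →
      (∫ ω, (∑ i ∈ Finset.range k, X i ω) ∂P = 0 ∧
        ∫ ω, (∑ i ∈ Finset.range k, X i ω) ^ 2 ∂P ≤ k * w) := by
    intro k w hw
    induction k with
    | zero => simp
    | succ k ih =>
      constructor
      · simp_rw [Finset.sum_range_succ]
        rw [integral_add (hint (hSm k) (hSb k)) (hint (hX k) (hM k)), ih.1, hmean, add_zero]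
      · have e : ∀ ω, (∑ i ∈ Finset.range (k + 1), X i ω) ^ 2 =
            (∑ i ∈ Finset.range k, X i ω) ^ 2 +
            2 * ((∑ i ∈ Finset.range k, X i ω) ^ 1 * X k ω ^ 1) + X k ω ^ 2 := fun ω => by
          rw [Finset.sum_range_succ]; ring
        simp_rw [e]
        have i1 := hpow (hSm k) (hSb k) 2
        have i2 := (hmulI k 1 1).const_mul 2
        rw [integral_add (i1.fun_add i2) (hpow (hX k) (hM k) 2), integral_add i1 i2,
          integral_const_mul, hmul]
        simp only [pow_one, hmean, mul_zero, add_zero]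
        push_cast
        linarith [ih.2, hw k]
  refine ⟨(hsq k v hv).1, (hsq k v hv).2, ?_⟩
  -- The binomial terms with a first power of the old sum or of the new variable vanish. The
  -- increment is thus at most `6 k M ^ 4 + M ^ 4`, which is below `3 M ^ 4 ((k + 1) ^ 2 - k ^ 2)`.
  induction k with
  | zero => simp
  | succ k ih =>
    have e : ∀ ω, (∑ i ∈ Finset.range (k + 1), X i ω) ^ 4 =
        (∑ i ∈ Finset.range k, X i ω) ^ 4 +
        4 * ((∑ i ∈ Finset.range k, X i ω) ^ 3 * X k ω ^ 1) +
        6 * ((∑ i ∈ Finset.range k, X i ω) ^ 2 * X k ω ^ 2) +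
        4 * ((∑ i ∈ Finset.range k, X i ω) ^ 1 * X k ω ^ 3) + X k ω ^ 4 := fun ω => by
      rw [Finset.sum_range_succ]; ring
    simp_rw [e]
    have i0 := hpow (hSm k) (hSb k) 4
    have i1 := (hmulI k 3 1).const_mul 4
    have i2 := (hmulI k 2 2).const_mul 6
    have i3 := (hmulI k 1 3).const_mul 4
    have i01 := i0.fun_add i1
    have i012 := i01.fun_add i2
    have i0123 := i012.fun_add i3
    have hk := hsq k (M ^ 2) hX2
    rw [integral_add i0123 (hpow (hX k) (hM k) 4), integral_add i012 i3, integral_add i01 i2,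
      integral_add i0 i1, integral_const_mul, integral_const_mul, integral_const_mul, hmul, hmul,
      hmul]
    simp only [pow_one, hmean, mul_zero, add_zero, hk.1, zero_mul]
    have h0 : 0 ≤ ∫ ω, X k ω ^ 2 ∂P := integral_nonneg fun ω => by positivity
    have h1 : (∫ ω, (∑ i ∈ Finset.range k, X i ω) ^ 2 ∂P) * ∫ ω, X k ω ^ 2 ∂P ≤
        (k * M ^ 2) * M ^ 2 :=
      mul_le_mul hk.2 (hX2 k) h0 (by positivity)
    have h4 : 0 ≤ M ^ 4 := by positivity
    push_cast
    nlinarith [hX4 k]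

end Independence

/-! ### Finite versions of the hyperbolic functions -/

/-- `((1 + s)^m + (1 - s)^m) / 2`, which tends to `cosh t` when `s = t / m`. -/
def coshPoly (m : ℕ) (s : ℝ) : ℝ := ((1 + s) ^ m + (1 - s) ^ m) / 2

def sinhPoly (m : ℕ) (s : ℝ) : ℝ := ((1 + s) ^ m - (1 - s) ^ m) / 2

theorem coshPoly_succ (m : ℕ) (s : ℝ) : coshPoly (m + 1) s = coshPoly m s + s * sinhPoly m s := by
  unfold coshPoly sinhPoly; ring

theorem sinhPoly_succ (m : ℕ) (s : ℝ) : sinhPoly (m + 1) s = sinhPoly m s + s * coshPoly m s := by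
  unfold coshPoly sinhPoly; ring

/-- Bernoulli's inequality for both powers; the linear terms cancel. -/
theorem one_le_coshPoly (m : ℕ) {s : ℝ} (hs : |s| ≤ 1) : 1 ≤ coshPoly m s := by
  have h := abs_le.1 hs
  have h1 := one_add_mul_le_pow (a := s) (by linarith) m
  have h2 := one_add_mul_le_pow (a := -s) (by linarith) m
  rw [← sub_eq_add_neg] at h2
  unfold coshPoly
  linarith

theorem mul_sinhPoly_nonneg (m : ℕ) {s : ℝ} (hs : |s| ≤ 1) : 0 ≤ s * sinhPoly m s := by
  have h := abs_le.1 hs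
  unfold sinhPoly
  rcases le_total 0 s with h0 | h0
  · have := pow_le_pow_left₀ (by linarith : 0 ≤ 1 - s) (by linarith : 1 - s ≤ 1 + s) m
    exact mul_nonneg h0 (by linarith)
  · have := pow_le_pow_left₀ (by linarith : 0 ≤ 1 + s) (by linarith : 1 + s ≤ 1 - s) m
    exact mul_nonneg_of_nonpos_of_nonpos h0 (by linarith)

theorem abs_sinhPoly_le (m : ℕ) {s : ℝ} (hs : |s| ≤ 1) : |sinhPoly m s| ≤ coshPoly m s := by
  have h := abs_le.1 hs
  have h1 := pow_nonneg (by linarith : 0 ≤ 1 - s) m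
  have h2 := pow_nonneg (by linarith : 0 ≤ 1 + s) m
  unfold sinhPoly coshPoly
  rw [abs_le]
  constructor <;> linarith

theorem tendsto_coshPoly (t : ℝ) :
    Tendsto (fun n : ℕ => coshPoly n (t / n)) atTop (𝓝 (Real.cosh t)) := by
  have h1 := Real.tendsto_one_add_div_pow_exp t
  have h2 := Real.tendsto_one_add_div_pow_exp (-t)
  rw [Real.cosh_eq]
  refine ((h1.add h2).div_const 2).congr fun n => ?_
  simp only [coshPoly, neg_div, sub_eq_add_neg]

/-- The precisions of the Gaussian functions `m` steps before the end. -/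
def precision {Q : Type*} (h : ℝ) (τ : Q → ℝ) (m : ℕ) (q : Q) : ℝ :=
  τ q * sinhPoly m (h ^ 2 * τ q) / coshPoly m (h ^ 2 * τ q)

/-! ### The exact solution of the recursion for the precisions. -/

section Precision

variable {Q : Type*} {h : ℝ} {τ : Q → ℝ}

theorem precision_zero : precision h τ 0 = 0 := by
  funext q; simp [precision, sinhPoly]

theorem one_add_mul_precision (hs : ∀ q, |h ^ 2 * τ q| ≤ 1) (m : ℕ) (q : Q) :
    1 + h ^ 2 * precision h τ m q = coshPoly (m + 1) (h ^ 2 * τ q) / coshPoly m (h ^ 2 * τ q) := by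
  have := (zero_lt_one.trans_le (one_le_coshPoly m (hs q))).ne'
  rw [precision, coshPoly_succ]
  field_simp

/-- The addition rules for `coshPoly` and `sinhPoly` at `s = h² τ` make the discrete `τ tanh` an
exact solution of the discretised Riccati equation. Hence solving the recursion adds no error. -/
theorem precision_succ (hs : ∀ q, |h ^ 2 * τ q| ≤ 1) (m : ℕ) :
    precisionStep h τ (precision h τ m) = precision h τ (m + 1) := by
  funext q
  have h0 := (zero_lt_one.trans_le (one_le_coshPoly m (hs q))).ne'
  have h1 := (zero_lt_one.trans_le (one_le_coshPoly (m + 1) (hs q))).ne'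
  rw [precisionStep, one_add_mul_precision hs, precision, precision, sinhPoly_succ]
  generalize coshPoly (m + 1) (h ^ 2 * τ q) = c₁ at *
  generalize coshPoly m (h ^ 2 * τ q) = c₀ at *
  generalize sinhPoly m (h ^ 2 * τ q) = s₀ at *
  field_simp

theorem precision_nonneg (hs : ∀ q, |h ^ 2 * τ q| ≤ 1) (m : ℕ) (q : Q) : 0 ≤ precision h τ m q := by
  rcases eq_or_ne h 0 with rfl | hh
  · simp [precision, sinhPoly]
  · refine div_nonneg ?_ (zero_le_one.trans (one_le_coshPoly m (hs q)))
    have := mul_sinhPoly_nonneg m (hs q)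
    have hh2 : 0 < h ^ 2 := by positivity
    rw [mul_assoc] at this
    exact nonneg_of_mul_nonneg_right this hh2

theorem precision_le (hs : ∀ q, |h ^ 2 * τ q| ≤ 1) (m : ℕ) (q : Q) : precision h τ m q ≤ |τ q| := by
  have h0 := zero_lt_one.trans_le (one_le_coshPoly m (hs q))
  rw [precision, div_le_iff₀ h0]
  refine (le_abs_self _).trans ?_
  rw [abs_mul]
  exact mul_le_mul_of_nonneg_left (abs_sinhPoly_le m (hs q)) (abs_nonneg _)

end Precision

/-! ### Lévy areas of random walks -/

section Walk

variable {Q : Type*}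

/-- The rescaled walk with steps `x`. -/
def walk (h : ℝ) (x : ℕ → Q ⊕ Q → ℝ) (k : ℕ) : Q ⊕ Q → ℝ := h • ∑ i ∈ Finset.range k, x i

theorem walk_apply (h : ℝ) (x : ℕ → Q ⊕ Q → ℝ) (k : ℕ) (r : Q ⊕ Q) :
    walk h x k r = h * ∑ i ∈ Finset.range k, x i r := by
  simp [walk]

theorem walk_succ (h : ℝ) (x : ℕ → Q ⊕ Q → ℝ) (k : ℕ) : walk h x (k + 1) = walk h x k + h • x k := by
  simp [walk, Finset.sum_range_succ]

theorem walk_congr (h : ℝ) {x y : ℕ → Q ⊕ Q → ℝ} {k : ℕ} (hxy : ∀ i < k, x i = y i) :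
    walk h x k = walk h y k := by
  rw [walk, walk, Finset.sum_congr rfl fun i hi => hxy i (Finset.mem_range.1 hi)]

theorem measurable_walk (h : ℝ) (k : ℕ) : Measurable fun x : ℕ → Q ⊕ Q → ℝ => walk h x k := by
  unfold walk; fun_prop

variable [Fintype Q]

/-- The rescaled signed area of the walk with steps `x`. -/
def walkArea (e : ℕ → ℝ) (h : ℝ) (τ : Q → ℝ) (x : ℕ → Q ⊕ Q → ℝ) (k : ℕ) : ℝ :=
  ∑ j ∈ Finset.range k, e j * h * sympForm τ (walk h x j) (x j)

theorem walkArea_succ (e : ℕ → ℝ) (h : ℝ) (τ : Q → ℝ) (x : ℕ → Q ⊕ Q → ℝ) (k : ℕ) :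
    walkArea e h τ x (k + 1) =
      walkArea e h τ x k + e k * h * sympForm τ (walk h x k) (x k) := by
  simp [walkArea, Finset.sum_range_succ]

theorem walkArea_eq (e : ℕ → ℝ) (h : ℝ) (τ : Q → ℝ) (x : ℕ → Q ⊕ Q → ℝ) (k : ℕ) :
    walkArea e h τ x k =
      h ^ 2 * ∑ j ∈ Finset.range k, ∑ i ∈ Finset.range j, e j * sympForm τ (x i) (x j) := by
  rw [walkArea, Finset.mul_sum]
  refine Finset.sum_congr rfl fun j _ => ?_
  have : sympForm τ (walk h x j) (x j) = h * ∑ i ∈ Finset.range j, sympForm τ (x i) (x j) := by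
    simp only [sympForm, walk_apply]
    rw [Finset.sum_comm, Finset.mul_sum]
    refine Finset.sum_congr rfl fun q _ => ?_
    rw [← Finset.mul_sum, Finset.sum_sub_distrib, ← Finset.sum_mul, ← Finset.sum_mul]
    ring
  rw [this, ← Finset.mul_sum]
  ring

theorem walkArea_congr (e : ℕ → ℝ) (h : ℝ) (τ : Q → ℝ) {x y : ℕ → Q ⊕ Q → ℝ} {k : ℕ}
    (hxy : ∀ i < k, x i = y i) : walkArea e h τ x k = walkArea e h τ y k := by
  refine Finset.sum_congr rfl fun j hj => ?_
  have hj' := Finset.mem_range.1 hj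
  rw [walk_congr h fun i hi => hxy i (hi.trans hj'), hxy j hj']

theorem measurable_sympForm (τ : Q → ℝ) :
    Measurable fun p : (Q ⊕ Q → ℝ) × (Q ⊕ Q → ℝ) => sympForm τ p.1 p.2 := by
  unfold sympForm; fun_prop

theorem measurable_walkArea (e : ℕ → ℝ) (h : ℝ) (τ : Q → ℝ) (k : ℕ) :
    Measurable fun x : ℕ → Q ⊕ Q → ℝ => walkArea e h τ x k := by
  unfold walkArea
  refine Finset.measurable_sum _ fun j _ => Measurable.const_mul ?_ _
  exact (measurable_sympForm τ).comp ((measurable_walk h j).prodMk (measurable_pi_apply j))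

theorem measurable_gaussFun (θ : Q → ℝ) : Measurable (gaussFun θ) := by
  unfold gaussFun planarForm; fun_prop

variable {Ω : Type*} [MeasurableSpace Ω] {P : Measure Ω} [IsProbabilityMeasure P]
  {z : ℕ → Ω → Q ⊕ Q → ℝ} {M γ : ℝ}

/-- Moment bounds for the rescaled walk. -/
theorem integral_one_add_walk_pow_le (hz : ∀ i, Measurable (z i)) (hind : iIndepFun z P)
    (hiso : ∀ i, IsNearlyIsotropic (P.map (z i)) M γ) (hγ1 : γ ≤ 1)
    {n k : ℕ} (hk : k ≤ n) {h : ℝ} (hh : h ^ 2 * n = 1) :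
    Integrable (fun ω => (1 + ∑ r, |walk h (fun i => z i ω) k r|) ^ 2) P ∧
    Integrable (fun ω => (1 + ∑ r, |walk h (fun i => z i ω) k r|) ^ 4) P ∧
    ∫ ω, (1 + ∑ r, |walk h (fun i => z i ω) k r|) ^ 2 ∂P ≤ 2 + 16 * (Fintype.card Q : ℝ) ^ 2 ∧
    ∫ ω, (1 + ∑ r, |walk h (fun i => z i ω) k r|) ^ 4 ∂P ≤
      8 + 384 * (Fintype.card Q : ℝ) ^ 4 * M ^ 4 := by
  have hzr : ∀ r i, Measurable fun ω => z i ω r := fun r i => (measurable_pi_apply r).comp (hz i)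
  have hb : ∀ i, ∀ᵐ ω ∂P, ∀ r, |z i ω r| ≤ M := fun i =>
    ae_of_ae_map (hz i).aemeasurable (hiso i).bounded
  have hmean : ∀ r i, ∫ ω, z i ω r ∂P = 0 := fun r i => by
    rw [← (hiso i).mean r, integral_map (hz i).aemeasurable
      (measurable_pi_apply r).aestronglyMeasurable]
  have hvar : ∀ r i, ∫ ω, z i ω r ^ 2 ∂P ≤ 2 := fun r i => by
    have h1 := (abs_le.1 ((hiso i).cov_self r)).2
    rw [integral_map (hz i).aemeasurable
      ((measurable_pi_apply r).pow_const 2).aestronglyMeasurable] at h1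
    linarith
  have hindr : ∀ r, iIndepFun (fun i ω => z i ω r) P := fun r =>
    hind.comp (fun _ v => v r) fun _ => measurable_pi_apply r
  have hmom : ∀ r, ∫ ω, walk h (fun i => z i ω) k r ^ 2 ∂P ≤ 2 ∧
      ∫ ω, walk h (fun i => z i ω) k r ^ 4 ∂P ≤ 3 * M ^ 4 := fun r => by
    have h1 := integral_sum_pow_two_four_le (hzr r) (hindr r)
      (fun i => (hb i).mono fun ω hω => hω r) (hmean r) (hvar r) k
    have hkn : h ^ 2 * k ≤ 1 := by
      rw [← hh]
      exact mul_le_mul_of_nonneg_left (by exact_mod_cast hk) (sq_nonneg _)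
    have hk0 : 0 ≤ h ^ 2 * k := by positivity
    constructor
    · simp_rw [walk_apply, mul_pow]
      rw [integral_const_mul]
      nlinarith [mul_le_mul_of_nonneg_left h1.2.1 (sq_nonneg h)]
    · simp_rw [walk_apply, mul_pow]
      rw [integral_const_mul]
      have h4 : 0 ≤ h ^ 4 := by positivity
      have : (h ^ 2 * k) ^ 2 ≤ 1 := pow_le_one₀ hk0 hkn
      have hM4 : 0 ≤ 3 * M ^ 4 := by positivity
      nlinarith [mul_le_mul_of_nonneg_left h1.2.2 h4, mul_le_mul_of_nonneg_left this hM4]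
  have hwm : ∀ r, Measurable fun ω => walk h (fun i => z i ω) k r := fun r => by
    have : Measurable fun ω i => z i ω := measurable_pi_lambda _ hz
    exact (measurable_pi_apply r).comp ((measurable_walk h k).comp this)
  have hwb : ∀ᵐ ω ∂P, ∀ r, |walk h (fun i => z i ω) k r| ≤ |h| * (k * M) := by
    filter_upwards [ae_all_iff.2 hb] with ω hω r
    rw [walk_apply, abs_mul]
    refine mul_le_mul_of_nonneg_left ?_ (abs_nonneg _)
    calc _ ≤ ∑ i ∈ Finset.range k, |z i ω r| := Finset.abs_sum_le_sum_abs _ _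
      _ ≤ ∑ _i ∈ Finset.range k, M := Finset.sum_le_sum fun i _ => hω i r
      _ = _ := by simp
  have hIr : ∀ r m, Integrable (fun ω => walk h (fun i => z i ω) k r ^ m) P := fun r m => by
    refine Integrable.of_bound ((hwm r).pow_const m).aestronglyMeasurable ((|h| * (k * M)) ^ m) ?_
    filter_upwards [hwb] with ω hω
    rw [norm_pow]
    exact pow_le_pow_left₀ (norm_nonneg _) (hω r) m
  have hI : ∀ m, Integrable (fun ω => (1 + ∑ r, |walk h (fun i => z i ω) k r|) ^ m) P := fun m => by
    refine Integrable.of_bound (Measurable.aestronglyMeasurable ?_)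
      ((1 + ∑ _r : Q ⊕ Q, |h| * (k * M)) ^ m) ?_
    · exact ((measurable_const.add (Finset.measurable_sum _ fun r _ => (hwm r).abs))).pow_const m
    · filter_upwards [hwb] with ω hω
      have h0 : 0 ≤ 1 + ∑ r, |walk h (fun i => z i ω) k r| := by positivity
      rw [norm_pow, Real.norm_of_nonneg h0]
      refine pow_le_pow_left₀ h0 ?_ m
      gcongr with r
      exact hω r
  have hcard : ((Finset.univ : Finset (Q ⊕ Q)).card : ℝ) = 2 * Fintype.card Q := by
    simp; ring
  set d : ℝ := (Fintype.card Q : ℝ) with hd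
  have hd0 : 0 ≤ d := Nat.cast_nonneg _
  have hU2 : ∀ u : Q ⊕ Q → ℝ, (∑ r, |u r|) ^ 2 ≤ 2 * d * ∑ r, u r ^ 2 := fun u => by
    have := sq_sum_le_card_mul_sum_sq (s := (Finset.univ : Finset (Q ⊕ Q))) (f := fun r => |u r|)
    simpa only [hcard, sq_abs] using this
  have hU4 : ∀ u : Q ⊕ Q → ℝ, (∑ r, |u r|) ^ 4 ≤ 8 * d ^ 3 * ∑ r, u r ^ 4 := fun u => by
    have h1 := sq_sum_le_card_mul_sum_sq (s := (Finset.univ : Finset (Q ⊕ Q))) (f := fun r => u r ^ 2)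
    rw [hcard] at h1
    have h2 : ∑ r, (u r ^ 2) ^ 2 = ∑ r, u r ^ 4 := Finset.sum_congr rfl fun r _ => by ring
    rw [h2] at h1
    calc (∑ r, |u r|) ^ 4 = ((∑ r, |u r|) ^ 2) ^ 2 := by ring
      _ ≤ (2 * d * ∑ r, u r ^ 2) ^ 2 := pow_le_pow_left₀ (sq_nonneg _) (hU2 u) 2
      _ = 4 * d ^ 2 * (∑ r, u r ^ 2) ^ 2 := by ring
      _ ≤ 4 * d ^ 2 * (2 * d * ∑ r, u r ^ 4) := mul_le_mul_of_nonneg_left h1 (by positivity)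
      _ = _ := by ring
  refine ⟨hI 2, hI 4, ?_, ?_⟩
  · calc _ ≤ ∫ ω, (2 + 4 * d * ∑ r, walk h (fun i => z i ω) k r ^ 2) ∂P := by
          refine integral_mono (hI 2) ((integrable_const _).add
            ((integrable_finsetSum _ fun r _ => hIr r 2).const_mul _)) fun ω => ?_
          have := hU2 (walk h (fun i => z i ω) k)
          dsimp only
          nlinarith [sq_nonneg (1 - ∑ r, |walk h (fun i => z i ω) k r|)]
      _ = 2 + 4 * d * ∑ r, ∫ ω, walk h (fun i => z i ω) k r ^ 2 ∂P := by
          rw [integral_add (integrable_const _)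
            ((integrable_finsetSum _ fun r _ => hIr r 2).const_mul _), integral_const_mul,
            integral_finsetSum _ fun r _ => hIr r 2]
          simp
      _ ≤ 2 + 4 * d * ∑ _r : Q ⊕ Q, 2 := by gcongr with r; exact (hmom r).1
      _ = _ := by rw [Finset.sum_const, nsmul_eq_mul, hcard]; ring
  · calc _ ≤ ∫ ω, (8 + 64 * d ^ 3 * ∑ r, walk h (fun i => z i ω) k r ^ 4) ∂P := by
          refine integral_mono (hI 4) ((integrable_const _).add
            ((integrable_finsetSum _ fun r _ => hIr r 4).const_mul _)) fun ω => ?_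
          have h4 := hU4 (walk h (fun i => z i ω) k)
          have h0 : 0 ≤ ∑ r, |walk h (fun i => z i ω) k r| := by positivity
          have := add_pow_le zero_le_one h0 4
          dsimp only
          norm_num [-Fintype.sum_sum_type] at this
          linarith
      _ = 8 + 64 * d ^ 3 * ∑ r, ∫ ω, walk h (fun i => z i ω) k r ^ 4 ∂P := by
          rw [integral_add (integrable_const _)
            ((integrable_finsetSum _ fun r _ => hIr r 4).const_mul _), integral_const_mul,
            integral_finsetSum _ fun r _ => hIr r 4]
          simp
      _ ≤ 8 + 64 * d ^ 3 * ∑ _r : Q ⊕ Q, 3 * M ^ 4 := by gcongr with r; exact (hmom r).2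
      _ = _ := by rw [Finset.sum_const, nsmul_eq_mul, hcard]; ring

/-- Replacing one step of the walk by its Gaussian counterpart. -/
theorem norm_integral_walk_step_le [DecidableEq Q] (hz : ∀ i, Measurable (z i)) (hind : iIndepFun z P)
    (hiso : ∀ i, IsNearlyIsotropic (P.map (z i)) M γ) (hM : 0 ≤ M) (hγ : 0 ≤ γ)
    {e : ℕ → ℝ} (he : ∀ i, |e i| = 1) {τ : Q → ℝ} {Λ : ℝ} (hΛ : 0 ≤ Λ)
    (hτ : ∀ q, |τ q| ≤ Λ) {h : ℝ} (hh0 : 0 ≤ h) (hh1 : h ≤ 1) (hs : ∀ q, |h ^ 2 * τ q| ≤ 1)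
    (k m : ℕ) {C₁ C₂ : ℝ}
    (hC₁ : C₁ = Fintype.card Q * Λ + 2 * Λ ^ 2)
    (hC₂ : C₂ = 32 * (2 * Λ * M + 2 * Λ * (Fintype.card Q * M) ^ 2) ^ 3 +
        2 * (2 * Λ * M + 2 * Λ * (Fintype.card Q * M) ^ 2) ^ 2 +
        ((Fintype.card Q * Λ + Λ ^ 2) ^ 2 + Fintype.card Q * Λ ^ 2 + Λ ^ 3))
    (hI2 : Integrable (fun ω => (1 + ∑ r, |walk h (fun i => z i ω) k r|) ^ 2) P)
    (hI4 : Integrable (fun ω => (1 + ∑ r, |walk h (fun i => z i ω) k r|) ^ 4) P) :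
    ‖∫ ω, Complex.exp ((walkArea e h τ (fun i => z i ω) (k + 1) : ℝ) * Complex.I) *
        (gaussFun (precision h τ m) (walk h (fun i => z i ω) (k + 1)) : ℝ) ∂P -
      ((∏ q, (1 + h ^ 2 * precision h τ m q)⁻¹ : ℝ) : ℂ) *
      ∫ ω, Complex.exp ((walkArea e h τ (fun i => z i ω) k : ℝ) * Complex.I) *
        (gaussFun (precision h τ (m + 1)) (walk h (fun i => z i ω) k) : ℝ) ∂P‖ ≤
      C₁ * γ * h ^ 2 * ∫ ω, (1 + ∑ r, |walk h (fun i => z i ω) k r|) ^ 2 ∂P +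
      C₂ * h ^ 3 * ∫ ω, (1 + ∑ r, |walk h (fun i => z i ω) k r|) ^ 4 ∂P := by
  have hZ : Measurable fun ω i => z i ω := measurable_pi_lambda _ hz
  have hpos : Measurable fun ω => walk h (fun i => z i ω) k := (measurable_walk h k).comp hZ
  have harea : Measurable fun ω => walkArea e h τ (fun i => z i ω) k :=
    (measurable_walkArea e h τ k).comp hZ
  have hprob : IsProbabilityMeasure (P.map (z k)) :=
    Measure.isProbabilityMeasure_map (hz k).aemeasurable
  have hθ0 := precision_nonneg hs m
  have hθ1 := precision_nonneg hs (m + 1)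
  have hind' : IndepFun (fun ω => (walkArea e h τ (fun i => z i ω) k, walk h (fun i => z i ω) k))
      (z k) P :=
    indepFun_of_depends_on hz hind (Finset.range k) (by simp)
      (F := fun x => (walkArea e h τ x k, walk h x k))
      ((measurable_walkArea e h τ k).prodMk (measurable_walk h k))
      (fun x y hxy => by
        have hxy' : ∀ i < k, x i = y i := fun i hi => hxy i (Finset.mem_range.2 hi)
        rw [walkArea_congr e h τ hxy', walk_congr h hxy'])
  set H : (ℝ × (Q ⊕ Q → ℝ)) × (Q ⊕ Q → ℝ) → ℂ := fun p =>
    Complex.exp ((p.1.1 : ℝ) * Complex.I) *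
      (Complex.exp ((e k * h * sympForm τ p.1.2 p.2 : ℝ) * Complex.I) *
        (gaussFun (precision h τ m) (p.1.2 + h • p.2) : ℝ)) with hH
  have hHm : Measurable H := by
    refine Measurable.mul (by fun_prop) (Measurable.mul ?_ ?_)
    · have : Measurable fun p : (ℝ × (Q ⊕ Q → ℝ)) × (Q ⊕ Q → ℝ) => sympForm τ p.1.2 p.2 :=
        (measurable_sympForm τ).comp (f := fun p : (ℝ × (Q ⊕ Q → ℝ)) × (Q ⊕ Q → ℝ) => (p.1.2, p.2))
          (by fun_prop)
      fun_prop
    · exact Complex.measurable_ofReal.comp ((measurable_gaussFun _).comp (by fun_prop))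
  have hHn : ∀ p, ‖H p‖ ≤ 1 := fun p => by
    simp only [hH]
    rw [norm_mul, norm_mul, Complex.norm_exp_ofReal_mul_I, Complex.norm_exp_ofReal_mul_I, one_mul,
      one_mul, Complex.norm_real, Real.norm_of_nonneg (gaussFun_pos _ _).le]
    exact gaussFun_le_one hθ0 _
  have e1 : ∀ ω, Complex.exp ((walkArea e h τ (fun i => z i ω) (k + 1) : ℝ) * Complex.I) *
      (gaussFun (precision h τ m) (walk h (fun i => z i ω) (k + 1)) : ℝ) =
      H ((walkArea e h τ (fun i => z i ω) k, walk h (fun i => z i ω) k), z k ω) := fun ω => by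
    rw [hH, walkArea_succ, walk_succ, Complex.ofReal_add, add_mul, Complex.exp_add, mul_assoc]
  have hHI : Integrable (fun ω => H ((walkArea e h τ (fun i => z i ω) k,
      walk h (fun i => z i ω) k), z k ω)) P :=
    Integrable.of_bound (hHm.comp ((harea.prodMk hpos).prodMk (hz k))).aestronglyMeasurable 1
      (ae_of_all _ fun ω => hHn _)
  have e2 := integral_eq_integral_integral_of_indepFun (harea.prodMk hpos) (hz k) hind'
    hHm.stronglyMeasurable hHI
  have hGI : Integrable (fun ω => Complex.exp ((walkArea e h τ (fun i => z i ω) k : ℝ) * Complex.I) *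
      (gaussFun (precision h τ (m + 1)) (walk h (fun i => z i ω) k) : ℝ)) P := by
    refine Integrable.of_bound (Measurable.aestronglyMeasurable ?_) 1 (ae_of_all _ fun ω => ?_)
    · exact Measurable.mul (by fun_prop)
        (Complex.measurable_ofReal.comp ((measurable_gaussFun _).comp hpos))
    · rw [norm_mul, Complex.norm_exp_ofReal_mul_I, one_mul, Complex.norm_real,
        Real.norm_of_nonneg (gaussFun_pos _ _).le]
      exact gaussFun_le_one hθ1 _
  have hInner : Integrable (fun ω => ∫ y, H ((walkArea e h τ (fun i => z i ω) k,
      walk h (fun i => z i ω) k), y) ∂(P.map (z k))) P := by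
    refine Integrable.of_bound ?_ 1 (ae_of_all _ fun ω => ?_)
    · exact (hHm.stronglyMeasurable.integral_prod_right'.measurable.comp
        (harea.prodMk hpos)).aestronglyMeasurable
    · simpa using norm_integral_le_of_norm_le_const (ae_of_all (P.map (z k))
        fun y => hHn ((walkArea e h τ (fun i => z i ω) k, walk h (fun i => z i ω) k), y))
  simp_rw [e1]
  rw [e2, ← integral_const_mul, ← integral_sub hInner (hGI.const_mul _),
    ← integral_const_mul, ← integral_const_mul,
    ← integral_add (hI2.const_mul _) (hI4.const_mul _)]
  refine norm_integral_le_of_norm_le ((hI2.const_mul _).add (hI4.const_mul _))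
    (ae_of_all _ fun ω => ?_)
  have hstep := norm_integral_gaussFun_sub_le (hiso k) hM hγ (he k) hh0 hh1 hτ hθ0
    (precision_le hs m) hΛ (walk h (fun i => z i ω) k)
  rw [precision_succ hs, ← hC₁, ← hC₂] at hstep
  refine le_trans (le_of_eq ?_) hstep
  simp only [hH]
  -- The phase collected up to time `k` has modulus one, so the estimate at the frozen position
  -- passes through unchanged.
  rw [integral_const_mul, mul_left_comm, ← mul_sub, norm_mul, Complex.norm_exp_ofReal_mul_I, one_mul,
    Complex.ofReal_mul]

/-- The characteristic function of the signed area of a random walk. -/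
theorem exists_norm_integral_exp_walkArea_sub_le [DecidableEq Q] (τ : Q → ℝ) :
    ∃ A : ℝ, 0 ≤ A ∧ ∀ M : ℝ, 0 ≤ M → ∃ B : ℝ, 0 ≤ B ∧ ∃ N : ℕ, ∀ n, N ≤ n →
      ∀ {Ω : Type*} [MeasurableSpace Ω] {P : Measure Ω} [IsProbabilityMeasure P]
        (z : ℕ → Ω → Q ⊕ Q → ℝ) (γ : ℝ) (e : ℕ → ℝ), (∀ i, Measurable (z i)) → iIndepFun z P →
        (∀ i, IsNearlyIsotropic (P.map (z i)) M γ) → 0 ≤ γ → γ ≤ 1 → (∀ i, |e i| = 1) →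
        ‖∫ ω, Complex.exp (((n : ℝ)⁻¹ * ∑ j ∈ Finset.range n, ∑ i ∈ Finset.range j,
            e j * sympForm τ (z i ω) (z j ω) : ℝ) * Complex.I) ∂P -
          ((∏ q, (coshPoly n (τ q / n))⁻¹ : ℝ) : ℂ)‖ ≤ A * γ + B * (√(n : ℝ))⁻¹ := by
  set Λ : ℝ := ∑ q, |τ q| with hΛdef
  have hΛ : 0 ≤ Λ := Finset.sum_nonneg fun q _ => abs_nonneg _
  have hτ : ∀ q, |τ q| ≤ Λ := fun q =>
    Finset.single_le_sum (f := fun q => |τ q|) (fun q _ => abs_nonneg _) (Finset.mem_univ q)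
  obtain ⟨C₁, hC₁⟩ : ∃ C₁ : ℝ, C₁ = Fintype.card Q * Λ + 2 * Λ ^ 2 := ⟨_, rfl⟩
  have hC₁0 : 0 ≤ C₁ := by rw [hC₁]; positivity
  -- The coefficient of `γ` is fixed before `M` is given. Later a small `γ` is bought with a large
  -- truncation level `M`, whose effect must stay in the term that vanishes as `n` grows.
  refine ⟨C₁ * (2 + 16 * (Fintype.card Q : ℝ) ^ 2), by positivity, fun M hM => ?_⟩
  obtain ⟨C₂, hC₂⟩ : ∃ C₂ : ℝ, C₂ = 32 * (2 * Λ * M + 2 * Λ * (Fintype.card Q * M) ^ 2) ^ 3 +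
        2 * (2 * Λ * M + 2 * Λ * (Fintype.card Q * M) ^ 2) ^ 2 +
        ((Fintype.card Q * Λ + Λ ^ 2) ^ 2 + Fintype.card Q * Λ ^ 2 + Λ ^ 3) := ⟨_, rfl⟩
  have hC₂0 : 0 ≤ C₂ := by rw [hC₂]; positivity
  -- The threshold gives `n ≥ 1` and `|τ q| / n ≤ 1`; the latter keeps `coshPoly` at least 1.
  refine ⟨C₂ * (8 + 384 * (Fintype.card Q : ℝ) ^ 4 * M ^ 4), by positivity, ⌈Λ⌉₊ + 1, ?_⟩
  intro n hn Ω _ P _ z γ e hz hind hiso hγ hγ1 he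
  have hn1 : 1 ≤ n := by omega
  have hn0 : (0 : ℝ) < n := by exact_mod_cast hn1
  have hΛn : Λ ≤ n := (Nat.le_ceil Λ).trans (by exact_mod_cast (by omega : ⌈Λ⌉₊ ≤ n))
  set h : ℝ := (√(n : ℝ))⁻¹ with hh
  have hh2 : h ^ 2 = (n : ℝ)⁻¹ := by rw [hh, inv_pow, Real.sq_sqrt hn0.le]
  have hh2n : h ^ 2 * n = 1 := by rw [hh2]; exact inv_mul_cancel₀ hn0.ne'
  have hh0 : 0 ≤ h := by positivity
  have hh1 : h ≤ 1 := inv_le_one_of_one_le₀ (Real.one_le_sqrt.2 (by exact_mod_cast hn1))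
  have hs : ∀ q, |h ^ 2 * τ q| ≤ 1 := fun q => by
    rw [abs_mul, abs_of_nonneg (sq_nonneg h), hh2, inv_mul_le_iff₀ hn0, mul_one]
    exact (hτ q).trans hΛn
  have hcpos : ∀ m q, 1 ≤ coshPoly m (h ^ 2 * τ q) := fun m q => one_le_coshPoly m (hs q)
  set D : ℕ → ℝ := fun m => ∏ q, (coshPoly m (h ^ 2 * τ q))⁻¹ with hD
  have hD0 : ∀ m, 0 ≤ D m := fun m =>
    Finset.prod_nonneg fun q _ => inv_nonneg.2 (zero_le_one.trans (hcpos m q))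
  have hD1 : ∀ m, D m ≤ 1 := fun m =>
    Finset.prod_le_one (fun q _ => inv_nonneg.2 (zero_le_one.trans (hcpos m q)))
      fun q _ => inv_le_one_of_one_le₀ (hcpos m q)
  -- Each scalar is the inverse of a quotient of consecutive values of `coshPoly`, so the product
  -- over the steps telescopes.
  have hDs : ∀ m, D m * ∏ q, (1 + h ^ 2 * precision h τ m q)⁻¹ = D (m + 1) := fun m => by
    rw [hD, ← Finset.prod_mul_distrib]
    refine Finset.prod_congr rfl fun q _ => ?_
    have h1 := (zero_lt_one.trans_le (hcpos m q)).ne'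
    rw [one_add_mul_precision hs, inv_div]
    field_simp
  set E : ℕ → ℕ → ℂ := fun k m =>
    ∫ ω, Complex.exp ((walkArea e h τ (fun i => z i ω) k : ℝ) * Complex.I) *
        (gaussFun (precision h τ m) (walk h (fun i => z i ω) k) : ℝ) ∂P with hE
  set c : ℝ := C₁ * γ * h ^ 2 * (2 + 16 * (Fintype.card Q : ℝ) ^ 2) +
    C₂ * h ^ 3 * (8 + 384 * (Fintype.card Q : ℝ) ^ 4 * M ^ 4) with hc
  -- The quantities `D (n - k) * E k (n - k)` interpolate between the two sides of the claim. At `k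
  -- = n` the precision is zero and `D 0 = 1`, which leaves the characteristic function. At `k = 0`
  -- area and position vanish, which leaves `D n`. The `n` errors then add up to the claimed bound
  -- because `n h² = 1` and `n h³ = h`.
  have hstep : ∀ k < n, ‖(D (n - (k + 1)) : ℂ) * E (k + 1) (n - (k + 1)) - D (n - k) * E k (n - k)‖ ≤ c := by
    intro k hk
    obtain ⟨m, hm⟩ : ∃ m, n = k + 1 + m := ⟨n - (k + 1), by omega⟩
    have hm1 : n - (k + 1) = m := by omega
    have hm2 : n - k = m + 1 := by omega
    obtain ⟨i2, i4, b2, b4⟩ := integral_one_add_walk_pow_le hz hind hiso hγ1 hk.le hh2n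
    have h1 := norm_integral_walk_step_le hz hind hiso hM hγ he hΛ hτ hh0 hh1 hs k m hC₁ hC₂ i2 i4
    rw [hm1, hm2, ← hDs m, Complex.ofReal_mul, mul_assoc, ← mul_sub, norm_mul, Complex.norm_real,
      Real.norm_of_nonneg (hD0 m)]
    refine (mul_le_of_le_one_left (norm_nonneg _) (hD1 m)).trans (h1.trans ?_)
    rw [hc]
    gcongr
  have htel : ‖(D (n - n) : ℂ) * E n (n - n) - D (n - 0) * E 0 (n - 0)‖ ≤ n * c := by
    rw [← Finset.sum_range_sub (fun k => (D (n - k) : ℂ) * E k (n - k)) n]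
    refine (norm_sum_le _ _).trans ?_
    calc _ ≤ ∑ _k ∈ Finset.range n, c := Finset.sum_le_sum fun k hk => hstep k (Finset.mem_range.1 hk)
      _ = n * c := by simp
  have hEn : (D (n - n) : ℂ) * E n (n - n) = ∫ ω, Complex.exp (((n : ℝ)⁻¹ *
      ∑ j ∈ Finset.range n, ∑ i ∈ Finset.range j,
        e j * sympForm τ (z i ω) (z j ω) : ℝ) * Complex.I) ∂P := by
    simp only [hD, hE, Nat.sub_self, precision_zero, walkArea_eq, hh2]
    simp [coshPoly, gaussFun, planarForm]
  have hE0 : (D (n - 0) : ℂ) * E 0 (n - 0) = ((∏ q, (coshPoly n (τ q / n))⁻¹ : ℝ) : ℂ) := by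
    have : ∀ q, h ^ 2 * τ q = τ q / n := fun q => by rw [hh2]; ring
    simp only [hD, hE, Nat.sub_zero, this]
    simp [walkArea, walk, gaussFun, planarForm]
  rw [hEn, hE0] at htel
  refine htel.trans (le_of_eq ?_)
  rw [hc]
  have : (n : ℝ) * h ^ 3 = h := by rw [pow_succ, ← mul_assoc, mul_comm (n : ℝ), hh2n, one_mul]
  linear_combination (C₁ * γ * (2 + 16 * (Fintype.card Q : ℝ) ^ 2)) * hh2n +
    (C₂ * (8 + 384 * (Fintype.card Q : ℝ) ^ 4 * M ^ 4)) * this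

end Walk

/-! ### Second moments of degenerate statistics -/

theorem lpNorm_two_sq {T : Type*} [MeasurableSpace T] {μ : Measure T} {g : T → ℝ}
    (hg : MemLp g 2 μ) : lpNorm g 2 μ ^ 2 = ∫ x, g x ^ 2 ∂μ := by
  have h0 : 0 ≤ ∫ x, g x ^ 2 ∂μ := integral_nonneg fun x => sq_nonneg _
  rw [← toReal_eLpNorm hg.1, hg.eLpNorm_eq_integral_rpow_norm (by norm_num) (by norm_num)]
  simp only [ENNReal.toReal_ofNat, Real.rpow_two, Real.norm_eq_abs, sq_abs]
  rw [ENNReal.toReal_ofReal (by positivity), ← Real.rpow_natCast, ← Real.rpow_mul h0]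
  norm_num

/-- The map `a ↦ exp (i t a)` has Lipschitz constant `|t|`, and the L¹ norm is at most the L² norm
on a probability space. -/
theorem norm_integral_exp_sub_le {Ω : Type*} [MeasurableSpace Ω] {P : Measure Ω}
    [IsProbabilityMeasure P] {A B : Ω → ℝ} (hA : AEStronglyMeasurable A P)
    (hB : AEStronglyMeasurable B P) (hAB : MemLp (A - B) 2 P) (t : ℝ) :
    ‖∫ ω, Complex.exp ((t * A ω : ℝ) * Complex.I) ∂P -
      ∫ ω, Complex.exp ((t * B ω : ℝ) * Complex.I) ∂P‖ ≤ |t| * lpNorm (A - B) 2 P := by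
  have hI : ∀ {C : Ω → ℝ}, AEStronglyMeasurable C P →
      Integrable (fun ω => Complex.exp ((t * C ω : ℝ) * Complex.I)) P := by
    intro C hC
    refine Integrable.of_bound ?_ 1 (ae_of_all _ fun ω => (Complex.norm_exp_ofReal_mul_I _).le)
    exact (Complex.measurable_exp.comp_aemeasurable
      ((Complex.measurable_ofReal.comp_aemeasurable
        (hC.aemeasurable.const_mul t)).mul_const _)).aestronglyMeasurable
  have h1 : MemLp (A - B) 1 P := hAB.mono_exponent (by norm_num)
  have h2 : Integrable (A - B) P := memLp_one_iff_integrable.1 h1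
  rw [← integral_sub (hI hA) (hI hB)]
  calc _ ≤ ∫ ω, |t| * ‖(A - B) ω‖ ∂P := by
        refine norm_integral_le_of_norm_le (h2.norm.const_mul _) (ae_of_all _ fun ω => ?_)
        have e : Complex.exp ((t * A ω : ℝ) * Complex.I) - Complex.exp ((t * B ω : ℝ) * Complex.I) =
            Complex.exp ((t * B ω : ℝ) * Complex.I) *
              (Complex.exp (Complex.I * (t * (A ω - B ω) : ℝ)) - 1) := by
          rw [mul_sub, ← Complex.exp_add, mul_one]
          congr 2
          push_cast; ring
        rw [e, norm_mul, Complex.norm_exp_ofReal_mul_I, one_mul]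
        refine (Real.norm_exp_I_mul_ofReal_sub_one_le).trans ?_
        rw [norm_mul]; rfl
    _ = |t| * (eLpNorm (A - B) 1 P).toReal := by
        rw [integral_const_mul, eLpNorm_one_eq_lintegral_enorm, integral_norm_eq_lintegral_enorm h2.1]
    _ ≤ _ := by
        rw [← toReal_eLpNorm hAB.1]
        refine mul_le_mul_of_nonneg_left (ENNReal.toReal_mono hAB.2.ne ?_) (abs_nonneg _)
        exact eLpNorm_le_eLpNorm_of_exponent_le (by norm_num) hAB.1

section Degenerate

variable {S : Type*} [MeasurableSpace S] {ν : Measure S}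

/-- Both marginal conditional expectations of the kernel `g` vanish. -/
def IsDegenerate (ν : Measure S) (g : S → S → ℝ) : Prop :=
  (∀ᵐ x ∂ν, ∫ y, g x y ∂ν = 0) ∧ ∀ᵐ y ∂ν, ∫ x, g x y ∂ν = 0

/-- A sequence of independent observations with distribution `ν`. -/
structure IsSample {Ω : Type*} [MeasurableSpace Ω] (P : Measure Ω) (ν : Measure S)
    (Y : ℕ → Ω → S) : Prop where
  measurable : ∀ i, Measurable (Y i)
  map_eq : ∀ i, P.map (Y i) = ν
  indep : iIndepFun Y P

/-- `∑_{i < j < n} c_ij g(x_i, x_j)`. -/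
def weightedStat (c : ℕ → ℕ → ℝ) (g : S → S → ℝ) (n : ℕ) (x : ℕ → S) : ℝ :=
  ∑ j ∈ Finset.range n, ∑ i ∈ Finset.range j, c i j * g (x i) (x j)

omit [MeasurableSpace S] in
theorem weightedStat_eq_sum_sigma (c : ℕ → ℕ → ℝ) (g : S → S → ℝ) (n : ℕ) (x : ℕ → S) :
    weightedStat c g n x =
      ∑ p ∈ (Finset.range n).sigma fun j => Finset.range j, c p.2 p.1 * g (x p.2) (x p.1) := by
  rw [Finset.sum_sigma]; rfl

variable {Ω : Type*} [MeasurableSpace Ω] {P : Measure Ω} [IsProbabilityMeasure P] {Y : ℕ → Ω → S}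

theorem IsSample.map_prod (hY : IsSample P ν Y) {i j : ℕ} (hij : i ≠ j) :
    P.map (fun ω => (Y i ω, Y j ω)) = ν.prod ν := by
  rw [(indepFun_iff_map_prod_eq_prod_map_map (hY.measurable i).aemeasurable
    (hY.measurable j).aemeasurable).1 (hY.indep.indepFun hij), hY.map_eq, hY.map_eq]

theorem IsSample.measurePreserving (hY : IsSample P ν Y) {i j : ℕ} (hij : i ≠ j) :
    MeasurePreserving (fun ω => (Y i ω, Y j ω)) P (ν.prod ν) :=
  ⟨(hY.measurable i).prodMk (hY.measurable j), hY.map_prod hij⟩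

theorem IsSample.memLp (hY : IsSample P ν Y) {i j : ℕ} (hij : i ≠ j) {g : S → S → ℝ}
    (hg : MemLp (Function.uncurry g) 2 (ν.prod ν)) : MemLp (fun ω => g (Y i ω) (Y j ω)) 2 P :=
  hg.comp_measurePreserving (hY.measurePreserving hij)

/-- The observation `Y a` occurs in the first factor only. It is averaged first, with the others
frozen, and the marginal condition makes this average zero. -/
theorem IsSample.integral_mul_eq_zero (hY : IsSample P ν Y) {g g' : S → S → ℝ}
    (hgm : Measurable (Function.uncurry g)) (hgm' : Measurable (Function.uncurry g'))
    (hg : MemLp (Function.uncurry g) 2 (ν.prod ν)) (hg' : MemLp (Function.uncurry g') 2 (ν.prod ν))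
    (h0 : ∀ᵐ x ∂ν, ∫ y, g x y ∂ν = 0) {a i k l : ℕ} (hai : i ≠ a) (hak : k ≠ a) (hal : l ≠ a)
    (hkl : k ≠ l) : ∫ ω, g (Y i ω) (Y a ω) * g' (Y k ω) (Y l ω) ∂P = 0 := by
  have hX : Measurable fun ω => (Y i ω, Y k ω, Y l ω) :=
    (hY.measurable i).prodMk ((hY.measurable k).prodMk (hY.measurable l))
  have hind : IndepFun (fun ω => (Y i ω, Y k ω, Y l ω)) (Y a) P :=
    indepFun_of_depends_on hY.measurable hY.indep {i, k, l} (a := a)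
      (by simp [hai.symm, hak.symm, hal.symm])
      (F := fun x => (x i, x k, x l)) (by fun_prop)
      (fun x y hxy => by rw [hxy i (by simp), hxy k (by simp), hxy l (by simp)])
  have hHm : Measurable fun p : (S × S × S) × S => g p.1.1 p.2 * g' p.1.2.1 p.1.2.2 :=
    (hgm.comp (f := fun p : (S × S × S) × S => (p.1.1, p.2)) (by fun_prop)).mul
      (hgm'.comp (f := fun p : (S × S × S) × S => (p.1.2.1, p.1.2.2)) (by fun_prop))
  have := integral_eq_integral_integral_of_indepFun hX (hY.measurable a) hind
    hHm.stronglyMeasurable (MemLp.integrable_mul (hY.memLp hai hg) (hY.memLp hkl hg'))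
  refine this.trans (integral_eq_zero_of_ae ?_)
  have h1 : ∀ᵐ ω ∂P, ∫ y, g (Y i ω) y ∂ν = 0 := by
    rw [← hY.map_eq i] at h0
    have := ae_of_ae_map (hY.measurable i).aemeasurable h0
    rwa [hY.map_eq i] at this
  filter_upwards [h1] with ω hω
  rw [hY.map_eq, integral_mul_const, hω, zero_mul]
  rfl

theorem IsSample.memLp_weightedStat (hY : IsSample P ν Y) {g : S → S → ℝ}
    (hg : MemLp (Function.uncurry g) 2 (ν.prod ν)) (c : ℕ → ℕ → ℝ) (n : ℕ) :
    MemLp (fun ω => weightedStat c g n fun k => Y k ω) 2 P := by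
  unfold weightedStat
  refine memLp_finsetSum _ fun j _ => memLp_finsetSum _ fun i hi => ?_
  exact (hY.memLp (Finset.mem_range.1 hi).ne hg).const_mul _

variable [IsProbabilityMeasure ν]

theorem IsSample.integral_mul_eq_zero_of_ne (hY : IsSample P ν Y) {g : S → S → ℝ}
    (hgm : Measurable (Function.uncurry g)) (hg : MemLp (Function.uncurry g) 2 (ν.prod ν))
    (h0 : IsDegenerate ν g) {i j k l : ℕ} (hij : i < j) (hkl : k < l) (hne : ¬(i = k ∧ j = l)) :
    ∫ ω, g (Y i ω) (Y j ω) * g (Y k ω) (Y l ω) ∂P = 0 := by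
  -- Two different increasing pairs cannot share both indices, so `j` or else `i` is absent from the
  -- second pair. In the latter case the kernel is transposed.
  by_cases hj : k ≠ j ∧ l ≠ j
  · exact hY.integral_mul_eq_zero hgm hgm hg hg h0.1 hij.ne hj.1 hj.2 hkl.ne
  · have hi : k ≠ i ∧ l ≠ i := by omega
    exact hY.integral_mul_eq_zero (g := fun x y => g y x) (hgm.comp measurable_swap) hgm
      (hg.comp_measurePreserving Measure.measurePreserving_swap) hg h0.2 hij.ne' hi.1 hi.2 hkl.ne

/-- Terms with different pairs are orthogonal, so only the diagonal of the expanded square remains.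
-/
theorem IsSample.lpNorm_weightedStat_sq (hY : IsSample P ν Y) {g : S → S → ℝ}
    (hgm : Measurable (Function.uncurry g)) (hg : MemLp (Function.uncurry g) 2 (ν.prod ν))
    (h0 : IsDegenerate ν g) (c : ℕ → ℕ → ℝ) (n : ℕ) :
    lpNorm (fun ω => weightedStat c g n fun k => Y k ω) 2 P ^ 2 =
      (∑ j ∈ Finset.range n, ∑ i ∈ Finset.range j, c i j ^ 2) *
        lpNorm (Function.uncurry g) 2 (ν.prod ν) ^ 2 := by
  rw [lpNorm_two_sq (hY.memLp_weightedStat hg c n), lpNorm_two_sq hg]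
  simp_rw [weightedStat_eq_sum_sigma, sq, Finset.sum_mul_sum]
  set s := (Finset.range n).sigma fun j => Finset.range j with hs
  have hlt : ∀ p ∈ s, p.2 < p.1 := fun p hp => by
    simpa using (Finset.mem_sigma.1 hp).2
  have hI : ∀ p ∈ s, ∀ q ∈ s, Integrable (fun ω => c p.2 p.1 * g (Y p.2 ω) (Y p.1 ω) *
      (c q.2 q.1 * g (Y q.2 ω) (Y q.1 ω))) P := fun p hp q hq =>
    MemLp.integrable_mul ((hY.memLp (hlt p hp).ne hg).const_mul _)
      ((hY.memLp (hlt q hq).ne hg).const_mul _)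
  rw [integral_finsetSum _ fun p hp => integrable_finsetSum _ fun q hq => hI p hp q hq]
  have hsum : ∑ j ∈ Finset.range n, ∑ i ∈ Finset.range j, c i j * c i j =
      ∑ p ∈ s, c p.2 p.1 * c p.2 p.1 := by rw [hs, Finset.sum_sigma]
  rw [hsum, Finset.sum_mul]
  refine Finset.sum_congr rfl fun p hp => ?_
  rw [integral_finsetSum _ fun q hq => hI p hp q hq, Finset.sum_eq_single_of_mem p hp]
  · have h1 : ∫ ω, g (Y p.2 ω) (Y p.1 ω) * g (Y p.2 ω) (Y p.1 ω) ∂P =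
        ∫ x, Function.uncurry g x * Function.uncurry g x ∂(ν.prod ν) := by
      rw [← hY.map_prod (hlt p hp).ne, integral_map
        ((hY.measurable _).prodMk (hY.measurable _)).aemeasurable
        (Measurable.aestronglyMeasurable (by fun_prop))]
      rfl
    rw [← h1, ← integral_const_mul]
    congr 1
    funext ω; ring
  · intro q hq hqp
    have h1 := hY.integral_mul_eq_zero_of_ne hgm hg h0 (hlt p hp) (hlt q hq) (by
      rintro ⟨e1, e2⟩
      exact hqp (Sigma.ext e2.symm (heq_of_eq e1.symm)))
    have : ∀ ω, c p.2 p.1 * g (Y p.2 ω) (Y p.1 ω) * (c q.2 q.1 * g (Y q.2 ω) (Y q.1 ω)) =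
        c p.2 p.1 * c q.2 q.1 * (g (Y p.2 ω) (Y p.1 ω) * g (Y q.2 ω) (Y q.1 ω)) := fun ω => by ring
    simp_rw [this]
    rw [integral_const_mul, h1, mul_zero]

/-- There are at most `n²` orthogonal terms. The resulting linear growth is exactly what the factor
`n⁻¹` absorbs, whatever the weights are. -/
theorem IsSample.lpNorm_weightedStat_le (hY : IsSample P ν Y) {g : S → S → ℝ}
    (hgm : Measurable (Function.uncurry g)) (hg : MemLp (Function.uncurry g) 2 (ν.prod ν))
    (h0 : IsDegenerate ν g) {c : ℕ → ℕ → ℝ} (hc : ∀ i j, |c i j| ≤ 1) (n : ℕ) :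
    lpNorm (fun ω => weightedStat c g n fun k => Y k ω) 2 P ≤
      n * lpNorm (Function.uncurry g) 2 (ν.prod ν) := by
  refine le_of_sq_le_sq ?_ (mul_nonneg (Nat.cast_nonneg _) lpNorm_nonneg)
  rw [hY.lpNorm_weightedStat_sq hgm hg h0 c n, mul_pow]
  refine mul_le_mul_of_nonneg_right ?_ (sq_nonneg _)
  calc _ ≤ ∑ j ∈ Finset.range n, ∑ _i ∈ Finset.range j, (1 : ℝ) := by
        gcongr with j _ i _
        exact (sq_le_one_iff_abs_le_one _).2 (hc i j)
    _ ≤ ∑ _j ∈ Finset.range n, (n : ℝ) := by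
        refine Finset.sum_le_sum fun j hj => ?_
        simpa using (Finset.mem_range.1 hj).le
    _ = _ := by simp [sq]

end Degenerate

/-! ### Kernels of finite rank -/

section FiniteRank

variable {S : Type*} [MeasurableSpace S] {ν : Measure S}

theorem abs_integral_mul_le {a b : S → ℝ} (ha : MemLp a 2 ν) (hb : MemLp b 2 ν) :
    |∫ x, a x * b x ∂ν| ≤ lpNorm a 2 ν * lpNorm b 2 ν := by
  have h1 : inner ℝ (ha.toLp a) (hb.toLp b) = ∫ x, a x * b x ∂ν := by
    rw [L2.inner_def]
    refine integral_congr_ae ?_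
    filter_upwards [ha.coeFn_toLp, hb.coeFn_toLp] with x h1 h2
    rw [h1, h2]
    simp [mul_comm]
  have := abs_real_inner_le_norm (ha.toLp a) (hb.toLp b)
  rwa [h1, Lp.norm_toLp, Lp.norm_toLp, toReal_eLpNorm ha.1, toReal_eLpNorm hb.1] at this

variable [IsProbabilityMeasure ν]

theorem memLp_prod_mul {a b : S → ℝ} (ha : MemLp a 2 ν) (hb : MemLp b 2 ν) :
    MemLp (fun p : S × S => a p.1 * b p.2) 2 (ν.prod ν) := by
  have hm : AEStronglyMeasurable (fun p : S × S => a p.1 * b p.2) (ν.prod ν) :=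
    (ha.comp_fst ν).1.mul (hb.comp_snd ν).1
  rw [memLp_two_iff_integrable_sq hm]
  simp_rw [mul_pow]
  exact Integrable.mul_prod ha.integrable_sq hb.integrable_sq

theorem lpNorm_prod_mul {a b : S → ℝ} (ha : MemLp a 2 ν) (hb : MemLp b 2 ν) :
    lpNorm (fun p : S × S => a p.1 * b p.2) 2 (ν.prod ν) = lpNorm a 2 ν * lpNorm b 2 ν := by
  have h : lpNorm (fun p : S × S => a p.1 * b p.2) 2 (ν.prod ν) ^ 2 =
      (lpNorm a 2 ν * lpNorm b 2 ν) ^ 2 := by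
    rw [lpNorm_two_sq (memLp_prod_mul ha hb), mul_pow, lpNorm_two_sq ha, lpNorm_two_sq hb]
    simp_rw [mul_pow]
    exact integral_prod_mul (fun x => a x ^ 2) fun x => b x ^ 2
  exact (pow_left_inj₀ lpNorm_nonneg (mul_nonneg lpNorm_nonneg lpNorm_nonneg) two_ne_zero).1 h

/-- Square integrable functions with mean zero are approximated by bounded ones. -/
theorem exists_bounded_lpNorm_sub_le {a : S → ℝ} (ha : MemLp a 2 ν) (ha0 : ∫ x, a x ∂ν = 0)
    {η : ℝ} (hη : 0 < η) :
    ∃ b : S → ℝ, Measurable b ∧ (∃ M, ∀ x, |b x| ≤ M) ∧ ∫ x, b x ∂ν = 0 ∧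
      lpNorm (a - b) 2 ν ≤ η := by
  -- Half of `η` pays for the simple function and half for recentring it: as `a` has mean zero, the
  -- mean of `g` is bounded by the distance of `g` from `a`.
  obtain ⟨g, hg, hgL⟩ := ha.exists_simpleFunc_eLpNorm_sub_lt (by norm_num)
    (ENNReal.ofReal_pos.2 (half_pos hη)).ne'
  have hag : MemLp (a - ⇑g) 2 ν := ha.sub hgL
  have hg1 : lpNorm (a - ⇑g) 2 ν ≤ η / 2 := by
    rw [← toReal_eLpNorm hag.1]
    exact ENNReal.toReal_le_of_le_ofReal (half_pos hη).le hg.le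
  have hgI : Integrable g ν := hgL.integrable (by norm_num)
  have haI : Integrable a ν := ha.integrable (by norm_num)
  have hmean : |∫ x, g x ∂ν| ≤ η / 2 := by
    have h1 := abs_integral_mul_le hag (memLp_const (1 : ℝ))
    have h2 : lpNorm (fun _ : S => (1 : ℝ)) 2 ν = 1 := by
      rw [lpNorm_const (by norm_num) (IsProbabilityMeasure.ne_zero ν)]; simp
    rw [h2] at h1
    simp only [Pi.sub_apply, mul_one] at h1
    rw [integral_sub haI hgI, ha0, zero_sub, abs_neg] at h1
    exact h1.trans hg1
  refine ⟨fun x => g x - ∫ y, g y ∂ν, g.measurable.sub_const _, ?_, ?_, ?_⟩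
  · obtain ⟨C, hC⟩ := g.exists_forall_norm_le
    exact ⟨C + |∫ y, g y ∂ν|, fun x => (abs_sub _ _).trans (add_le_add (hC x) le_rfl)⟩
  · rw [integral_sub hgI (integrable_const _)]; simp
  · have e : (a - fun x => g x - ∫ y, g y ∂ν) = (a - ⇑g) + fun _ => ∫ y, g y ∂ν := by
      funext x; simp; ring
    rw [e]
    refine (lpNorm_add_le hag (by norm_num)).trans ?_
    have h2 : lpNorm (fun _ : S => ∫ y, g y ∂ν) 2 ν = |∫ y, g y ∂ν| := by
      rw [lpNorm_const (by norm_num) (IsProbabilityMeasure.ne_zero ν)]; simp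
    rw [h2]
    linarith

variable {Q : Type*} [Fintype Q]

/-- The antisymmetric kernel `∑ lam_q (v_q(x) w_q(y) - w_q(x) v_q(y))`. -/
def pairKernel (lam : Q → ℝ) (v : Q ⊕ Q → S → ℝ) (x y : S) : ℝ :=
  sympForm lam (fun r => v r x) fun r => v r y

omit [IsProbabilityMeasure ν] in
theorem measurable_pairKernel (lam : Q → ℝ) {v : Q ⊕ Q → S → ℝ} (hv : ∀ r, Measurable (v r)) :
    Measurable (Function.uncurry (pairKernel lam v)) := by
  have : Function.uncurry (pairKernel lam v) =
      (fun p : (Q ⊕ Q → ℝ) × (Q ⊕ Q → ℝ) => sympForm lam p.1 p.2) ∘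
        fun p : S × S => (fun r => v r p.1, fun r => v r p.2) := rfl
  rw [this]
  exact (measurable_sympForm lam).comp (by fun_prop)

theorem memLp_pairKernel (lam : Q → ℝ) {v : Q ⊕ Q → S → ℝ} (hv : ∀ r, MemLp (v r) 2 ν) :
    MemLp (Function.uncurry (pairKernel lam v)) 2 (ν.prod ν) := by
  have : Function.uncurry (pairKernel lam v) = fun p : S × S =>
      ∑ q, lam q * (v (.inl q) p.1 * v (.inr q) p.2 - v (.inr q) p.1 * v (.inl q) p.2) := rfl
  rw [this]
  exact memLp_finsetSum _ fun q _ =>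
    ((memLp_prod_mul (hv _) (hv _)).sub (memLp_prod_mul (hv _) (hv _))).const_mul _

theorem isDegenerate_pairKernel (lam : Q → ℝ) {v : Q ⊕ Q → S → ℝ} (hv : ∀ r, MemLp (v r) 2 ν)
    (hv0 : ∀ r, ∫ x, v r x ∂ν = 0) : IsDegenerate ν (pairKernel lam v) := by
  have hI : ∀ r, Integrable (v r) ν := fun r => (hv r).integrable (by norm_num)
  constructor
  · refine ae_of_all _ fun x => ?_
    simp only [pairKernel, sympForm]
    have h : ∀ q, Integrable (fun y => lam q * (v (.inl q) x * v (.inr q) y -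
        v (.inr q) x * v (.inl q) y)) ν := fun q =>
      (((hI _).const_mul _).sub ((hI _).const_mul _)).const_mul _
    rw [integral_finsetSum _ fun q _ => h q]
    refine Finset.sum_eq_zero fun q _ => ?_
    rw [integral_const_mul, integral_sub ((hI _).const_mul _) ((hI _).const_mul _),
      integral_const_mul, integral_const_mul, hv0, hv0]
    simp
  · refine ae_of_all _ fun x => ?_
    simp only [pairKernel, sympForm]
    have h : ∀ q, Integrable (fun y => lam q * (v (.inl q) y * v (.inr q) x -
        v (.inr q) y * v (.inl q) x)) ν := fun q =>
      (((hI _).mul_const _).sub ((hI _).mul_const _)).const_mul _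
    rw [integral_finsetSum _ fun q _ => h q]
    refine Finset.sum_eq_zero fun q _ => ?_
    rw [integral_const_mul, integral_sub ((hI _).mul_const _) ((hI _).mul_const _),
      integral_mul_const, integral_mul_const, hv0, hv0]
    simp

theorem IsDegenerate.sub {g g' : S → S → ℝ} (hg : MemLp (Function.uncurry g) 2 (ν.prod ν))
    (hg' : MemLp (Function.uncurry g') 2 (ν.prod ν)) (h : IsDegenerate ν g)
    (h' : IsDegenerate ν g') : IsDegenerate ν fun x y => g x y - g' x y := by
  have i1 : Integrable (Function.uncurry g) (ν.prod ν) := hg.integrable (by norm_num)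
  have i2 : Integrable (Function.uncurry g') (ν.prod ν) := hg'.integrable (by norm_num)
  constructor
  · filter_upwards [h.1, h'.1, i1.prod_right_ae, i2.prod_right_ae] with x h1 h2 h3 h4
    have := integral_sub h3 h4
    simp only [Function.uncurry_apply_pair] at this
    rw [this, h1, h2, sub_zero]
  · filter_upwards [h.2, h'.2, i1.prod_left_ae, i2.prod_left_ae] with x h1 h2 h3 h4
    have := integral_sub h3 h4
    simp only [Function.uncurry_apply_pair] at this
    rw [this, h1, h2, sub_zero]

/-- Replacing the factors of a product one after the other costs `η + (1 + η) η ≤ 3 η`, and every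
plane contributes two products. -/
theorem lpNorm_pairKernel_sub_le (lam : Q → ℝ) {v w : Q ⊕ Q → S → ℝ} (hv : ∀ r, MemLp (v r) 2 ν)
    (hw : ∀ r, MemLp (w r) 2 ν) (hv1 : ∀ r, lpNorm (v r) 2 ν ≤ 1) {η : ℝ} (hη1 : η ≤ 1)
    (hvw : ∀ r, lpNorm (v r - w r) 2 ν ≤ η) :
    lpNorm (Function.uncurry (pairKernel lam v) - Function.uncurry (pairKernel lam w)) 2
      (ν.prod ν) ≤ (∑ q, |lam q|) * (6 * η) := by
  have hw1 : ∀ r, lpNorm (w r) 2 ν ≤ 1 + η := fun r => by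
    have := lpNorm_le_lpNorm_add_lpNorm_sub (f := w r) (hv r) (by norm_num : (1 : ENNReal) ≤ 2)
    linarith [hv1 r, hvw r]
  have hη0 : ∀ _r : Q ⊕ Q, 0 ≤ η := fun r => lpNorm_nonneg.trans (hvw r)
  have hprod : ∀ r s, MemLp (fun p : S × S => v r p.1 * v s p.2 - w r p.1 * w s p.2) 2 (ν.prod ν) ∧
      lpNorm (fun p : S × S => v r p.1 * v s p.2 - w r p.1 * w s p.2) 2 (ν.prod ν) ≤ 3 * η := by
    intro r s
    have hr := (hv r).sub (hw r)
    have hs := (hv s).sub (hw s)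
    have e : (fun p : S × S => v r p.1 * v s p.2 - w r p.1 * w s p.2) =
        (fun p : S × S => (v r - w r) p.1 * v s p.2) + fun p : S × S => w r p.1 * (v s - w s) p.2 := by
      funext p; simp only [Pi.add_apply, Pi.sub_apply]; ring
    have m1 := memLp_prod_mul hr (hv s)
    have m2 := memLp_prod_mul (hw r) hs
    rw [e]
    refine ⟨m1.add m2, (lpNorm_add_le m1 (by norm_num)).trans ?_⟩
    rw [lpNorm_prod_mul hr (hv s), lpNorm_prod_mul (hw r) hs]
    have h1 := mul_le_mul (hvw r) (hv1 s) lpNorm_nonneg (hη0 r)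
    have h2 := mul_le_mul (hw1 r) (hvw s) lpNorm_nonneg (by linarith [hη0 r])
    nlinarith [hη0 r]
  have e : Function.uncurry (pairKernel lam v) - Function.uncurry (pairKernel lam w) =
      ∑ q, lam q • ((fun p : S × S => v (.inl q) p.1 * v (.inr q) p.2 - w (.inl q) p.1 * w (.inr q) p.2) -
        fun p : S × S => v (.inr q) p.1 * v (.inl q) p.2 - w (.inr q) p.1 * w (.inl q) p.2) := by
    funext ⟨x, y⟩
    simp only [pairKernel, sympForm, Function.uncurry_apply_pair, Pi.sub_apply, Finset.sum_apply,
      Pi.smul_apply, smul_eq_mul, ← Finset.sum_sub_distrib]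
    exact Finset.sum_congr rfl fun q _ => by ring
  rw [e, Finset.sum_mul]
  refine (lpNorm_sum_le (fun q _ => ((hprod _ _).1.sub (hprod _ _).1).const_smul _)
    (by norm_num)).trans (Finset.sum_le_sum fun q _ => ?_)
  rw [lpNorm_const_smul]
  refine mul_le_mul_of_nonneg_left ?_ (norm_nonneg _)
  refine (lpNorm_sub_le (hprod _ _).1 (by norm_num)).trans ?_
  linarith [(hprod (.inl q) (.inr q)).2, (hprod (.inr q) (.inl q)).2]

omit [IsProbabilityMeasure ν] [Fintype Q] in
theorem abs_integral_mul_sub_le {v w : Q ⊕ Q → S → ℝ} (hv : ∀ r, MemLp (v r) 2 ν)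
    (hw : ∀ r, MemLp (w r) 2 ν) (hv1 : ∀ r, lpNorm (v r) 2 ν ≤ 1) {η : ℝ} (hη1 : η ≤ 1)
    (hvw : ∀ r, lpNorm (v r - w r) 2 ν ≤ η) (r s : Q ⊕ Q) :
    |∫ x, w r x * w s x ∂ν - ∫ x, v r x * v s x ∂ν| ≤ 3 * η := by
  have hw1 : lpNorm (w s) 2 ν ≤ 1 + η := by
    have := lpNorm_le_lpNorm_add_lpNorm_sub (f := w s) (hv s) (by norm_num : (1 : ENNReal) ≤ 2)
    linarith [hv1 s, hvw s]
  have hη0 : 0 ≤ η := lpNorm_nonneg.trans (hvw r)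
  have i1 : Integrable (fun x => w r x * w s x) ν := MemLp.integrable_mul (hw r) (hw s)
  have i2 : Integrable (fun x => v r x * v s x) ν := MemLp.integrable_mul (hv r) (hv s)
  have i3 : Integrable (fun x => (v r - w r) x * w s x) ν :=
    MemLp.integrable_mul ((hv r).sub (hw r)) (hw s)
  have i4 : Integrable (fun x => v r x * (v s - w s) x) ν :=
    MemLp.integrable_mul (hv r) ((hv s).sub (hw s))
  have e : ∫ x, w r x * w s x ∂ν - ∫ x, v r x * v s x ∂ν =
      -(∫ x, (v r - w r) x * w s x ∂ν + ∫ x, v r x * (v s - w s) x ∂ν) := by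
    rw [← integral_sub i1 i2, ← integral_add i3 i4, ← integral_neg]
    congr 1
    funext x; simp only [Pi.sub_apply]; ring
  rw [e, abs_neg]
  refine (abs_add_le _ _).trans ?_
  have h1 := abs_integral_mul_le ((hv r).sub (hw r)) (hw s)
  have h2 := abs_integral_mul_le (hv r) ((hv s).sub (hw s))
  have h3 := mul_le_mul (hvw r) hw1 lpNorm_nonneg hη0
  have h4 := mul_le_mul (hv1 r) (hvw s) lpNorm_nonneg zero_le_one
  nlinarith

/-- The family `v` consists of centred orthonormal functions. -/
structure IsCentredOrthonormal {R : Type*} (ν : Measure S) (v : R → S → ℝ) : Prop where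
  measurable : ∀ r, Measurable (v r)
  memLp : ∀ r, MemLp (v r) 2 ν
  mean : ∀ r, ∫ x, v r x ∂ν = 0
  norm : ∀ r, ∫ x, v r x ^ 2 ∂ν = 1
  orth : ∀ r s, r ≠ s → ∫ x, v r x * v s x ∂ν = 0

/-- The weights `δ_i ε_j` of a signed statistic. -/
def signWeight (δ ε : ℕ → ℝ) (i j : ℕ) : ℝ := δ i * ε j

variable {Ω : Type*} [MeasurableSpace Ω] {P : Measure Ω} [IsProbabilityMeasure P]

/-- The functions `v` are truncated to bounded ones, for which the statistic is the area of a walk.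
The difference of `f` and the truncated kernel is degenerate and is handled by second moments. The
threshold `N` does not depend on the sample or on the signs, because the cyclic statistic uses a
rearrangement of the sample that changes with `n`. -/
theorem exists_norm_integral_exp_signed_sub_le (lam : Q → ℝ) {v : Q ⊕ Q → S → ℝ}
    (hv : IsCentredOrthonormal ν v) {f : S → S → ℝ} (hfm : Measurable (Function.uncurry f))
    (hf : MemLp (Function.uncurry f) 2 (ν.prod ν)) (hf0 : IsDegenerate ν f) (t : ℝ) {κ : ℝ}
    (hκ : 0 < κ) : ∃ N : ℕ, ∀ n, N ≤ n → ∀ (Y : ℕ → Ω → S) (δ ε : ℕ → ℝ), IsSample P ν Y →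
      (∀ i, |δ i| = 1) → (∀ i, |ε i| = 1) →
      ‖∫ ω, Complex.exp ((t * ((n : ℝ)⁻¹ * weightedStat (signWeight δ ε) f n fun k => Y k ω) : ℝ) *
          Complex.I) ∂P - ((∏ q, (Real.cosh (t * lam q))⁻¹ : ℝ) : ℂ)‖ ≤
        |t| * lpNorm (Function.uncurry f - Function.uncurry (pairKernel lam v)) 2 (ν.prod ν) + κ := by
  classical
  obtain ⟨A, hA0, hA⟩ := exists_norm_integral_exp_walkArea_sub_le (fun q => t * lam q)
  have hv1 : ∀ r, lpNorm (v r) 2 ν ≤ 1 := fun r =>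
    le_of_sq_le_sq (by rw [lpNorm_two_sq (hv.memLp r), hv.norm]; norm_num) zero_le_one
  -- choice of the truncation level
  set L : ℝ := ∑ q, |lam q| with hL
  have hL0 : 0 ≤ L := Finset.sum_nonneg fun q _ => abs_nonneg _
  have hc0 : 0 < 1 + 6 * |t| * L + 3 * A := by positivity
  -- The bound `1 / 3` keeps the covariance defect `3 * η` at most 1. The other bound keeps the
  -- error `6 |t| L η` of the kernel and the error `3 A η` of the covariance together below `κ / 3`.
  set η : ℝ := min (1 / 3) (κ / 3 / (1 + 6 * |t| * L + 3 * A)) with hη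
  have hη0 : 0 < η := lt_min (by norm_num) (by positivity)
  have hη3 : η ≤ 1 / 3 := min_le_left _ _
  have hη1 : η ≤ 1 := by linarith
  have hηκ : (6 * |t| * L + 3 * A) * η ≤ κ / 3 := by
    have h1 : η ≤ κ / 3 / (1 + 6 * |t| * L + 3 * A) := min_le_right _ _
    rw [le_div_iff₀ hc0] at h1
    nlinarith
  choose w hwm hwb hw0 hvw using fun r => exists_bounded_lpNorm_sub_le (hv.memLp r) (hv.mean r) hη0
  choose b hb using hwb
  set M : ℝ := ∑ r, |b r| with hM
  have hM0 : 0 ≤ M := Finset.sum_nonneg fun r _ => abs_nonneg _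
  have hwM : ∀ r x, |w r x| ≤ M := fun r x => ((hb r x).trans (le_abs_self _)).trans
    (Finset.single_le_sum (f := fun r => |b r|) (fun r _ => abs_nonneg _) (Finset.mem_univ r))
  have hwL : ∀ r, MemLp (w r) 2 ν := fun r =>
    MemLp.of_bound (hwm r).aestronglyMeasurable M (ae_of_all _ (hwM r))
  obtain ⟨B, hB0, N₁, hN₁⟩ := hA M hM0
  have hsqrt : Tendsto (fun n : ℕ => B * (√(n : ℝ))⁻¹) atTop (𝓝 0) := by
    simpa using (tendsto_inv_atTop_zero.comp
      (Real.tendsto_sqrt_atTop.comp tendsto_natCast_atTop_atTop)).const_mul B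
  have hcosh : Tendsto (fun n : ℕ => ∏ q, (coshPoly n (t * lam q / n))⁻¹) atTop
      (𝓝 (∏ q, (Real.cosh (t * lam q))⁻¹)) :=
    tendsto_finsetProd _ fun q _ => (tendsto_coshPoly _).inv₀ (Real.cosh_pos _).ne'
  obtain ⟨N₂, hN₂⟩ := eventually_atTop.1 (hsqrt.eventually (gt_mem_nhds (by positivity : 0 < κ / 6)))
  obtain ⟨N₃, hN₃⟩ := eventually_atTop.1
    (hcosh.eventually (Metric.ball_mem_nhds _ (by positivity : 0 < κ / 6)))
  refine ⟨max (max N₁ N₂) (max N₃ 1), fun n hn Y δ ε hY hδ hε => ?_⟩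
  have hn1 : N₁ ≤ n := le_trans (by simp) hn
  have hn2 : N₂ ≤ n := le_trans (by simp) hn
  have hn3 : N₃ ≤ n := le_trans (by simp) hn
  have hn4 : 1 ≤ n := le_trans (by simp) hn
  have hn0 : (0 : ℝ) < n := by exact_mod_cast hn4
  -- the walk with bounded steps
  set z : ℕ → Ω → Q ⊕ Q → ℝ := fun i ω r => δ i * w r (Y i ω) with hz
  have hzφ : ∀ i, Measurable fun x : S => fun r => δ i * w r x := fun i =>
    measurable_pi_lambda _ fun r => (hwm r).const_mul _
  have hzm : ∀ i, Measurable (z i) := fun i => (hzφ i).comp (hY.measurable i)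
  have hzind : iIndepFun z P := hY.indep.comp (fun i x r => δ i * w r x) hzφ
  have hzmap : ∀ i, P.map (z i) = ν.map fun x r => δ i * w r x := fun i => by
    rw [← hY.map_eq i, Measure.map_map (hzφ i) (hY.measurable i)]; rfl
  have hδ2 : ∀ i, δ i * δ i = 1 := fun i => by rw [← abs_mul_abs_self, hδ, one_mul]
  have hcov := abs_integral_mul_sub_le hv.memLp hwL hv1 hη1 hvw
  have hiso : ∀ i, IsNearlyIsotropic (P.map (z i)) M (3 * η) := by
    intro i
    rw [hzmap i]
    refine ⟨?_, fun r => ?_, fun r => ?_, fun r s hrs => ?_⟩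
    · rw [ae_map_iff (hzφ i).aemeasurable]
      · refine ae_of_all _ fun x r => ?_
        rw [abs_mul, hδ, one_mul]; exact hwM r x
      · have : {u : Q ⊕ Q → ℝ | ∀ r, |u r| ≤ M} = ⋂ r, {u | |u r| ≤ M} := by ext; simp
        rw [this]
        exact MeasurableSet.iInter fun r =>
          measurableSet_le (measurable_pi_apply r).abs measurable_const
    · rw [integral_map (hzφ i).aemeasurable (measurable_pi_apply r).aestronglyMeasurable,
        integral_const_mul, hw0, mul_zero]
    · rw [integral_map (hzφ i).aemeasurable
        ((measurable_pi_apply r).pow_const 2).aestronglyMeasurable]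
      have := hcov r r
      simp_rw [← sq] at this
      rw [hv.norm] at this
      simp_rw [mul_pow, sq (δ i), hδ2, one_mul]
      exact this
    · rw [integral_map (hzφ i).aemeasurable
        (Measurable.aestronglyMeasurable (by fun_prop))]
      have := hcov r s
      rw [hv.orth r s hrs, sub_zero] at this
      have e : ∀ x, δ i * w r x * (δ i * w s x) = w r x * w s x := fun x => by
        linear_combination (w r x * w s x) * hδ2 i
      simp_rw [e]
      exact this
  have hmain := hN₁ n hn1 z (3 * η) (fun j => ε j * δ j) hzm hzind hiso (by positivity)
    (by linarith) fun j => by rw [abs_mul, hε, hδ, one_mul]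
  -- Since `δ j * δ j = 1`, the weight `δ i * ε j` equals `(ε j * δ j) * (δ i * δ j)`. The last two
  -- signs go into the steps by bilinearity, and the first product is the sign of the increment of
  -- area.
  have hwalk : ∀ ω, (n : ℝ)⁻¹ * ∑ j ∈ Finset.range n, ∑ i ∈ Finset.range j,
      ε j * δ j * sympForm (fun q => t * lam q) (z i ω) (z j ω) =
      t * ((n : ℝ)⁻¹ * weightedStat (signWeight δ ε) (pairKernel lam w) n fun k => Y k ω) := by
    intro ω
    rw [mul_left_comm t, weightedStat, Finset.mul_sum (a := t)]
    congr 1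
    refine Finset.sum_congr rfl fun j _ => ?_
    rw [Finset.mul_sum]
    refine Finset.sum_congr rfl fun i _ => ?_
    have : sympForm (fun q => t * lam q) (z i ω) (z j ω) =
        t * (δ i * δ j) * pairKernel lam w (Y i ω) (Y j ω) := by
      simp only [pairKernel, sympForm, hz, Finset.mul_sum]
      exact Finset.sum_congr rfl fun q _ => by ring
    rw [this, signWeight]
    linear_combination (t * δ i * ε j * pairKernel lam w (Y i ω) (Y j ω)) * hδ2 j
  simp_rw [hwalk] at hmain
  -- comparison of `f` with the truncated kernel
  have hKw := memLp_pairKernel lam hwL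
  have hKv := memLp_pairKernel lam hv.memLp
  set G : S → S → ℝ := fun x y => f x y - pairKernel lam w x y with hG
  have hGm : Measurable (Function.uncurry G) := hfm.sub (measurable_pairKernel lam hwm)
  have hGu : Function.uncurry G = Function.uncurry f - Function.uncurry (pairKernel lam w) := rfl
  have hGL : MemLp (Function.uncurry G) 2 (ν.prod ν) := hf.sub hKw
  have hG0 : IsDegenerate ν G := hf0.sub hf hKw (isDegenerate_pairKernel lam hwL hw0)
  have hsw : ∀ i j, |signWeight δ ε i j| ≤ 1 := fun i j => by
    rw [signWeight, abs_mul, hδ, hε, one_mul]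
  have hGn := hY.lpNorm_weightedStat_le hGm hGL hG0 hsw n
  have hdiff : (fun ω => (n : ℝ)⁻¹ * weightedStat (signWeight δ ε) f n fun k => Y k ω) -
      (fun ω => (n : ℝ)⁻¹ * weightedStat (signWeight δ ε) (pairKernel lam w) n fun k => Y k ω) =
      (n : ℝ)⁻¹ • fun ω => weightedStat (signWeight δ ε) G n fun k => Y k ω := by
    funext ω
    simp only [Pi.sub_apply, Pi.smul_apply, smul_eq_mul, ← mul_sub, weightedStat,
      ← Finset.sum_sub_distrib, hG]
  have hstat := fun (g : S → S → ℝ) (hg : MemLp (Function.uncurry g) 2 (ν.prod ν)) =>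
    hY.memLp_weightedStat hg (signWeight δ ε) n
  have h1 := norm_integral_exp_sub_le ((hstat f hf).const_mul (n : ℝ)⁻¹).1
    ((hstat _ hKw).const_mul (n : ℝ)⁻¹).1 (by rw [hdiff]; exact (hstat G hGL).const_smul _) t
  rw [hdiff, lpNorm_const_smul, Real.nnnorm_of_nonneg (inv_nonneg.2 hn0.le)] at h1
  have h2 : lpNorm (Function.uncurry G) 2 (ν.prod ν) ≤
      lpNorm (Function.uncurry f - Function.uncurry (pairKernel lam v)) 2 (ν.prod ν) + L * (6 * η) := by
    rw [hGu]
    refine (lpNorm_sub_le_lpNorm_sub_add_lpNorm_sub hf hKv (by norm_num)).trans ?_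
    exact add_le_add le_rfl (lpNorm_pairKernel_sub_le lam hv.memLp hwL hv1 hη1 hvw)
  have h3 : (n : ℝ)⁻¹ * lpNorm (fun ω => weightedStat (signWeight δ ε) G n fun k => Y k ω) 2 P ≤
      lpNorm (Function.uncurry G) 2 (ν.prod ν) := by
    rw [inv_mul_le_iff₀ hn0]; exact hGn
  have h4 := hN₂ n hn2
  have h5 := hN₃ n hn3
  rw [Real.dist_eq] at h5
  have h6 : ‖((∏ q, (coshPoly n (t * lam q / n))⁻¹ : ℝ) : ℂ) -
      ((∏ q, (Real.cosh (t * lam q))⁻¹ : ℝ) : ℂ)‖ ≤ κ / 6 := by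
    rw [← Complex.ofReal_sub, Complex.norm_real]; exact h5.le
  have h7 := norm_sub_le_norm_sub_add_norm_sub
    (∫ ω, Complex.exp ((t * ((n : ℝ)⁻¹ * weightedStat (signWeight δ ε) f n fun k => Y k ω) : ℝ) *
          Complex.I) ∂P)
    (∫ ω, Complex.exp ((t * ((n : ℝ)⁻¹ * weightedStat (signWeight δ ε) (pairKernel lam w) n
      fun k => Y k ω) : ℝ) * Complex.I) ∂P) ((∏ q, (Real.cosh (t * lam q))⁻¹ : ℝ) : ℂ)
  have h8 := norm_sub_le_norm_sub_add_norm_sub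
    (∫ ω, Complex.exp ((t * ((n : ℝ)⁻¹ * weightedStat (signWeight δ ε) (pairKernel lam w) n
      fun k => Y k ω) : ℝ) * Complex.I) ∂P) ((∏ q, (coshPoly n (t * lam q / n))⁻¹ : ℝ) : ℂ)
    ((∏ q, (Real.cosh (t * lam q))⁻¹ : ℝ) : ℂ)
  have h9 := mul_le_mul_of_nonneg_left (h3.trans h2) (abs_nonneg t)
  have h10 := h1.trans h9
  nlinarith

end FiniteRank

/-! ### The cyclic statistic as a bi-alternating one -/

section Cyclic

/-- The term with labels `i`, `k` occurs in the cyclic statistic of size `n`. -/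
def IsCyclicStep (n i k : ℕ) : Prop :=
  (i < k ∧ 2 * k < n + 2 * i) ∨ (k < i ∧ n + 2 * k < 2 * i)

instance (n i k : ℕ) : Decidable (IsCyclicStep n i k) := by
  unfold IsCyclicStep; infer_instance

theorem sum_cyclic_eq (n : ℕ) {i : ℕ} (hi : i < n) (G : ℕ → ℝ) :
    ∑ j ∈ (Finset.range n).filter (fun j => 1 ≤ j ∧ 2 * j < n), G ((i + j) % n) =
      ∑ k ∈ Finset.range n, if IsCyclicStep n i k then G k else 0 := by
  have hmod : ∀ j, j < n → (i + j) % n = if i + j < n then i + j else i + j - n := by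
    intro j hj
    split_ifs with h
    · exact Nat.mod_eq_of_lt h
    · rw [Nat.mod_eq_sub_mod (not_lt.1 h), Nat.mod_eq_of_lt (by omega)]
  rw [← Finset.sum_filter]
  refine Finset.sum_bij' (fun j _ => (i + j) % n) (fun k _ => if i < k then k - i else k + n - i)
    ?_ ?_ ?_ ?_ fun _ _ => rfl
  · intro j hj
    simp only [Finset.mem_filter, Finset.mem_range] at hj ⊢
    unfold IsCyclicStep
    rw [hmod j hj.1]
    split_ifs <;> omega
  · intro k hk
    simp only [Finset.mem_filter, Finset.mem_range] at hk ⊢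
    unfold IsCyclicStep at hk
    split_ifs <;> omega
  · intro j hj
    simp only [Finset.mem_filter, Finset.mem_range] at hj
    simp only [hmod j hj.1]
    split_ifs <;> omega
  · intro k hk
    simp only [Finset.mem_filter, Finset.mem_range] at hk
    unfold IsCyclicStep at hk
    rw [hmod _ (by split_ifs <;> omega)]
    split_ifs <;> omega

/-- The rearrangement `0, m, 1, m + 1, …` of `0, …, n - 1`, where `m = ⌈n / 2⌉`. -/
def shuffle (n p : ℕ) : ℕ :=
  if p < n then (if p % 2 = 0 then p / 2 else p / 2 + (n + 1) / 2) else p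

theorem shuffle_injective (n : ℕ) : Function.Injective (shuffle n) := by
  intro p q h
  simp only [shuffle] at h
  split_ifs at h <;> omega

theorem shuffle_lt {n p : ℕ} (hp : p < n) : shuffle n p < n := by
  simp only [shuffle]
  split_ifs <;> omega

theorem sum_range_shuffle (n : ℕ) (F : ℕ → ℝ) :
    ∑ p ∈ Finset.range n, F (shuffle n p) = ∑ k ∈ Finset.range n, F k := by
  have himg : (Finset.range n).image (shuffle n) = Finset.range n :=
    Finset.eq_of_subset_of_card_le
      (fun k hk => by
        obtain ⟨p, hp, rfl⟩ := Finset.mem_image.1 hk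
        exact Finset.mem_range.2 (shuffle_lt (Finset.mem_range.1 hp)))
      (Finset.card_image_of_injective _ (shuffle_injective n)).ge
  rw [← Finset.sum_image (fun p _ q _ h => shuffle_injective n h), himg]

/-- The weight of the neighbours `2k`, `2k + 1`, which is present only for even `n`. -/
def neighbourWeight (n i j : ℕ) : ℝ := if n % 2 = 0 ∧ i % 2 = 0 ∧ j = i + 1 then 1 else 0

/-- Even places list the first half of the cycle and odd places the second. Places `p < q` of equal
parity are less than half a turn apart in the forward direction, which gives `+1`; for opposite
parity the short way runs backwards, which gives `-1`. The exception is an antipodal pair, possible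
only for even `n` and `q = p + 1` with `p` even: it occurs in neither direction, and
`neighbourWeight` restores the value 0. -/
theorem cyclicStep_sub_cyclicStep {n p q : ℕ} (hpq : p < q) (hq : q < n) :
    ((if IsCyclicStep n (shuffle n p) (shuffle n q) then 1 else 0 : ℝ) -
        if IsCyclicStep n (shuffle n q) (shuffle n p) then 1 else 0) =
      signWeight (fun i => (-1) ^ i) (fun j => (-1) ^ j) p q + neighbourWeight n p q := by
  have hp : p < n := hpq.trans hq
  have hpow : ∀ a : ℕ, ((-1 : ℝ)) ^ a = if a % 2 = 0 then 1 else -1 := by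
    intro a
    split_ifs with h
    · exact (Nat.even_iff.2 h).neg_one_pow
    · exact (Nat.odd_iff.2 (by omega)).neg_one_pow
  simp only [signWeight, hpow, neighbourWeight, shuffle, hp, hq, if_true, IsCyclicStep]
  rcases Nat.mod_two_eq_zero_or_one p with h1 | h1 <;>
    rcases Nat.mod_two_eq_zero_or_one q with h2 | h2 <;>
    simp only [h1, h2, if_true, one_ne_zero, if_false, false_and, and_false, true_and]
  · rw [if_pos (by omega), if_neg (by omega), if_neg (by omega)]; norm_num
  · by_cases h : n % 2 = 0 ∧ q = p + 1
    · rw [if_neg (by omega), if_neg (by omega), if_pos h]; norm_num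
    · rw [if_neg (by omega), if_pos (by omega), if_neg h]; norm_num
  · rw [if_neg (by omega), if_pos (by omega)]; norm_num
  · rw [if_pos (by omega), if_neg (by omega)]; norm_num

theorem sum_range_sum_range_eq (n : ℕ) (F : ℕ → ℕ → ℝ) (h0 : ∀ i, F i i = 0)
    (hs : ∀ i j, F i j = F j i) :
    ∑ i ∈ Finset.range n, ∑ j ∈ Finset.range n, F i j =
      2 * ∑ j ∈ Finset.range n, ∑ i ∈ Finset.range j, F i j := by
  induction n with
  | zero => simp
  | succ n ih =>
    simp_rw [Finset.sum_range_succ, Finset.sum_add_distrib]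
    rw [ih, h0, Finset.sum_congr rfl fun j _ => hs n j]
    ring

variable {S : Type*}

theorem cyclic_eq_weightedStat {g : S → S → ℝ} (hg : ∀ x y, g x y = -g y x) (n : ℕ) (x : ℕ → S) :
    cyclic g n x = weightedStat (fun p q => signWeight (fun i => (-1) ^ i) (fun j => (-1) ^ j) p q +
      neighbourWeight n p q) g n fun k => x (shuffle n k) := by
  have hg0 : ∀ y, g y y = 0 := fun y => by linarith [hg y y]
  have h1 : cyclic g n x = ∑ p ∈ Finset.range n, ∑ q ∈ Finset.range n,
      if IsCyclicStep n (shuffle n p) (shuffle n q) then g (x (shuffle n p)) (x (shuffle n q))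
        else 0 := by
    rw [cyclic, Finset.sum_congr rfl fun i hi =>
      sum_cyclic_eq n (Finset.mem_range.1 hi) fun k => g (x i) (x k)]
    rw [← sum_range_shuffle]
    exact Finset.sum_congr rfl fun p _ => (sum_range_shuffle n _).symm
  -- Adding the sum with its two indices exchanged and using antisymmetry gives the difference of
  -- the two indicators. The new summand is symmetric and zero on the diagonal, so the sum over all
  -- pairs is twice the sum over increasing pairs.
  have h2 : 2 * cyclic g n x = ∑ p ∈ Finset.range n, ∑ q ∈ Finset.range n,
      ((if IsCyclicStep n (shuffle n p) (shuffle n q) then 1 else 0 : ℝ) -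
        if IsCyclicStep n (shuffle n q) (shuffle n p) then 1 else 0) *
        g (x (shuffle n p)) (x (shuffle n q)) := by
    rw [two_mul]
    refine (congrArg₂ (· + ·) h1 (h1.trans Finset.sum_comm)).trans ?_
    rw [← Finset.sum_add_distrib]
    refine Finset.sum_congr rfl fun p _ => ?_
    rw [← Finset.sum_add_distrib]
    refine Finset.sum_congr rfl fun q _ => ?_
    rw [hg (x (shuffle n q)) (x (shuffle n p))]
    split_ifs <;> ring
  rw [sum_range_sum_range_eq n _ (fun p => by rw [hg0, mul_zero])
    (fun p q => by rw [hg (x (shuffle n q)) (x (shuffle n p))]; ring)] at h2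
  rw [mul_left_cancel₀ two_ne_zero h2, weightedStat]
  refine Finset.sum_congr rfl fun q hq => Finset.sum_congr rfl fun p hp => ?_
  rw [cyclicStep_sub_cyclicStep (Finset.mem_range.1 hp) (Finset.mem_range.1 hq)]

theorem weightedStat_add (c d : ℕ → ℕ → ℝ) (g : S → S → ℝ) (n : ℕ) (x : ℕ → S) :
    weightedStat (fun i j => c i j + d i j) g n x = weightedStat c g n x + weightedStat d g n x := by
  simp only [weightedStat, add_mul, Finset.sum_add_distrib]

theorem sum_neighbourWeight_sq_le (n : ℕ) :
    ∑ j ∈ Finset.range n, ∑ i ∈ Finset.range j, neighbourWeight n i j ^ 2 ≤ n := by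
  calc _ ≤ ∑ _j ∈ Finset.range n, (1 : ℝ) := by
        refine Finset.sum_le_sum fun j _ => ?_
        -- Each `j` has at most one partner. For `j = 0` the range is empty, so the truncated
        -- subtraction is harmless.
        calc _ ≤ ∑ i ∈ Finset.range j, if i = j - 1 then (1 : ℝ) else 0 := by
              refine Finset.sum_le_sum fun i _ => ?_
              simp only [neighbourWeight]
              split_ifs with h1 h2 h2
              · norm_num
              · omega
              · norm_num
              · norm_num
          _ ≤ 1 := by
              rw [Finset.sum_ite_eq']
              split_ifs <;> norm_num
    _ = n := by simp

theorem standard_eq_weightedStat (g : S → S → ℝ) (n : ℕ) (x : ℕ → S) :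
    standard g n x = weightedStat (signWeight (fun _ => 1) fun _ => 1) g n x := by
  simp [standard, weightedStat, signWeight]

theorem biAlternating_eq_weightedStat (g : S → S → ℝ) (n : ℕ) (x : ℕ → S) :
    biAlternating g n x =
      weightedStat (signWeight (fun i => (-1) ^ (i + 1)) fun j => (-1) ^ (j + 1)) g n x := by
  simp only [biAlternating, weightedStat, signWeight, pow_add]

theorem alternatingPM_eq_weightedStat (g : S → S → ℝ) (n : ℕ) (x : ℕ → S) :
    alternatingPM g n x = weightedStat (signWeight (fun _ => 1) fun j => (-1) ^ (j + 1)) g n x := by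
  simp only [alternatingPM, weightedStat, signWeight, one_mul]

theorem alternatingMP_eq_weightedStat (g : S → S → ℝ) (n : ℕ) (x : ℕ → S) :
    alternatingMP g n x =
      weightedStat (signWeight (fun i => (-1) ^ (i + 1 + 1)) fun _ => 1) g n x := by
  simp only [alternatingMP, weightedStat, signWeight, mul_one]

end Cyclic

/-! ### Degeneracy and exact antisymmetry -/

section Antisymmetric

variable {S : Type*} [MeasurableSpace S] {ν : Measure S} {Ω : Type*} [MeasurableSpace Ω]
  {P : Measure Ω} {Y : ℕ → Ω → S}

theorem IsSample.comp_injective (hY : IsSample P ν Y) {σ : ℕ → ℕ} (hσ : Function.Injective σ) :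
    IsSample P ν fun k => Y (σ k) :=
  ⟨fun _ => hY.measurable _, fun _ => hY.map_eq _, hY.indep.precomp hσ⟩

variable [IsProbabilityMeasure P]

theorem IsSample.ae_eq_of_ne (hY : IsSample P ν Y) {f g : S → S → ℝ}
    (hfg : ∀ᵐ p ∂(ν.prod ν), f p.1 p.2 = g p.1 p.2) :
    ∀ᵐ ω ∂P, ∀ i j, i ≠ j → f (Y i ω) (Y j ω) = g (Y i ω) (Y j ω) := by
  rw [ae_all_iff]; intro i
  rw [ae_all_iff]; intro j
  by_cases hij : i = j
  · exact ae_of_all _ fun _ h => absurd hij h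
  · filter_upwards [(hY.measurePreserving hij).quasiMeasurePreserving.ae hfg] with ω hω _ using hω

variable [IsProbabilityMeasure ν]

/-- Antisymmetry makes the mean zero, so `f = f₁₂` says that `f₁(x) + f₂(y) = 0` for almost all
pairs. Integrating out one variable removes its projection, which has mean zero, and leaves the
other one. -/
theorem isDegenerate_of_antisymmetric {f : S → S → ℝ}
    (hf : MemLp (Function.uncurry f) 2 (ν.prod ν))
    (hf_anti : ∀ᵐ p ∂(ν.prod ν), f p.1 p.2 = -f p.2 p.1)
    (hf_pair : ∀ᵐ p ∂(ν.prod ν), f p.1 p.2 = hoeffdingPair ν f p.1 p.2) : IsDegenerate ν f := by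
  have hI : Integrable (Function.uncurry f) (ν.prod ν) := hf.integrable (by norm_num)
  have hI' : Integrable (fun p : S × S => f p.1 p.2) (ν.prod ν) := hI
  have hmean : hoeffdingMean ν f = 0 := by
    have h1 : hoeffdingMean ν f = ∫ p, f p.2 p.1 ∂(ν.prod ν) :=
      (integral_prod_swap (fun p : S × S => f p.1 p.2)).symm
    have h2 : hoeffdingMean ν f = -∫ p, f p.2 p.1 ∂(ν.prod ν) := by
      rw [← integral_neg]; exact integral_congr_ae hf_anti
    linarith
  have h1 : hoeffdingFst ν f = fun x => ∫ y, f x y ∂ν := by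
    funext x; rw [hoeffdingFst, hmean, sub_zero]
  have h2 : hoeffdingSnd ν f = fun y => ∫ x, f x y ∂ν := by
    funext y; rw [hoeffdingSnd, hmean, sub_zero]
  have hsum : ∀ᵐ p ∂(ν.prod ν), (∫ y, f p.1 y ∂ν) + ∫ x, f x p.2 ∂ν = 0 := by
    filter_upwards [hf_pair] with p hp
    rw [hoeffdingPair, h1, h2, hmean] at hp
    linarith
  have i1 : Integrable (fun x => ∫ y, f x y ∂ν) ν := hI.integral_prod_left
  have i2 : Integrable (fun y => ∫ x, f x y ∂ν) ν := hI.integral_prod_right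
  have m1 : ∫ x, ∫ y, f x y ∂ν ∂ν = 0 := by
    rw [integral_integral hI]; exact hmean
  have m2 : ∫ y, ∫ x, f x y ∂ν ∂ν = 0 := by
    rw [integral_integral_swap (f := fun y x => f x y) hI.swap, m1]
  constructor
  · filter_upwards [Measure.ae_ae_of_ae_prod hsum] with x hx
    have := integral_congr_ae hx
    rw [integral_add (integrable_const _) i2, m2] at this
    simpa using this
  · have hsw : ∀ᵐ p ∂(ν.prod ν), (∫ y, f p.2 y ∂ν) + ∫ x, f x p.1 ∂ν = 0 :=
      Measure.measurePreserving_swap.quasiMeasurePreserving.ae hsum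
    filter_upwards [Measure.ae_ae_of_ae_prod hsw] with y hy
    have := integral_congr_ae hy
    rw [integral_add i1 (integrable_const _), m1] at this
    simpa using this

/-- The conditions `1 ≤ j` and `2 * j < n` exclude coincidences modulo `n`, so values of the kernel
at equal indices never occur. -/
theorem cyclic_congr {S : Type*} {f g : S → S → ℝ} {x : ℕ → S}
    (h : ∀ i j, i ≠ j → f (x i) (x j) = g (x i) (x j)) (n : ℕ) :
    cyclic f n x = cyclic g n x := by
  unfold cyclic
  refine Finset.sum_congr rfl fun i hi => Finset.sum_congr rfl fun j hj => h _ _ ?_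
  simp only [Finset.mem_filter, Finset.mem_range] at hi hj
  intro h
  rcases lt_or_ge (i + j) n with h1 | h1
  · rw [Nat.mod_eq_of_lt h1] at h; omega
  · rw [Nat.mod_eq_sub_mod h1, Nat.mod_eq_of_lt (by omega)] at h; omega

variable {Q : Type*} [Fintype Q]

/-- The rearrangement needs exact antisymmetry, so `f` is replaced by its antisymmetric part, which
agrees with it almost everywhere. For each `n` the rearranged observations are again a sample, to
which the signed estimate applies. The sum over neighbours consists of at most `n` orthogonal terms
and is of order `n^(-1/2)` after normalisation. -/
theorem exists_norm_integral_exp_cyclic_sub_le (lam : Q → ℝ) {v : Q ⊕ Q → S → ℝ}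
    (hv : IsCentredOrthonormal ν v) {f : S → S → ℝ} (hfm : Measurable (Function.uncurry f))
    (hf : MemLp (Function.uncurry f) 2 (ν.prod ν)) (hf0 : IsDegenerate ν f)
    (hf_anti : ∀ᵐ p ∂(ν.prod ν), f p.1 p.2 = -f p.2 p.1) (hY : IsSample P ν Y) (t : ℝ) {κ : ℝ}
    (hκ : 0 < κ) : ∃ N : ℕ, ∀ n, N ≤ n →
      ‖∫ ω, Complex.exp ((t * ((n : ℝ)⁻¹ * cyclic f n fun k => Y k ω) : ℝ) *
          Complex.I) ∂P - ((∏ q, (Real.cosh (t * lam q))⁻¹ : ℝ) : ℂ)‖ ≤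
        |t| * lpNorm (Function.uncurry f - Function.uncurry (pairKernel lam v)) 2 (ν.prod ν) + κ := by
  set g : S → S → ℝ := fun x y => (f x y - f y x) / 2 with hg
  have hanti : ∀ x y, g x y = -g y x := fun x y => by simp only [hg]; ring
  have hfg : ∀ᵐ p ∂(ν.prod ν), f p.1 p.2 = g p.1 p.2 := by
    filter_upwards [hf_anti] with p hp
    simp only [hg]; linarith
  have hfg' : Function.uncurry f =ᵐ[ν.prod ν] Function.uncurry g := hfg
  have hgm : Measurable (Function.uncurry g) := (hfm.sub (hfm.comp measurable_swap)).div_const 2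
  have hgL : MemLp (Function.uncurry g) 2 (ν.prod ν) := hf.ae_eq hfg'
  have hg0 : IsDegenerate ν g := by
    constructor
    · filter_upwards [hf0.1, Measure.ae_ae_of_ae_prod hfg] with x hx h
      rw [← hx]; exact (integral_congr_ae h).symm
    · have hsw := Measure.measurePreserving_swap.quasiMeasurePreserving.ae hfg
      filter_upwards [hf0.2, Measure.ae_ae_of_ae_prod hsw] with x hx h
      rw [← hx]; exact (integral_congr_ae h).symm
  have hKL := memLp_pairKernel lam hv.memLp
  have hD : lpNorm (Function.uncurry g - Function.uncurry (pairKernel lam v)) 2 (ν.prod ν) =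
      lpNorm (Function.uncurry f - Function.uncurry (pairKernel lam v)) 2 (ν.prod ν) := by
    rw [← toReal_eLpNorm (hgL.sub hKL).1, ← toReal_eLpNorm (hf.sub hKL).1,
      eLpNorm_congr_ae (hfg'.symm.sub EventuallyEq.rfl)]
  obtain ⟨N, hN⟩ := exists_norm_integral_exp_signed_sub_le (Ω := Ω) (P := P) lam hv hgm hgL hg0 t
    (half_pos hκ)
  set C : ℝ := |t| * lpNorm (Function.uncurry g) 2 (ν.prod ν) with hC
  have hsqrt : Tendsto (fun n : ℕ => C * (√(n : ℝ))⁻¹) atTop (𝓝 0) := by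
    simpa using (tendsto_inv_atTop_zero.comp
      (Real.tendsto_sqrt_atTop.comp tendsto_natCast_atTop_atTop)).const_mul C
  obtain ⟨N₂, hN₂⟩ := eventually_atTop.1 (hsqrt.eventually (gt_mem_nhds (half_pos hκ)))
  refine ⟨max (max N N₂) 1, fun n hn => ?_⟩
  have hn1 : N ≤ n := le_trans (by simp) hn
  have hn2 : N₂ ≤ n := le_trans (by simp) hn
  have hn3 : 1 ≤ n := le_trans (by simp) hn
  have hn0 : (0 : ℝ) < n := by exact_mod_cast hn3
  have hZ := hY.comp_injective (shuffle_injective n)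
  have hmain := hN n hn1 _ (fun i => (-1) ^ i) (fun j => (-1) ^ j) hZ (by simp) (by simp)
  rw [hD] at hmain
  set A : Ω → ℝ := fun ω => (n : ℝ)⁻¹ * weightedStat
    (signWeight (fun i => (-1) ^ i) (fun j => (-1) ^ j)) g n fun k => Y (shuffle n k) ω with hA
  set B : Ω → ℝ := fun ω => (n : ℝ)⁻¹ * weightedStat (neighbourWeight n) g n
    fun k => Y (shuffle n k) ω with hB
  have hAL : MemLp A 2 P := (hZ.memLp_weightedStat hgL _ n).const_mul _
  have hBL : MemLp B 2 P := (hZ.memLp_weightedStat hgL _ n).const_mul _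
  have hcyc : ∫ ω, Complex.exp ((t * ((n : ℝ)⁻¹ * cyclic f n fun k => Y k ω) : ℝ) *
      Complex.I) ∂P = ∫ ω, Complex.exp ((t * (A + B) ω : ℝ) * Complex.I) ∂P := by
    refine integral_congr_ae ?_
    filter_upwards [hY.ae_eq_of_ne hfg] with ω hω
    rw [cyclic_congr hω, cyclic_eq_weightedStat hanti, weightedStat_add, mul_add]
    rfl
  have h1 := norm_integral_exp_sub_le (hAL.add hBL).1 hAL.1
    (by rw [add_sub_cancel_left]; exact hBL) t
  rw [add_sub_cancel_left] at h1
  have hBn : lpNorm B 2 P ≤ (√(n : ℝ))⁻¹ * lpNorm (Function.uncurry g) 2 (ν.prod ν) := by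
    have e : B = (n : ℝ)⁻¹ • fun ω => weightedStat (neighbourWeight n) g n
      fun k => Y (shuffle n k) ω := rfl
    refine le_of_sq_le_sq ?_ (mul_nonneg (by positivity) lpNorm_nonneg)
    rw [e, lpNorm_const_smul, mul_pow, hZ.lpNorm_weightedStat_sq hgm hgL hg0, mul_pow, ← mul_assoc]
    refine mul_le_mul_of_nonneg_right ?_ (sq_nonneg _)
    rw [inv_pow, Real.sq_sqrt hn0.le]
    have e2 : ((‖(n : ℝ)⁻¹‖₊ : NNReal) : ℝ) = (n : ℝ)⁻¹ := by simp
    rw [e2]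
    calc _ ≤ (n : ℝ)⁻¹ ^ 2 * n :=
          mul_le_mul_of_nonneg_left (sum_neighbourWeight_sq_le n) (by positivity)
      _ = _ := by field_simp
  have h2 := hN₂ n hn2
  rw [hcyc]
  have h3 := norm_sub_le_norm_sub_add_norm_sub
    (∫ ω, Complex.exp ((t * (A + B) ω : ℝ) * Complex.I) ∂P)
    (∫ ω, Complex.exp ((t * A ω : ℝ) * Complex.I) ∂P) ((∏ q, (Real.cosh (t * lam q))⁻¹ : ℝ) : ℂ)
  have h4 := mul_le_mul_of_nonneg_left hBn (abs_nonneg t)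
  have h5 : |t| * ((√(n : ℝ))⁻¹ * lpNorm (Function.uncurry g) 2 (ν.prod ν)) =
    C * (√(n : ℝ))⁻¹ := by rw [hC]; ring
  linarith

end Antisymmetric

/-! ### Integral operators on `L²` -/

section KernelOperator

open scoped InnerProductSpace ComplexConjugate

variable {S : Type*} [MeasurableSpace S] {ν : Measure S}

theorem memLp_uncurry_coeFn (H : Lp ℂ 2 (ν.prod ν)) :
    MemLp (Function.uncurry fun x y => H (x, y)) 2 (ν.prod ν) := Lp.memLp H

theorem memLp_uncurry_ofReal {f : S → S → ℝ} (hf : MemLp (Function.uncurry f) 2 (ν.prod ν)) :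
    MemLp (Function.uncurry fun x y => (f x y : ℂ)) 2 (ν.prod ν) := hf.ofReal

/-! Complex conjugation -/

theorem inner_star_star (ψ φ : Lp ℂ 2 ν) : ⟪star ψ, star φ⟫_ℂ = conj ⟪ψ, φ⟫_ℂ := by
  rw [L2.inner_def, L2.inner_def, ← integral_conj]
  refine integral_congr_ae ?_
  filter_upwards [Lp.coeFn_star ψ, Lp.coeFn_star φ] with x h1 h2
  rw [h1, h2]
  simp [RCLike.inner_apply, mul_comm]

theorem Lp_star_smul (c : ℂ) (φ : Lp ℂ 2 ν) : star (c • φ) = conj c • star φ := by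
  refine Lp.ext ?_
  filter_upwards [Lp.coeFn_star (c • φ), Lp.coeFn_smul c φ, Lp.coeFn_smul (conj c) (star φ),
    Lp.coeFn_star φ] with x h1 h2 h3 h4
  rw [h1, h3, Pi.star_apply, h2, Pi.smul_apply, Pi.smul_apply, h4, Pi.star_apply]
  simp

theorem Lp_star_add (φ ψ : Lp ℂ 2 ν) : star (φ + ψ) = star φ + star ψ := by
  refine Lp.ext ?_
  filter_upwards [Lp.coeFn_star (φ + ψ), Lp.coeFn_add φ ψ, Lp.coeFn_add (star φ) (star ψ),
    Lp.coeFn_star φ, Lp.coeFn_star ψ] with x h1 h2 h3 h4 h5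
  rw [h1, h3, Pi.star_apply, h2, Pi.add_apply, Pi.add_apply, h4, h5, Pi.star_apply, Pi.star_apply,
    star_add]

variable [IsProbabilityMeasure ν]

theorem memLp_tensor (ψ φ : Lp ℂ 2 ν) :
    MemLp (fun p : S × S => ψ p.1 * conj (φ p.2)) 2 (ν.prod ν) := by
  have hm : AEStronglyMeasurable (fun p : S × S => ψ p.1 * conj (φ p.2)) (ν.prod ν) :=
    ((Lp.memLp ψ).comp_fst ν).1.mul ((Lp.memLp φ).star.comp_snd ν).1
  rw [memLp_two_iff_integrable_sq_norm hm]
  simp_rw [norm_mul, mul_pow, RCLike.norm_conj]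
  exact Integrable.mul_prod ((Lp.memLp ψ).integrable_norm_pow two_ne_zero)
    ((Lp.memLp φ).integrable_norm_pow two_ne_zero)

/-- The kernel `ψ(x) conj (φ(y))` as an element of `L²(ν ⊗ ν)`. -/
def tensor (ψ φ : Lp ℂ 2 ν) : Lp ℂ 2 (ν.prod ν) := (memLp_tensor ψ φ).toLp _

theorem coeFn_tensor (ψ φ : Lp ℂ 2 ν) :
    tensor ψ φ =ᵐ[ν.prod ν] fun p : S × S => ψ p.1 * conj (φ p.2) := MemLp.coeFn_toLp _

theorem inner_tensor_tensor (ψ φ ψ' φ' : Lp ℂ 2 ν) :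
    ⟪tensor ψ φ, tensor ψ' φ'⟫_ℂ = ⟪ψ, ψ'⟫_ℂ * ⟪φ', φ⟫_ℂ := by
  rw [L2.inner_def, L2.inner_def, L2.inner_def, ← integral_prod_mul]
  refine integral_congr_ae ?_
  filter_upwards [coeFn_tensor ψ φ, coeFn_tensor ψ' φ'] with p h1 h2
  rw [h1, h2]
  simp only [RCLike.inner_apply, map_mul, Complex.conj_conj]
  ring

/-- By Fubini, matrix coefficients of the operator are inner products of its kernel with elementary
tensors. This is the bridge over which Bessel's inequality and uniqueness pass between kernels and
operators. -/
theorem inner_integralOperator {g : S → S → ℂ} (hg : MemLp (Function.uncurry g) 2 (ν.prod ν))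
    (ψ φ : Lp ℂ 2 ν) :
    ⟪ψ, integralOperator ν g hg φ⟫_ℂ = ⟪tensor ψ φ, hg.toLp (Function.uncurry g)⟫_ℂ := by
  have hI : Integrable (fun p : S × S => g p.1 p.2 * (φ p.2 * conj (ψ p.1))) (ν.prod ν) := by
    have := MemLp.integrable_mul hg (memLp_tensor ψ φ).star
    refine this.congr (ae_of_all _ fun p => ?_)
    simp [Function.uncurry, mul_comm]
  rw [L2.inner_def, L2.inner_def]
  have h1 : ∫ p, ⟪tensor ψ φ p, hg.toLp (Function.uncurry g) p⟫_ℂ ∂(ν.prod ν) =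
      ∫ p : S × S, g p.1 p.2 * (φ p.2 * conj (ψ p.1)) ∂(ν.prod ν) := by
    refine integral_congr_ae ?_
    filter_upwards [coeFn_tensor ψ φ, hg.coeFn_toLp] with p h1 h2
    rw [h1, h2]
    simp only [RCLike.inner_apply, map_mul, Complex.conj_conj, Function.uncurry]
    ring
  rw [h1, integral_prod _ hI]
  refine integral_congr_ae ?_
  filter_upwards [integralOperator_apply g hg φ] with x hx
  rw [hx, RCLike.inner_apply, ← integral_mul_const]
  congr 1
  funext y
  ring

theorem tensor_indicator {A B : Set S} (hA : MeasurableSet A) (hB : MeasurableSet B) :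
    tensor (indicatorConstLp 2 hA (measure_ne_top ν A) (1 : ℂ))
      (indicatorConstLp 2 hB (measure_ne_top ν B) (1 : ℂ)) =
      indicatorConstLp 2 (hA.prod hB) (measure_ne_top (ν.prod ν) (A ×ˢ B)) (1 : ℂ) := by
  refine Lp.ext ((coeFn_tensor _ _).trans ?_)
  have h1 := Measure.quasiMeasurePreserving_fst (μ := ν) (ν := ν) |>.ae
    (indicatorConstLp_coeFn (p := 2) (hs := hA) (hμs := measure_ne_top ν A) (c := (1 : ℂ)))
  have h2 := Measure.quasiMeasurePreserving_snd (μ := ν) (ν := ν) |>.ae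
    (indicatorConstLp_coeFn (p := 2) (hs := hB) (hμs := measure_ne_top ν B) (c := (1 : ℂ)))
  filter_upwards [h1, h2, indicatorConstLp_coeFn (p := 2) (hs := hA.prod hB)
    (hμs := measure_ne_top (ν.prod ν) (A ×ˢ B)) (c := (1 : ℂ))] with p h1 h2 h3
  rw [h1, h2, h3]
  by_cases hpA : p.1 ∈ A <;> by_cases hpB : p.2 ∈ B <;> simp [Set.indicator, hpA, hpB]

/-- A square integrable kernel orthogonal to all products vanishes. -/
theorem eq_zero_of_inner_tensor {G : Lp ℂ 2 (ν.prod ν)} (h : ∀ ψ φ, ⟪tensor ψ φ, G⟫_ℂ = 0) :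
    G = 0 := by
  have hGI : Integrable G (ν.prod ν) := (Lp.memLp G).integrable (by norm_num)
  have hrect : ∀ A B : Set S, MeasurableSet A → MeasurableSet B →
      ∫ p in A ×ˢ B, G p ∂(ν.prod ν) = 0 := by
    intro A B hA hB
    have := h (indicatorConstLp 2 hA (measure_ne_top ν A) (1 : ℂ))
      (indicatorConstLp 2 hB (measure_ne_top ν B) (1 : ℂ))
    rwa [tensor_indicator, L2.inner_indicatorConstLp_one] at this
  have hall : ∀ s, MeasurableSet s → ∫ p in s, G p ∂(ν.prod ν) = 0 := by
    intro s hs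
    induction s, hs using MeasurableSpace.induction_on_inter generateFrom_prod.symm
      isPiSystem_prod with
    | empty => simp
    | basic t ht =>
      obtain ⟨A, hA, B, hB, rfl⟩ := ht
      exact hrect A B hA hB
    | compl t ht ih =>
      have h1 := integral_add_compl ht hGI
      have h2 := hrect Set.univ Set.univ .univ .univ
      rw [Set.univ_prod_univ, Measure.restrict_univ] at h2
      rw [ih, h2, zero_add] at h1
      exact h1
    | iUnion t hd ht ih =>
      rw [integral_iUnion ht hd hGI.integrableOn]
      simp [ih]
  have h0 : G =ᵐ[ν.prod ν] 0 :=
    Integrable.ae_eq_zero_of_forall_setIntegral_eq_zero hGI fun s hs _ => hall s hs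
  exact (Lp.eq_zero_iff_ae_eq_zero).2 h0

/-- The integral operator whose kernel is an element of `L²(ν ⊗ ν)`. -/
def kernelOperator (H : Lp ℂ 2 (ν.prod ν)) : Lp ℂ 2 ν →L[ℂ] Lp ℂ 2 ν :=
  integralOperator ν (fun x y => H (x, y)) (memLp_uncurry_coeFn H)

theorem inner_kernelOperator (H : Lp ℂ 2 (ν.prod ν)) (ψ φ : Lp ℂ 2 ν) :
    ⟪ψ, kernelOperator H φ⟫_ℂ = ⟪tensor ψ φ, H⟫_ℂ := by
  rw [kernelOperator, inner_integralOperator]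
  congr 1
  exact Lp.toLp_coeFn H (Lp.memLp H)

theorem integralOperator_eq_kernelOperator {g : S → S → ℂ}
    (hg : MemLp (Function.uncurry g) 2 (ν.prod ν)) :
    integralOperator ν g hg = kernelOperator (hg.toLp (Function.uncurry g)) := by
  refine ContinuousLinearMap.ext fun φ => ext_inner_left ℂ fun ψ => ?_
  rw [inner_integralOperator, inner_kernelOperator]

theorem norm_kernelOperator_le (H : Lp ℂ 2 (ν.prod ν)) : ‖kernelOperator H‖ ≤ ‖H‖ := by
  refine ContinuousLinearMap.opNorm_le_bound _ (norm_nonneg _) fun φ => ?_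
  rw [Lp.norm_def, Lp.norm_def, Lp.norm_def, ← ENNReal.toReal_mul, kernelOperator,
    eLpNorm_congr_ae (integralOperator_apply _ (memLp_uncurry_coeFn H) φ)]
  exact ENNReal.toReal_mono (ENNReal.mul_lt_top (Lp.memLp H).2 (Lp.memLp φ).2).ne
    (eLpNorm_integral_mul_le (memLp_uncurry_coeFn H) (Lp.memLp φ))

variable (ν) in
/-- `kernelOperator` as a continuous linear map. -/
def kernelOperatorL : Lp ℂ 2 (ν.prod ν) →L[ℂ] Lp ℂ 2 ν →L[ℂ] Lp ℂ 2 ν :=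
  LinearMap.mkContinuous
    { toFun := kernelOperator
      map_add' := fun H K => by
        refine ContinuousLinearMap.ext fun φ => ext_inner_left ℂ fun ψ => ?_
        rw [add_apply, inner_add_right]
        simp only [inner_kernelOperator, inner_add_right]
      map_smul' := fun c H => by
        refine ContinuousLinearMap.ext fun φ => ext_inner_left ℂ fun ψ => ?_
        rw [RingHom.id_apply, smul_apply, inner_smul_right]
        simp only [inner_kernelOperator, inner_smul_right] }
    1 fun H => by rw [one_mul]; exact norm_kernelOperator_le H

theorem kernelOperatorL_apply (H : Lp ℂ 2 (ν.prod ν)) : kernelOperatorL ν H = kernelOperator H :=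
  rfl

theorem kernelOperator_tensor (ψ φ χ : Lp ℂ 2 ν) :
    kernelOperator (tensor ψ φ) χ = ⟪φ, χ⟫_ℂ • ψ := by
  refine ext_inner_left ℂ fun ω => ?_
  rw [inner_kernelOperator, inner_tensor_tensor, inner_smul_right, mul_comm]

theorem span_tensor_dense :
    (Submodule.span ℂ (Set.range fun p : Lp ℂ 2 ν × Lp ℂ 2 ν => tensor p.1 p.2)).topologicalClosure
      = ⊤ := by
  rw [Submodule.topologicalClosure_eq_top_iff, Submodule.eq_bot_iff]
  intro G hG
  refine eq_zero_of_inner_tensor fun ψ φ => ?_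
  exact hG _ (Submodule.subset_span ⟨(ψ, φ), rfl⟩)

/-- Elementary tensors give operators of rank at most one and span a dense subspace. The operator
norm is bounded by the L² norm of the kernel, and compact operators form a closed set. -/
theorem isCompactOperator_kernelOperator (H : Lp ℂ 2 (ν.prod ν)) :
    IsCompactOperator (kernelOperator H) := by
  set V : Submodule ℂ (Lp ℂ 2 (ν.prod ν)) :=
    (compactOperator (RingHom.id ℂ) (Lp ℂ 2 ν) (Lp ℂ 2 ν)).comap (kernelOperatorL ν).toLinearMap
    with hV
  have hclosed : IsClosed (V : Set (Lp ℂ 2 (ν.prod ν))) :=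
    (isClosed_setOfPred_isCompactOperator (σ₁₂ := RingHom.id ℂ) (M₁ := Lp ℂ 2 ν)
      (M₂ := Lp ℂ 2 ν)).preimage (kernelOperatorL ν).continuous
  have hle : Submodule.span ℂ (Set.range fun p : Lp ℂ 2 ν × Lp ℂ 2 ν => tensor p.1 p.2) ≤ V := by
    rw [Submodule.span_le]
    rintro _ ⟨⟨ψ, φ⟩, rfl⟩
    change IsCompactOperator (kernelOperator (tensor ψ φ))
    have h1 : IsCompactOperator (innerSL ℂ φ) :=
      (isCompactOperator_id (E := ℂ)).comp_clm (innerSL ℂ φ)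
    have h2 := h1.clm_comp (ContinuousLinearMap.toSpanSingleton ℂ ψ)
    refine (congrArg IsCompactOperator ?_).mpr h2
    funext χ
    rw [kernelOperator_tensor]
    simp
  have := Submodule.topologicalClosure_minimal _ hle hclosed
  rw [span_tensor_dense] at this
  exact this (Submodule.mem_top (x := H))

variable {f : S → S → ℝ} (hf : MemLp (Function.uncurry f) 2 (ν.prod ν))

theorem realKernelOperator_eq : realKernelOperator ν f hf =
    integralOperator ν (fun x y => (f x y : ℂ)) (memLp_uncurry_ofReal hf) := rfl

/-- The kernel is real. Hence conjugation exchanges the eigenvectors for `z` and for the conjugate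
of `z`. -/
theorem realKernelOperator_star (φ : Lp ℂ 2 ν) :
    realKernelOperator ν f hf (star φ) = star (realKernelOperator ν f hf φ) := by
  refine Lp.ext ?_
  filter_upwards [integralOperator_apply _ (memLp_uncurry_ofReal hf) (star φ),
    integralOperator_apply _ (memLp_uncurry_ofReal hf) φ, Lp.coeFn_star (realKernelOperator ν f hf φ)] with x h1 h2 h3
  rw [h3, Pi.star_apply, realKernelOperator_eq, h1, h2]
  rw [RCLike.star_def, ← integral_conj]
  refine integral_congr_ae ?_
  filter_upwards [Lp.coeFn_star φ] with y hy
  rw [hy]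
  simp

theorem inner_realKernelOperator_left
    (hf_anti : ∀ᵐ p ∂(ν.prod ν), f p.1 p.2 = -f p.2 p.1) (ψ φ : Lp ℂ 2 ν) :
    ⟪realKernelOperator ν f hf ψ, φ⟫_ℂ = -⟪ψ, realKernelOperator ν f hf φ⟫_ℂ := by
  have key : ∀ ψ φ : Lp ℂ 2 ν, ⟪ψ, realKernelOperator ν f hf φ⟫_ℂ =
      ∫ p : S × S, (f p.1 p.2 : ℂ) * (φ p.2 * conj (ψ p.1)) ∂(ν.prod ν) := by
    intro ψ φ
    rw [realKernelOperator_eq, inner_integralOperator, L2.inner_def]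
    refine integral_congr_ae ?_
    filter_upwards [coeFn_tensor ψ φ, (memLp_uncurry_ofReal hf).coeFn_toLp] with p h1 h2
    rw [h1, h2]
    simp only [RCLike.inner_apply, map_mul, Complex.conj_conj, Function.uncurry]
    ring
  rw [← inner_conj_symm, key, key, ← integral_conj, ← integral_prod_swap, ← integral_neg]
  refine integral_congr_ae ?_
  filter_upwards [hf_anti] with p hp
  simp only [map_mul, Complex.conj_ofReal, Complex.conj_conj, Prod.fst_swap, Prod.snd_swap]
  rw [hp]
  push_cast
  ring

theorem isCompactOperator_realKernelOperator : IsCompactOperator (realKernelOperator ν f hf) := by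
  rw [realKernelOperator_eq, integralOperator_eq_kernelOperator]
  exact isCompactOperator_kernelOperator _

end KernelOperator

/-! ### Compact skew-adjoint operators -/

section SkewAdjoint

open scoped InnerProductSpace ComplexConjugate

variable {E : Type*} [NormedAddCommGroup E] [InnerProductSpace ℂ E] {T : E →L[ℂ] E}

theorem conj_eq_neg_of_skew (hT : ∀ x y, ⟪T x, y⟫_ℂ = -⟪x, T y⟫_ℂ) {z : ℂ} {x : E}
    (hx : T x = z • x) (hx0 : x ≠ 0) : conj z = -z := by
  have h := hT x x
  rw [hx, inner_smul_left, inner_smul_right, ← neg_mul] at h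
  exact mul_right_cancel₀ (inner_self_ne_zero.2 hx0) h

theorem inner_eq_zero_of_skew (hT : ∀ x y, ⟪T x, y⟫_ℂ = -⟪x, T y⟫_ℂ) {z w : ℂ} {x y : E}
    (hx : T x = z • x) (hy : T y = w • y) (hzw : z ≠ w) : ⟪x, y⟫_ℂ = 0 := by
  by_cases hx0 : x = 0
  · rw [hx0, inner_zero_left]
  have h := hT x y
  rw [hx, hy, inner_smul_left, inner_smul_right, conj_eq_neg_of_skew hT hx hx0] at h
  have : (w - z) * ⟪x, y⟫_ℂ = 0 := by linear_combination h
  exact (mul_eq_zero.1 this).resolve_left (sub_ne_zero.2 hzw.symm)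

/-- `-i T` is compact and self-adjoint, so by the spectral theorem the eigenvectors of `T` span a
dense subspace. -/
theorem eq_zero_of_eigenvectors [CompleteSpace E] (hT : ∀ x y, ⟪T x, y⟫_ℂ = -⟪x, T y⟫_ℂ)
    (hc : IsCompactOperator T) {D : E →L[ℂ] E} (hD : ∀ (z : ℂ) (x : E), T x = z • x → D x = 0) : D = 0 := by
  set A : E →L[ℂ] E := (-Complex.I) • T with hA
  have hAc : IsCompactOperator A := hc.smul (-Complex.I)
  have hAs : (A : E →ₗ[ℂ] E).IsSymmetric := fun x y => by
    change ⟪(-Complex.I) • T x, y⟫_ℂ = ⟪x, (-Complex.I) • T y⟫_ℂ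
    rw [inner_smul_left, inner_smul_right, hT]
    simp
  have h1 := ContinuousLinearMap.orthogonalComplement_iSup_eigenspaces_eq_bot hAc hAs
  rw [← Submodule.topologicalClosure_eq_top_iff] at h1
  have h2 : (⨆ μ, Module.End.eigenspace (A : Module.End ℂ E) μ) ≤ LinearMap.ker (D : E →ₗ[ℂ] E) := by
    refine iSup_le fun μ x hx => ?_
    rw [Module.End.mem_eigenspace_iff] at hx
    refine hD (Complex.I * μ) x ?_
    have hx' : (-Complex.I) • T x = μ • x := hx
    rw [mul_smul, ← hx', smul_smul]
    simp
  have h3 := Submodule.topologicalClosure_minimal _ h2 D.isClosed_ker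
  rw [h1] at h3
  ext x
  exact h3 (Submodule.mem_top (x := x))

variable [CompleteSpace E] {ι : Type*} {lam : ι → ℝ}

/-- Compactness makes the eigenspaces for nonzero eigenvalues finite-dimensional. The counting
condition then matches the indices with `lam q = s` to an orthonormal basis of the eigenspace for `i
s`, and different eigenspaces are orthogonal by skewness. -/
theorem exists_orthonormal_eigenvectors (hT : ∀ x y, ⟪T x, y⟫_ℂ = -⟪x, T y⟫_ℂ)
    (hc : IsCompactOperator T)
    (hlam : EnumeratesUpperEigenvalues (T : Module.End ℂ E) lam) :
    ∃ e : ι → E, Orthonormal ℂ e ∧ (∀ q, T (e q) = (Complex.I * lam q) • e q) ∧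
      ∀ s : ℝ, 0 < s → ∀ x, T x = (Complex.I * s) • x → x ∈ Submodule.span ℂ (Set.range e) := by
  have hfin : ∀ s : ℝ, 0 < s →
      FiniteDimensional ℂ (Module.End.eigenspace (T : Module.End ℂ E) (Complex.I * s)) :=
    fun s hs => ContinuousLinearMap.finite_dimensional_eigenspace hc _
      (mul_ne_zero Complex.I_ne_zero (Complex.ofReal_ne_zero.2 hs.ne'))
  have hbasis : ∀ s : ℝ, 0 < s → ∃ b : {q // lam q = s} → E, Orthonormal ℂ b ∧
      (∀ q, T (b q) = (Complex.I * s) • b q) ∧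
      ∀ x, T x = (Complex.I * s) • x → x ∈ Submodule.span ℂ (Set.range b) := by
    intro s hs
    have := hfin s hs
    have hcard := hlam.2 (Complex.I * s) (by simpa using hs)
    have hset : {q | Complex.I * (lam q : ℂ) = Complex.I * s} = {q | lam q = s} := by
      ext q; simp
    rw [hset, Cardinal.toENat_eq_natCast.mpr (Module.finrank_eq_rank _ _).symm] at hcard
    have : Finite {q // lam q = s} := Set.finite_of_encard_eq_coe hcard
    have hn : Nat.card {q // lam q = s} =
        Module.finrank ℂ (Module.End.eigenspace (T : Module.End ℂ E) (Complex.I * s)) := by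
      have h1 : {q | lam q = s}.ncard = _ := congrArg ENat.toNat hcard
      exact h1
    have σ := Finite.equivFinOfCardEq hn
    have b := stdOrthonormalBasis ℂ (Module.End.eigenspace (T : Module.End ℂ E) (Complex.I * s))
    refine ⟨fun q => (b (σ q) : E), ?_, fun q => ?_, fun x hx => ?_⟩
    · exact (b.orthonormal.comp σ σ.injective).comp_linearIsometry (Submodule.subtypeₗᵢ _)
    · exact Module.End.mem_eigenspace_iff.1 (b (σ q)).2
    · have hx' : x ∈ Module.End.eigenspace (T : Module.End ℂ E) (Complex.I * s) :=
        Module.End.mem_eigenspace_iff.2 hx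
      have h1 := congrArg Subtype.val (b.sum_repr ⟨x, hx'⟩)
      rw [Submodule.coe_sum] at h1
      change _ = x at h1
      rw [← h1]
      refine Submodule.sum_mem _ fun i _ => ?_
      refine Submodule.smul_mem _ _ (Submodule.subset_span ⟨σ.symm i, ?_⟩)
      simp
  choose! B hB using hbasis
  -- The basis `B s` is indexed by a type that depends on `s`; this moves a vector along `lam q =
  -- s`.
  have hBe : ∀ (s : ℝ) (q : {q // lam q = s}), B (lam q) ⟨q, rfl⟩ = B s q := by
    rintro _ ⟨q, rfl⟩; rfl
  have heig : ∀ q, T (B (lam q) ⟨q, rfl⟩) = (Complex.I * lam q) • B (lam q) ⟨q, rfl⟩ := fun q =>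
    (hB _ (hlam.1 q)).2.1 _
  refine ⟨fun q => B (lam q) ⟨q, rfl⟩, ⟨fun q => (hB _ (hlam.1 q)).1.1 _, fun q r hqr => ?_⟩, heig,
    fun s hs x hx => ?_⟩
  · by_cases h : lam q = lam r
    · have h1 := hBe (lam r) ⟨q, h⟩
      simp only at h1 ⊢
      rw [h1]
      exact (hB _ (hlam.1 r)).1.2 fun h2 => hqr (congrArg Subtype.val h2)
    · exact inner_eq_zero_of_skew hT (heig q) (heig r) (by simpa using h)
  · refine Submodule.span_mono ?_ ((hB s hs).2.2 x hx)
    rintro _ ⟨q, rfl⟩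
    exact ⟨q, hBe s q⟩

theorem EnumeratesUpperEigenvalues.comp_equiv {κ : Type*} {M : Type*} [AddCommGroup M] [Module ℂ M]
    {A : Module.End ℂ M} (h : EnumeratesUpperEigenvalues A lam) (σ : κ ≃ ι) :
    EnumeratesUpperEigenvalues A fun k => lam (σ k) :=
  ⟨fun k => h.1 _, fun z hz => by
    rw [← h.2 z hz, ← Set.encard_preimage_of_bijective σ.bijective]
    rfl⟩

/-- All eigenvalues are purely imaginary, so it suffices to take, for each `s > 0`, as many indices
as the eigenspace for `i s` has dimensions. That this index type is countable is a separate matter.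
-/
theorem enumeratesUpperEigenvalues_sigma (hT : ∀ x y, ⟪T x, y⟫_ℂ = -⟪x, T y⟫_ℂ)
    (hc : IsCompactOperator T) :
    EnumeratesUpperEigenvalues (T : Module.End ℂ E)
      fun j : Σ s : {s : ℝ // 0 < s}, Fin (Module.finrank ℂ
        (Module.End.eigenspace (T : Module.End ℂ E) (Complex.I * s.1))) => (j.1.1 : ℝ) := by
  refine ⟨fun j => j.1.2, fun z hz => ?_⟩
  by_cases hre : z.re = 0
  · obtain ⟨s, hs, rfl⟩ : ∃ s : ℝ, 0 < s ∧ z = Complex.I * s :=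
      ⟨z.im, hz, by apply Complex.ext <;> simp [hre]⟩
    have : FiniteDimensional ℂ (Module.End.eigenspace (T : Module.End ℂ E) (Complex.I * s)) :=
      ContinuousLinearMap.finite_dimensional_eigenspace hc _
        (mul_ne_zero Complex.I_ne_zero (Complex.ofReal_ne_zero.2 hs.ne'))
    rw [Cardinal.toENat_eq_natCast.mpr (Module.finrank_eq_rank _ _).symm]
    have hr : {j : Σ s : {s : ℝ // 0 < s}, Fin (Module.finrank ℂ
        (Module.End.eigenspace (T : Module.End ℂ E) (Complex.I * s.1))) |
        Complex.I * ((j.1.1 : ℝ) : ℂ) = Complex.I * s} = Set.range (Sigma.mk ⟨s, hs⟩) := by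
      ext ⟨⟨r, hr⟩, i⟩
      simp only [Set.mem_ofPred_eq, mul_eq_mul_left_iff, Complex.ofReal_inj, Complex.I_ne_zero,
        or_false, Set.mem_range]
      constructor
      · rintro rfl; exact ⟨i, rfl⟩
      · rintro ⟨i', h⟩
        exact (congrArg (fun j => (j.1.1 : ℝ)) h).symm
    rw [hr, ← Set.image_univ, (sigma_mk_injective).encard_image, Set.encard_univ]
    simp
  · have h1 : Module.End.eigenspace (T : Module.End ℂ E) z = ⊥ := by
      rw [Submodule.eq_bot_iff]
      intro x hx
      by_contra hx0
      have h := conj_eq_neg_of_skew hT (Module.End.mem_eigenspace_iff.1 hx) hx0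
      have := congrArg Complex.re h
      simp only [Complex.conj_re, Complex.neg_re] at this
      exact hre (by linarith)
    rw [h1, rank_bot, map_zero, Set.encard_eq_zero, Set.eq_empty_iff_forall_notMem]
    intro j hj
    exact hre (by rw [← (hj : _ = z)]; simp)

theorem exists_equiv_subtype_lt (J : Type*) [Countable J] :
    ∃ Q : ℕ∞, Nonempty ({q : ℕ // (q : ℕ∞) < Q} ≃ J) := by
  rcases finite_or_infinite J with h | h
  · refine ⟨(Nat.card J : ℕ∞), ⟨Equiv.trans ?_ (Finite.equivFin J).symm⟩⟩
    exact (Equiv.subtypeEquivRight fun q => by exact_mod_cast Iff.rfl).trans Fin.equivSubtype.symm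
  · obtain ⟨_⟩ := nonempty_denumerable J
    exact ⟨⊤, ⟨(Equiv.subtypeUnivEquiv fun q => ENat.natCast_lt_top q).trans (Denumerable.eqv J).symm⟩⟩

end SkewAdjoint

/-! ### The spectral expansion of an antisymmetric kernel -/

section Expansion

open scoped InnerProductSpace ComplexConjugate

theorem summable_smul_of_orthonormal {H ι : Type*} [NormedAddCommGroup H] [InnerProductSpace ℂ H]
    [CompleteSpace H] {u : ι → H} (hu : Orthonormal ℂ u) {c : ι → ℂ}
    (hc : Summable fun i => ‖c i‖ ^ 2) : Summable fun i => c i • u i :=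
  (hu.orthogonalFamily.summable_iff_norm_sq_summable c).2 hc

variable {S : Type*} [MeasurableSpace S] {ν : Measure S}

theorem orthonormal_star {ι : Type*} {e : ι → Lp ℂ 2 ν} (he : Orthonormal ℂ e) :
    Orthonormal ℂ fun q => star (e q) := by
  classical
  rw [orthonormal_iff_ite] at he ⊢
  intro q r
  rw [inner_star_star, he]
  split_ifs <;> simp

variable [IsProbabilityMeasure ν]

theorem orthonormal_tensor {ι : Type*} {e : ι → Lp ℂ 2 ν} (he : Orthonormal ℂ e) :
    Orthonormal ℂ fun q => tensor (e q) (e q) := by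
  classical
  rw [orthonormal_iff_ite] at he ⊢
  intro q r
  rw [inner_tensor_tensor, he, he]
  by_cases h : q = r
  · simp [h]
  · simp [h, Ne.symm h]

variable {f : S → S → ℝ} (hf : MemLp (Function.uncurry f) 2 (ν.prod ν)) {ι : Type*} {lam : ι → ℝ}
  {e : ι → Lp ℂ 2 ν}

theorem realKernelOperator_star_eigenvector
    (heig : ∀ q, realKernelOperator ν f hf (e q) = (Complex.I * lam q) • e q) (q : ι) :
    realKernelOperator ν f hf (star (e q)) = (-(Complex.I * lam q)) • star (e q) := by
  rw [realKernelOperator_star, heig, Lp_star_smul]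
  simp

/-- The coefficient of the kernel along `tensor (e q) (e q)` is `⟪e q, T (e q)⟫ = i lam q`, and
these tensors are orthonormal, so Bessel's inequality applies. -/
theorem summable_norm_sq_of_eigenvectors (he : Orthonormal ℂ e)
    (heig : ∀ q, realKernelOperator ν f hf (e q) = (Complex.I * lam q) • e q) :
    Summable fun q => ‖Complex.I * (lam q : ℂ)‖ ^ 2 := by
  refine ((orthonormal_tensor he).inner_products_summable
    (x := (memLp_uncurry_ofReal hf).toLp (Function.uncurry fun x y => (f x y : ℂ)))).congr fun q => ?_
  rw [← inner_integralOperator (memLp_uncurry_ofReal hf), ← realKernelOperator_eq hf, heig, inner_smul_right,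
    inner_self_eq_norm_sq_to_K, he.1]
  simp

/-- Square summability gives convergence to some `G`. The operator with kernel `F - G` kills every
eigenvector of `T`, hence is zero, and a kernel whose operator is zero is itself zero. -/
theorem hasSum_kernel (hf_anti : ∀ᵐ p ∂(ν.prod ν), f p.1 p.2 = -f p.2 p.1)
    (hlam : ∀ q, 0 < lam q) (he : Orthonormal ℂ e)
    (heig : ∀ q, realKernelOperator ν f hf (e q) = (Complex.I * lam q) • e q)
    (hspan : ∀ s : ℝ, 0 < s → ∀ x, realKernelOperator ν f hf x = (Complex.I * s) • x →
      x ∈ Submodule.span ℂ (Set.range e)) :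
    HasSum (fun q => (Complex.I * lam q) •
        (tensor (e q) (e q) - tensor (star (e q)) (star (e q))))
      ((memLp_uncurry_ofReal hf).toLp _) := by
  classical
  set F := (memLp_uncurry_ofReal hf).toLp _ with hF
  set T := realKernelOperator ν f hf with hT
  have hskew : ∀ x y, ⟪T x, y⟫_ℂ = -⟪x, T y⟫_ℂ := inner_realKernelOperator_left hf hf_anti
  have hTF : kernelOperatorL ν F = T := (integralOperator_eq_kernelOperator _).symm
  have hlam2 := summable_norm_sq_of_eigenvectors hf he heig
  have hstar := realKernelOperator_star_eigenvector hf heig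
  have hsum : Summable fun q => (Complex.I * lam q) •
      (tensor (e q) (e q) - tensor (star (e q)) (star (e q))) := by
    simp_rw [smul_sub]
    exact (summable_smul_of_orthonormal (orthonormal_tensor he) hlam2).sub
      (summable_smul_of_orthonormal (orthonormal_tensor (orthonormal_star he)) hlam2)
  obtain ⟨G, hG⟩ := hsum
  suffices h : F = G by rw [h]; exact hG
  have hGx : ∀ x, HasSum (fun q => (Complex.I * lam q) •
      (⟪e q, x⟫_ℂ • e q - ⟪star (e q), x⟫_ℂ • star (e q))) (kernelOperatorL ν G x) := by
    intro x
    have h1 := hG.mapL ((ContinuousLinearMap.apply ℂ (Lp ℂ 2 ν) x).comp (kernelOperatorL ν))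
    have h2 : ∀ q, ((ContinuousLinearMap.apply ℂ (Lp ℂ 2 ν) x).comp (kernelOperatorL ν))
        ((Complex.I * lam q) • (tensor (e q) (e q) - tensor (star (e q)) (star (e q)))) =
        (Complex.I * lam q) • (⟪e q, x⟫_ℂ • e q - ⟪star (e q), x⟫_ℂ • star (e q)) := fun q => by
      rw [map_smul, map_sub, ← kernelOperator_tensor, ← kernelOperator_tensor]
      rfl
    simp_rw [h2] at h1
    exact h1
  set D := kernelOperatorL ν (F - G) with hD
  have hDx : ∀ x, D x = T x - kernelOperatorL ν G x := fun x => by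
    rw [hD, map_sub, hTF]; rfl
  have hpm : ∀ q r, -(Complex.I * (lam q : ℂ)) ≠ Complex.I * lam r := by
    intro q r h
    have := congrArg Complex.im h
    simp at this
    linarith [hlam q, hlam r]
  have hee := orthonormal_iff_ite.1 he
  have hss := orthonormal_iff_ite.1 (orthonormal_star he)
  have hse : ∀ q r, ⟪star (e q), e r⟫_ℂ = 0 := fun q r =>
    inner_eq_zero_of_skew hskew (hstar q) (heig r) (hpm q r)
  have hes : ∀ q r, ⟪e q, star (e r)⟫_ℂ = 0 := fun q r =>
    inner_eq_zero_of_skew hskew (heig q) (hstar r) (hpm r q).symm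
  have hDe : ∀ r, D (e r) = 0 := by
    intro r
    have h1 := hGx (e r)
    simp only [hee, hse] at h1
    have h2 : HasSum (fun q => (Complex.I * lam q) • ((if q = r then (1 : ℂ) else 0) • e q -
        (0 : ℂ) • star (e q))) ((Complex.I * lam r) • e r) := by
      convert hasSum_single r fun q hq => ?_ using 1
      · simp
      · simp [hq]
    rw [hDx, h1.unique h2, heig, sub_self]
  have hDs : ∀ r, D (star (e r)) = 0 := by
    intro r
    have h1 := hGx (star (e r))
    simp only [hss, hes] at h1
    have h2 : HasSum (fun q => (Complex.I * lam q) • ((0 : ℂ) • e q -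
        (if q = r then (1 : ℂ) else 0) • star (e q))) ((-(Complex.I * lam r)) • star (e r)) := by
      convert hasSum_single r fun q hq => ?_ using 1
      · simp
      · simp [hq]
    rw [hDx, h1.unique h2, hstar, sub_self]
  have hD0 : D = 0 := by
    refine eq_zero_of_eigenvectors hskew (isCompactOperator_realKernelOperator hf) fun z x hx => ?_
    by_cases hx0 : x = 0
    · rw [hx0, map_zero]
    have hz := conj_eq_neg_of_skew hskew hx hx0
    have hre : z.re = 0 := by
      have := congrArg Complex.re hz
      simp only [Complex.conj_re, Complex.neg_re] at this
      linarith
    have hzi : z = Complex.I * z.im := by apply Complex.ext <;> simp [hre]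
    rcases lt_trichotomy z.im 0 with h | h | h
    -- An eigenvector for the lower half-plane is the conjugate of one for the upper half-plane,
    -- where `hspan` is available.
    · have h1 : T (star x) = (Complex.I * (-z.im : ℝ)) • star x := by
        rw [hT, realKernelOperator_star, ← hT, hx, Lp_star_smul, hz]
        congr 1
        rw [hzi]; simp
      have h2 := hspan _ (neg_pos.2 h) _ h1
      have h3 : ∀ y ∈ Submodule.span ℂ (Set.range e), D (star y) = 0 := by
        intro y hy
        induction hy using Submodule.span_induction with
        | mem y hy => obtain ⟨q, rfl⟩ := hy; exact hDs q
        | zero =>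
          have : star (0 : Lp ℂ 2 ν) = 0 := by
            have := Lp_star_smul (0 : ℂ) (0 : Lp ℂ 2 ν)
            simpa using this
          rw [this, map_zero]
        | add y y' _ _ h h' => rw [Lp_star_add, map_add, h, h', add_zero]
        | smul c y _ h => rw [Lp_star_smul, map_smul, h, smul_zero]
      have := h3 _ h2
      rwa [star_star] at this
    -- The kernel of `T` is orthogonal to all `e q` and their conjugates, so every term of the
    -- series vanishes on it.
    · have hz0 : z = 0 := by rw [hzi, h]; simp
      have hx' : T x = (0 : ℂ) • x := by rw [hx, hz0]
      have hnz : ∀ q, Complex.I * (lam q : ℂ) ≠ 0 := fun q =>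
        mul_ne_zero Complex.I_ne_zero (Complex.ofReal_ne_zero.2 (hlam q).ne')
      have h1 := hGx x
      have h2 : ∀ q, ⟪e q, x⟫_ℂ = 0 := fun q => inner_eq_zero_of_skew hskew (heig q) hx' (hnz q)
      have h3 : ∀ q, ⟪star (e q), x⟫_ℂ = 0 := fun q =>
        inner_eq_zero_of_skew hskew (hstar q) hx' (neg_ne_zero.2 (hnz q))
      simp only [h2, h3, zero_smul, sub_zero, smul_zero] at h1
      rw [hDx, h1.unique hasSum_zero, hx', zero_smul, sub_zero]
    · have h2 := hspan _ h x (by rw [hx, ← hzi])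
      have h3 : Submodule.span ℂ (Set.range e) ≤ LinearMap.ker (D : Lp ℂ 2 ν →ₗ[ℂ] Lp ℂ 2 ν) := by
        rw [Submodule.span_le]
        rintro _ ⟨q, rfl⟩
        exact hDe q
      exact h3 h2
  have h0 : F - G = 0 := eq_zero_of_inner_tensor fun ψ φ => by
    rw [← inner_kernelOperator, ← kernelOperatorL_apply, ← hD, hD0]
    simp
  exact sub_eq_zero.1 h0

/-- The squares of the eigenvalues are summable and none is zero, so the index type of all of them
is countable. -/
theorem exists_enumeration (hf_anti : ∀ᵐ p ∂(ν.prod ν), f p.1 p.2 = -f p.2 p.1) :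
    ∃ (Q : ℕ∞) (lam : {q : ℕ // (q : ℕ∞) < Q} → ℝ),
      EnumeratesUpperEigenvalues (realKernelOperator ν f hf : Module.End ℂ (Lp ℂ 2 ν)) lam := by
  have hskew := inner_realKernelOperator_left hf hf_anti
  have hc := isCompactOperator_realKernelOperator hf
  have h := enumeratesUpperEigenvalues_sigma hskew hc
  obtain ⟨e, he, heig, -⟩ := exists_orthonormal_eigenvectors hskew hc h
  have hcount := (summable_norm_sq_of_eigenvectors hf he heig).countable_support
  have hsupp : (Function.support fun j : Σ s : {s : ℝ // 0 < s}, Fin (Module.finrank ℂ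
      (Module.End.eigenspace (realKernelOperator ν f hf : Module.End ℂ (Lp ℂ 2 ν))
        (Complex.I * s.1))) => ‖Complex.I * ((j.1.1 : ℝ) : ℂ)‖ ^ 2) = Set.univ := by
    ext j
    simp [j.1.2.ne']
  rw [hsupp, Set.countable_univ_iff] at hcount
  obtain ⟨Q, ⟨σ⟩⟩ := exists_equiv_subtype_lt (Σ s : {s : ℝ // 0 < s}, Fin (Module.finrank ℂ
      (Module.End.eigenspace (realKernelOperator ν f hf : Module.End ℂ (Lp ℂ 2 ν))
        (Complex.I * s.1))))
  exact ⟨Q, _, h.comp_equiv σ⟩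

end Expansion

/-! ### The spectral expansion in real form -/

section RealForm

open scoped InnerProductSpace ComplexConjugate

variable {S : Type*} [MeasurableSpace S] {ν : Measure S}

theorem integrable_re_mul_re (φ ψ : Lp ℂ 2 ν) : Integrable (fun x => (φ x).re * (ψ x).re) ν :=
  MemLp.integrable_mul (Lp.memLp φ).re (Lp.memLp ψ).re

theorem integrable_re_mul_im (φ ψ : Lp ℂ 2 ν) : Integrable (fun x => (φ x).re * (ψ x).im) ν :=
  MemLp.integrable_mul (Lp.memLp φ).re (Lp.memLp ψ).im

theorem integrable_im_mul_im (φ ψ : Lp ℂ 2 ν) : Integrable (fun x => (φ x).im * (ψ x).im) ν :=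
  MemLp.integrable_mul (Lp.memLp φ).im (Lp.memLp ψ).im

theorem inner_eq_integrals (φ ψ : Lp ℂ 2 ν) :
    ⟪φ, ψ⟫_ℂ = ((∫ x, (φ x).re * (ψ x).re ∂ν + ∫ x, (φ x).im * (ψ x).im ∂ν : ℝ) : ℂ) +
      ((∫ x, (φ x).re * (ψ x).im ∂ν - ∫ x, (ψ x).re * (φ x).im ∂ν : ℝ) : ℂ) * Complex.I := by
  rw [← integral_add (integrable_re_mul_re φ ψ) (integrable_im_mul_im φ ψ),
    ← integral_sub (integrable_re_mul_im φ ψ) (integrable_re_mul_im ψ φ), L2.inner_def]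
  have hI := L2.integrable_inner (𝕜 := ℂ) φ ψ
  have h1 := Complex.reCLM.integral_comp_comm hI
  have h2 := Complex.imCLM.integral_comp_comm hI
  simp only [Complex.reCLM_apply, Complex.imCLM_apply] at h1 h2
  rw [← Complex.re_add_im (∫ x, ⟪φ x, ψ x⟫_ℂ ∂ν), ← h1, ← h2]
  congr 3
  · funext x
    simp [RCLike.inner_apply]; ring
  · congr 1
    funext x
    simp [RCLike.inner_apply]; ring

theorem inner_star_left_eq_integrals (φ ψ : Lp ℂ 2 ν) :
    ⟪star φ, ψ⟫_ℂ = ((∫ x, (φ x).re * (ψ x).re ∂ν - ∫ x, (φ x).im * (ψ x).im ∂ν : ℝ) : ℂ) +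
      ((∫ x, (φ x).re * (ψ x).im ∂ν + ∫ x, (ψ x).re * (φ x).im ∂ν : ℝ) : ℂ) * Complex.I := by
  have hre : ∀ᵐ x ∂ν, (star φ : Lp ℂ 2 ν) x = conj (φ x) := by
    filter_upwards [Lp.coeFn_star φ] with x hx
    rw [hx]; rfl
  have h1 : ∫ x, ((star φ : Lp ℂ 2 ν) x).re * (ψ x).re ∂ν = ∫ x, (φ x).re * (ψ x).re ∂ν :=
    integral_congr_ae (by filter_upwards [hre] with x hx; simp [hx])
  have h2 : ∫ x, ((star φ : Lp ℂ 2 ν) x).im * (ψ x).im ∂ν = -∫ x, (φ x).im * (ψ x).im ∂ν := by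
    rw [← integral_neg]
    exact integral_congr_ae (by filter_upwards [hre] with x hx; simp [hx])
  have h3 : ∫ x, ((star φ : Lp ℂ 2 ν) x).re * (ψ x).im ∂ν = ∫ x, (φ x).re * (ψ x).im ∂ν :=
    integral_congr_ae (by filter_upwards [hre] with x hx; simp [hx])
  have h4 : ∫ x, (ψ x).re * ((star φ : Lp ℂ 2 ν) x).im ∂ν = -∫ x, (ψ x).re * (φ x).im ∂ν := by
    rw [← integral_neg]
    exact integral_congr_ae (by filter_upwards [hre] with x hx; simp [hx])
  rw [inner_eq_integrals, h1, h2, h3, h4, sub_neg_eq_add, ← sub_eq_add_neg]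

/-- The real and imaginary parts of a family in `L²`, multiplied by `√2`. -/
def realParts {ι : Type*} (e : ι → Lp ℂ 2 ν) : ι ⊕ ι → S → ℝ
  | .inl q, x => √2 * (e q x).re
  | .inr q, x => √2 * (e q x).im

/-- The inner products of `e r` with `e q` and with its conjugate contain sums and differences of
the same integrals of real and imaginary parts. Together they determine each integral, and the
factor `√2` corrects the value `1 / 2` of the squared norms. -/
theorem isCentredOrthonormal_realParts [IsFiniteMeasure ν] {ι : Type*} {e : ι → Lp ℂ 2 ν} (he : Orthonormal ℂ e)
    (hse : ∀ q r, ⟪star (e q), e r⟫_ℂ = 0) (hmean : ∀ q, ∫ x, e q x ∂ν = 0) :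
    IsCentredOrthonormal ν (realParts e) := by
  classical
  have hs2 : √2 * √2 = 2 := Real.mul_self_sqrt zero_le_two
  have hem : ∀ q, Measurable (e q) := fun q => (Lp.stronglyMeasurable (e q)).measurable
  have hint : ∀ q r, ∫ x, (e q x).re * (e r x).re ∂ν = (if q = r then 1 else 0) / 2 ∧
      ∫ x, (e q x).im * (e r x).im ∂ν = (if q = r then 1 else 0) / 2 ∧
      ∫ x, (e q x).re * (e r x).im ∂ν = 0 := by
    intro q r
    have h1 := orthonormal_iff_ite.1 he q r
    have h2 := hse q r
    rw [inner_eq_integrals] at h1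
    rw [inner_star_left_eq_integrals] at h2
    have a1 := congrArg Complex.re h1
    have a2 := congrArg Complex.im h1
    have b1 := congrArg Complex.re h2
    have b2 := congrArg Complex.im h2
    have c1 : (if q = r then (1 : ℂ) else 0).re = if q = r then 1 else 0 := by split_ifs <;> simp
    have c2 : (if q = r then (1 : ℂ) else 0).im = 0 := by split_ifs <;> simp
    rw [c1] at a1
    rw [c2] at a2
    simp only [Complex.add_re, Complex.ofReal_re, Complex.mul_re, Complex.I_re, Complex.ofReal_im,
      Complex.I_im, Complex.add_im, Complex.mul_im, Complex.zero_re, Complex.zero_im] at a1 a2 b1 b2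
    refine ⟨?_, ?_, ?_⟩ <;> linarith
  have hscale : ∀ (u w : S → ℝ), ∫ x, √2 * u x * (√2 * w x) ∂ν = 2 * ∫ x, u x * w x ∂ν := by
    intro u w
    rw [← integral_const_mul]
    congr 1; funext x
    rw [mul_mul_mul_comm, hs2]
  refine ⟨?_, ?_, ?_, ?_, ?_⟩
  · rintro (q | q)
    · exact (Complex.measurable_re.comp (hem q)).const_mul _
    · exact (Complex.measurable_im.comp (hem q)).const_mul _
  · rintro (q | q)
    · exact (Lp.memLp (e q)).re.const_mul _
    · exact (Lp.memLp (e q)).im.const_mul _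
  · have hI : ∀ q, Integrable (e q) ν := fun q => (Lp.memLp (e q)).integrable (by norm_num)
    rintro (q | q)
    · have h := Complex.reCLM.integral_comp_comm (hI q)
      simp only [Complex.reCLM_apply, hmean, Complex.zero_re] at h
      simp only [realParts]
      rw [integral_const_mul, h, mul_zero]
    · have h := Complex.imCLM.integral_comp_comm (hI q)
      simp only [Complex.imCLM_apply, hmean, Complex.zero_im] at h
      simp only [realParts]
      rw [integral_const_mul, h, mul_zero]
  · rintro (q | q)
    · simp only [realParts, sq]
      rw [hscale, (hint q q).1]; simp
    · simp only [realParts, sq]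
      rw [hscale, (hint q q).2.1]; simp
  · rintro (q | q) (r | r) hqr
    · simp only [realParts]
      rw [hscale, (hint q r).1, if_neg fun h => hqr (by rw [h])]; simp
    · simp only [realParts]
      rw [hscale, (hint q r).2.2]; simp
    · simp only [realParts]
      rw [hscale]
      simp_rw [mul_comm (e q _).im]
      rw [(hint r q).2.2]; simp
    · simp only [realParts]
      rw [hscale, (hint q r).2.1, if_neg fun h => hqr (by rw [h])]; simp

theorem IsCentredOrthonormal.comp_injective {R R' : Type*} {v : R → S → ℝ}
    (hv : IsCentredOrthonormal ν v) {σ : R' → R} (hσ : Function.Injective σ) :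
    IsCentredOrthonormal ν fun r => v (σ r) :=
  ⟨fun _ => hv.measurable _, fun _ => hv.memLp _, fun _ => hv.mean _, fun _ => hv.norm _,
    fun _ _ h => hv.orth _ _ fun h' => h (hσ h')⟩

variable [IsProbabilityMeasure ν]

/-- Degeneracy says that `T` maps the constant function 1 to zero; skewness then gives `z ⟪1, φ⟫ =
0`. -/
theorem integral_eigenvector_eq_zero {f : S → S → ℝ} (hf : MemLp (Function.uncurry f) 2 (ν.prod ν))
    (hf_anti : ∀ᵐ p ∂(ν.prod ν), f p.1 p.2 = -f p.2 p.1) (hf0 : IsDegenerate ν f) {z : ℂ}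
    (hz : z ≠ 0) {φ : Lp ℂ 2 ν} (hφ : realKernelOperator ν f hf φ = z • φ) :
    ∫ x, φ x ∂ν = 0 := by
  set u : Lp ℂ 2 ν := indicatorConstLp 2 MeasurableSet.univ (measure_ne_top ν Set.univ) (1 : ℂ)
  have hu : ∀ ψ : Lp ℂ 2 ν, ⟪u, ψ⟫_ℂ = ∫ x, ψ x ∂ν := fun ψ => by
    rw [L2.inner_indicatorConstLp_one, Measure.restrict_univ]
  have hTu : realKernelOperator ν f hf u = 0 := by
    rw [Lp.eq_zero_iff_ae_eq_zero]
    filter_upwards [integralOperator_apply _ (memLp_uncurry_ofReal hf) u, hf0.1] with x hx h0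
    rw [realKernelOperator_eq, hx]
    have : ∫ y, (f x y : ℂ) * u y ∂ν = ∫ y, (f x y : ℂ) ∂ν := by
      refine integral_congr_ae ?_
      filter_upwards [indicatorConstLp_coeFn (p := 2) (hs := MeasurableSet.univ)
        (hμs := measure_ne_top ν Set.univ) (c := (1 : ℂ))] with y hy
      rw [hy]; simp
    rw [this, integral_complex_ofReal, h0]
    simp
  have h := inner_realKernelOperator_left hf hf_anti u φ
  rw [hTu, inner_zero_left, hφ, inner_smul_right, hu, eq_comm, neg_eq_zero] at h
  exact (mul_eq_zero.1 h).resolve_left hz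

/-- A conjugate pair of eigenvectors contributes `i lam (e(x) conj e(y) - conj e(x) e(y))`, which
equals `2 lam (Re e(x) Im e(y) - Im e(x) Re e(y))`. The two factors `√2` of `realParts` absorb the
2. -/
theorem exists_pairKernel_expansion {f : S → S → ℝ}
    (hf : MemLp (Function.uncurry f) 2 (ν.prod ν))
    (hf_anti : ∀ᵐ p ∂(ν.prod ν), f p.1 p.2 = -f p.2 p.1) (hf0 : IsDegenerate ν f) {ι : Type*}
    {lam : ι → ℝ} (hlam : EnumeratesUpperEigenvalues
      (realKernelOperator ν f hf : Module.End ℂ (Lp ℂ 2 ν)) lam) :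
    (Summable fun q => lam q ^ 2) ∧ ∃ v : ι ⊕ ι → S → ℝ, IsCentredOrthonormal ν v ∧
      Tendsto (fun s : Finset ι => lpNorm (Function.uncurry f - Function.uncurry
        (pairKernel (fun q : s => lam q) fun r => v (r.map Subtype.val Subtype.val))) 2 (ν.prod ν))
        atTop (𝓝 0) := by
  have hskew := inner_realKernelOperator_left hf hf_anti
  have hc := isCompactOperator_realKernelOperator hf
  obtain ⟨e, he, heig, hspan⟩ := exists_orthonormal_eigenvectors hskew hc hlam
  have hstar := realKernelOperator_star_eigenvector hf heig
  have hse : ∀ q r, ⟪star (e q), e r⟫_ℂ = 0 := fun q r => by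
    refine inner_eq_zero_of_skew hskew (hstar q) (heig r) fun h => ?_
    have := congrArg Complex.im h
    simp at this
    linarith [hlam.1 q, hlam.1 r]
  have hmean : ∀ q, ∫ x, e q x ∂ν = 0 := fun q =>
    integral_eigenvector_eq_zero hf hf_anti hf0
      (mul_ne_zero Complex.I_ne_zero (Complex.ofReal_ne_zero.2 (hlam.1 q).ne')) (heig q)
  have hv := isCentredOrthonormal_realParts he hse hmean
  refine ⟨(summable_norm_sq_of_eigenvectors hf he heig).congr fun q => by simp, realParts e, hv, ?_⟩
  have hsum := hasSum_kernel hf hf_anti hlam.1 he heig hspan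
  have hnorm := (tendsto_const_nhds (x := (memLp_uncurry_ofReal hf).toLp _)).sub hsum |>.norm
  rw [sub_self, norm_zero] at hnorm
  refine hnorm.congr fun s => ?_
  set K := pairKernel (fun q : s => lam q) fun r => realParts e (r.map Subtype.val Subtype.val)
    with hK
  have hKL : MemLp (Function.uncurry K) 2 (ν.prod ν) := memLp_pairKernel _ fun r => hv.memLp _
  have hdL : MemLp (Function.uncurry f - Function.uncurry K) 2 (ν.prod ν) := hf.sub hKL
  have hterm : ∀ᵐ p ∂(ν.prod ν), ∀ q ∈ s, ((Complex.I * lam q) •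
      (tensor (e q) (e q) - tensor (star (e q)) (star (e q))) : Lp ℂ 2 (ν.prod ν)) p =
      ((lam q * (√2 * (e q p.1).re * (√2 * (e q p.2).im) -
        √2 * (e q p.1).im * (√2 * (e q p.2).re)) : ℝ) : ℂ) := by
    rw [Finset.eventually_all]
    intro q _
    have s1 := Measure.quasiMeasurePreserving_fst (μ := ν) (ν := ν) |>.ae (Lp.coeFn_star (e q))
    have s2 := Measure.quasiMeasurePreserving_snd (μ := ν) (ν := ν) |>.ae (Lp.coeFn_star (e q))
    filter_upwards [Lp.coeFn_smul (Complex.I * (lam q : ℂ))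
      (tensor (e q) (e q) - tensor (star (e q)) (star (e q))),
      Lp.coeFn_sub (tensor (e q) (e q)) (tensor (star (e q)) (star (e q))),
      coeFn_tensor (e q) (e q), coeFn_tensor (star (e q)) (star (e q)), s1, s2]
      with p h1 h2 h3 h4 h5 h6
    rw [h1, Pi.smul_apply, h2, Pi.sub_apply, h3, h4, h5, h6]
    have hs2 : √2 * √2 = 2 := Real.mul_self_sqrt zero_le_two
    have e1 : lam q * (√2 * (e q p.1).re * (√2 * (e q p.2).im) -
        √2 * (e q p.1).im * (√2 * (e q p.2).re)) =
        2 * lam q * ((e q p.1).re * (e q p.2).im - (e q p.1).im * (e q p.2).re) := by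
      linear_combination lam q * ((e q p.1).re * (e q p.2).im - (e q p.1).im * (e q p.2).re) * hs2
    rw [e1]
    apply Complex.ext
    · simp; ring
    · simp
  have hdC : MemLp (fun p => (((Function.uncurry f - Function.uncurry K) p : ℝ) : ℂ)) 2
      (ν.prod ν) := hdL.ofReal
  have heq : (memLp_uncurry_ofReal hf).toLp _ - ∑ q ∈ s, (Complex.I * (lam q : ℂ)) •
      (tensor (e q) (e q) - tensor (star (e q)) (star (e q))) = hdC.toLp _ := by
    refine Lp.ext ?_
    filter_upwards [Lp.coeFn_sub ((memLp_uncurry_ofReal hf).toLp _)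
      (∑ q ∈ s, (Complex.I * (lam q : ℂ)) •
        (tensor (e q) (e q) - tensor (star (e q)) (star (e q)))),
      (memLp_uncurry_ofReal hf).coeFn_toLp, hdC.coeFn_toLp, hterm,
      Lp.coeFn_finsetSum s fun q => (Complex.I * (lam q : ℂ)) •
        (tensor (e q) (e q) - tensor (star (e q)) (star (e q)))] with p h1 h2 h3 h4 h5
    rw [h1, Pi.sub_apply, h2, h5, Finset.sum_apply, Finset.sum_congr rfl h4]
    refine Eq.trans ?_ h3.symm
    have e1 : Function.uncurry K p = ∑ q ∈ s, lam q * (√2 * (e q p.1).re * (√2 * (e q p.2).im) -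
        √2 * (e q p.1).im * (√2 * (e q p.2).re)) := by
      rw [← Finset.sum_coe_sort]
      rfl
    rw [Pi.sub_apply, e1]
    simp [Function.uncurry]
  rw [heq, Lp.norm_toLp, ← toReal_eLpNorm hdL.1]
  congr 1
  exact eLpNorm_congr_norm_ae (ae_of_all _ fun p => Complex.norm_real _)

end RealForm

/-! ### Sums of independent stochastic areas -/

section StochasticArea

variable {Ω : Type*} [MeasurableSpace Ω] {P : Measure Ω}

theorem integral_exp_eq_charFun {A : Ω → ℝ} (hA : AEMeasurable A P) (t : ℝ) :
    ∫ ω, Complex.exp ((t * A ω : ℝ) * Complex.I) ∂P = charFun (P.map A) t := by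
  rw [charFun_apply_real, integral_map hA (Measurable.aestronglyMeasurable (by fun_prop))]
  simp

variable {ι : Type*} {lam : ι → ℝ} {η : ι → Ω → ℝ}

theorem integral_exp_sum (hη : ∀ q, IsStochasticArea (η q) P) (hind : iIndepFun η P) (s : Finset ι)
    (t : ℝ) : ∫ ω, Complex.exp ((t * ∑ q ∈ s, lam q * η q ω : ℝ) * Complex.I) ∂P =
      ((∏ q ∈ s, (Real.cosh (t * lam q))⁻¹ : ℝ) : ℂ) := by
  have hm : ∀ q, AEMeasurable (fun ω => lam q * η q ω) P := fun q => (hη q).1.const_mul _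
  have hind' : iIndepFun (fun q ω => lam q * η q ω) P :=
    hind.comp (fun q x => lam q * x) fun q => measurable_const_mul _
  rw [integral_exp_eq_charFun (Finset.aemeasurable_fun_sum s fun q _ => hm q),
    (hind'.restrict s).charFun_map_fun_finsetSum_eq_prod fun q _ => hm q]
  rw [Finset.prod_apply, Complex.ofReal_prod]
  refine Finset.prod_congr rfl fun q _ => ?_
  rw [charFun_map_mul_comp (hη q).1, (hη q).2, one_div, mul_comm]

variable [IsProbabilityMeasure P]

theorem one_sub_le_inv_cosh (t : ℝ) : 1 - t ^ 2 / 2 ≤ (Real.cosh t)⁻¹ := by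
  calc 1 - t ^ 2 / 2 ≤ Real.exp (-(t ^ 2 / 2)) := by linarith [Real.add_one_le_exp (-(t ^ 2 / 2))]
    _ = (Real.exp (t ^ 2 / 2))⁻¹ := Real.exp_neg _
    _ ≤ _ := inv_anti₀ (Real.cosh_pos _) (Real.cosh_le_exp_half_sq t)

theorem tendsto_sq_mul_one_sub_cos (x : ℝ) :
    Tendsto (fun n : ℕ => 2 * (n : ℝ) ^ 2 * (1 - Real.cos ((n : ℝ)⁻¹ * x))) atTop (𝓝 (x ^ 2)) := by
  have h1 : Tendsto (fun n : ℕ => (n : ℝ)⁻¹ * x / 2) atTop (𝓝 0) := by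
    simpa using ((tendsto_inv_atTop_nhds_zero_nat (𝕜 := ℝ)).mul_const x).div_const 2
  have h2 := ((Real.continuous_sinc.tendsto 0).comp h1).pow 2 |>.const_mul (x ^ 2)
  rw [Real.sinc_zero, one_pow, mul_one] at h2
  refine h2.congr' ?_
  filter_upwards [eventually_gt_atTop 0] with n hn
  have hn0 : (n : ℝ) ≠ 0 := by exact_mod_cast hn.ne'
  have hsin : ∀ y : ℝ, y * Real.sinc y = Real.sin y := by
    intro y
    by_cases hy : y = 0
    · simp [hy]
    · rw [Real.sinc_of_ne_zero hy]; field_simp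
  have hcos : Real.cos ((n : ℝ)⁻¹ * x) = 1 - 2 * Real.sin ((n : ℝ)⁻¹ * x / 2) ^ 2 := by
    have := Real.cos_two_mul ((n : ℝ)⁻¹ * x / 2)
    rw [mul_div_cancel₀ _ (two_ne_zero' ℝ)] at this
    rw [this, Real.cos_sq']
    ring
  rw [hcos, ← hsin]
  simp only [Function.comp_apply]
  field_simp
  ring

/-- The second moment is read off the characteristic function near zero. The functions `2 n² (1 -
cos (η / n))` tend to `η²`, their means `2 n² (1 - 1 / cosh (1 / n))` are at most 1 because `cosh t
≤ exp (t² / 2)`, and Fatou's lemma applies. -/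
theorem IsStochasticArea.memLp {η : Ω → ℝ} (h : IsStochasticArea η P) :
    MemLp η 2 P ∧ ∫ ω, η ω ^ 2 ∂P ≤ 1 := by
  have hm := h.1
  have hcos : ∀ t : ℝ, ∫ ω, Real.cos (t * η ω) ∂P = (Real.cosh t)⁻¹ := by
    intro t
    have h1 := h.2 t
    rw [← integral_exp_eq_charFun hm] at h1
    have hI : Integrable (fun ω => Complex.exp ((t * η ω : ℝ) * Complex.I)) P := by
      refine Integrable.of_bound ?_ 1 (ae_of_all _ fun ω => (Complex.norm_exp_ofReal_mul_I _).le)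
      exact (Complex.measurable_exp.comp_aemeasurable
        ((Complex.measurable_ofReal.comp_aemeasurable (hm.const_mul t)).mul_const _)).aestronglyMeasurable
    have h2 := Complex.reCLM.integral_comp_comm hI
    simp only [Complex.reCLM_apply, Complex.exp_ofReal_mul_I_re, h1, Complex.ofReal_re,
      one_div] at h2
    exact h2
  have hcosI : ∀ t : ℝ, Integrable (fun ω => Real.cos (t * η ω)) P := fun t =>
    Integrable.of_bound (Real.measurable_cos.comp_aemeasurable (hm.const_mul t)).aestronglyMeasurable
      1 (ae_of_all _ fun ω => Real.abs_cos_le_one _)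
  have hle : ∀ n : ℕ, ∫⁻ ω, ENNReal.ofReal (2 * (n : ℝ) ^ 2 *
      (1 - Real.cos ((n : ℝ)⁻¹ * η ω))) ∂P ≤ 1 := by
    intro n
    have hI : Integrable (fun ω => 2 * (n : ℝ) ^ 2 * (1 - Real.cos ((n : ℝ)⁻¹ * η ω))) P :=
      ((integrable_const 1).sub (hcosI _)).const_mul _
    rw [← ofReal_integral_eq_lintegral_ofReal hI
      (ae_of_all _ fun ω => mul_nonneg (by positivity) (sub_nonneg.2 (Real.cos_le_one _)))]
    rw [integral_const_mul, integral_sub (integrable_const _) (hcosI _), hcos]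
    refine ENNReal.ofReal_le_one.2 ?_
    have h1 := one_sub_le_inv_cosh (n : ℝ)⁻¹
    simp only [integral_const, probReal_univ, smul_eq_mul, mul_one]
    by_cases hn : (n : ℝ) = 0
    · rw [hn]; norm_num
    · calc 2 * (n : ℝ) ^ 2 * (1 - (Real.cosh (n : ℝ)⁻¹)⁻¹) ≤
            2 * (n : ℝ) ^ 2 * (((n : ℝ)⁻¹) ^ 2 / 2) :=
            mul_le_mul_of_nonneg_left (by linarith) (by positivity)
        _ = 1 := by field_simp
  have hfatou : ∫⁻ ω, ENNReal.ofReal (η ω ^ 2) ∂P ≤ 1 := by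
    calc ∫⁻ ω, ENNReal.ofReal (η ω ^ 2) ∂P = ∫⁻ ω, liminf (fun n : ℕ => ENNReal.ofReal
          (2 * (n : ℝ) ^ 2 * (1 - Real.cos ((n : ℝ)⁻¹ * η ω)))) atTop ∂P := by
          refine lintegral_congr fun ω => ?_
          exact ((ENNReal.tendsto_ofReal (tendsto_sq_mul_one_sub_cos (η ω))).liminf_eq).symm
      _ ≤ liminf (fun n : ℕ => ∫⁻ ω, ENNReal.ofReal
          (2 * (n : ℝ) ^ 2 * (1 - Real.cos ((n : ℝ)⁻¹ * η ω))) ∂P) atTop := by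
          refine lintegral_liminf_le' fun n => ?_
          exact ((aemeasurable_const.sub (Real.measurable_cos.comp_aemeasurable
            (hm.const_mul _))).const_mul _).ennreal_ofReal
      _ ≤ 1 := liminf_le_of_frequently_le' (Frequently.of_forall hle)
  have hsqI : Integrable (fun ω => η ω ^ 2) P := by
    refine ⟨(hm.pow_const 2).aestronglyMeasurable, ?_⟩
    rw [hasFiniteIntegral_iff_ofReal (ae_of_all _ fun ω => sq_nonneg _)]
    exact hfatou.trans_lt ENNReal.one_lt_top
  refine ⟨(memLp_two_iff_integrable_sq hm.aestronglyMeasurable).2 hsqI, ?_⟩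
  rw [← ENNReal.ofReal_le_one, ofReal_integral_eq_lintegral_ofReal hsqI
    (ae_of_all _ fun ω => sq_nonneg _)]
  exact hfatou

/-- The hyperbolic cosine is even, so the law is symmetric. -/
theorem IsStochasticArea.integral_eq_zero {η : Ω → ℝ} (h : IsStochasticArea η P) :
    ∫ ω, η ω ∂P = 0 := by
  have hneg : P.map (fun ω => -1 * η ω) = P.map η := by
    have := Measure.isProbabilityMeasure_map (μ := P) h.1
    have := Measure.isProbabilityMeasure_map (μ := P) (h.1.const_mul (-1))
    refine Measure.ext_of_charFun (funext fun t => ?_)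
    rw [charFun_map_mul_comp h.1, h.2, h.2]
    simp
  have h1 : ∫ ω, -1 * η ω ∂P = ∫ ω, η ω ∂P := by
    have e1 := integral_map (h.1.const_mul (-1)) (f := fun x : ℝ => x)
      (Measurable.aestronglyMeasurable measurable_id)
    have e2 := integral_map h.1 (f := fun x : ℝ => x)
      (Measurable.aestronglyMeasurable measurable_id)
    rw [hneg] at e1
    rw [← e1, ← e2]
  rw [integral_const_mul] at h1
  linarith

/-- Pairwise orthogonal vectors with square summable norms form a summable family. -/
theorem summable_of_pairwise_inner_eq_zero {H κ : Type*} [NormedAddCommGroup H]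
    [InnerProductSpace ℝ H] [CompleteSpace H] {y : κ → H}
    (hy : ∀ q r, q ≠ r → inner ℝ (y q) (y r) = 0) (hs : Summable fun q => ‖y q‖ ^ 2) :
    Summable y := by
  have hV : OrthogonalFamily ℝ (fun q => (ℝ ∙ y q)) fun q => (ℝ ∙ y q).subtypeₗᵢ := by
    refine OrthogonalFamily.of_pairwise fun q r hqr => ?_
    change (ℝ ∙ y q) ⟂ (ℝ ∙ y r)
    rw [Submodule.isOrtho_span]
    rintro _ rfl _ rfl
    exact hy q r hqr
  exact (hV.summable_iff_norm_sq_summable fun q => ⟨y q, Submodule.mem_span_singleton_self _⟩).2 hs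

/-- Independent centred terms are orthogonal in L², with norms at most `|lam q|`. -/
theorem exists_isL2Sum (hη : ∀ q, IsStochasticArea (η q) P) (hind : iIndepFun η P)
    (hlam : Summable fun q => lam q ^ 2) :
    ∃ W : Ω → ℝ, IsL2Sum (fun q ω => lam q * η q ω) W P := by
  have hL : ∀ q, MemLp (fun ω => lam q * η q ω) 2 P := fun q => (hη q).memLp.1.const_mul _
  set y : ι → Lp ℝ 2 P := fun q => (hL q).toLp _ with hy
  have hinner : ∀ q r, inner ℝ (y q) (y r) = lam q * lam r * ∫ ω, η q ω * η r ω ∂P := by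
    intro q r
    rw [L2.inner_def, ← integral_const_mul]
    refine integral_congr_ae ?_
    filter_upwards [(hL q).coeFn_toLp, (hL r).coeFn_toLp] with ω h1 h2
    rw [h1, h2]
    simp only [RCLike.inner_apply, conj_trivial]
    ring
  have horth : ∀ q r, q ≠ r → inner ℝ (y q) (y r) = 0 := by
    intro q r hqr
    rw [hinner, (hind.indepFun hqr).integral_fun_mul_eq_mul_integral
      (hη q).1.aestronglyMeasurable (hη r).1.aestronglyMeasurable, (hη q).integral_eq_zero]
    simp
  have hnorm : ∀ q, ‖y q‖ ^ 2 ≤ lam q ^ 2 := by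
    intro q
    rw [← real_inner_self_eq_norm_sq, hinner, ← sq]
    have h1 := (hη q).memLp.2
    simp_rw [← sq]
    nlinarith [sq_nonneg (lam q)]
  have hsum : Summable y := summable_of_pairwise_inner_eq_zero horth
    (Summable.of_nonneg_of_le (fun q => sq_nonneg _) hnorm hlam)
  obtain ⟨W, hW⟩ := hsum
  refine ⟨W, Lp.memLp W, ?_⟩
  have h1 : Tendsto (fun s : Finset ι => edist (∑ q ∈ s, y q) W) atTop (𝓝 0) :=
    tendsto_iff_edist_tendsto_0.1 hW
  refine h1.congr fun s => ?_
  rw [Lp.edist_def]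
  refine eLpNorm_congr_ae ?_
  have hall : ∀ᵐ ω ∂P, ∀ q ∈ s, y q ω = lam q * η q ω := by
    rw [Finset.eventually_all]
    exact fun q _ => (hL q).coeFn_toLp
  filter_upwards [Lp.coeFn_finsetSum s y, hall] with ω h1 h2
  rw [Pi.sub_apply, h1, Finset.sum_apply, Finset.sum_congr rfl h2]

/-- The finite products are the characteristic functions of the partial sums, and at a fixed `t` a
characteristic function depends continuously on the variable in L². -/
theorem tendsto_prod_inv_cosh (hη : ∀ q, IsStochasticArea (η q) P) (hind : iIndepFun η P)
    {W : Ω → ℝ} (hW : IsL2Sum (fun q ω => lam q * η q ω) W P) (t : ℝ) :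
    Tendsto (fun s : Finset ι => ((∏ q ∈ s, (Real.cosh (t * lam q))⁻¹ : ℝ) : ℂ)) atTop
      (𝓝 (∫ ω, Complex.exp ((t * W ω : ℝ) * Complex.I) ∂P)) := by
  have hL : ∀ s : Finset ι, MemLp (fun ω => ∑ q ∈ s, lam q * η q ω) 2 P := fun s =>
    memLp_finsetSum _ fun q _ => (hη q).memLp.1.const_mul _
  rw [tendsto_iff_norm_sub_tendsto_zero]
  have h1 := ((ENNReal.tendsto_toReal ENNReal.zero_ne_top).comp hW.2).const_mul |t|
  rw [ENNReal.toReal_zero, mul_zero] at h1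
  refine squeeze_zero (fun _ => norm_nonneg _) (fun s => ?_) h1
  rw [← integral_exp_sum hη hind]
  refine (norm_integral_exp_sub_le (hL s).1 hW.1.1 ((hL s).sub hW.1) t).trans_eq ?_
  rw [← toReal_eLpNorm ((hL s).sub hW.1).1]
  rfl

end StochasticArea

/-! ### Convergence in distribution -/

section Convergence

variable {Ω Ω' : Type*} [MeasurableSpace Ω] [MeasurableSpace Ω'] {P : Measure Ω}
  [IsProbabilityMeasure P] {P' : Measure Ω'} [IsProbabilityMeasure P']

theorem tendstoInDistribution_of_integral_exp {A : ℕ → Ω → ℝ} {W : Ω' → ℝ}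
    (hA : ∀ n, AEMeasurable (A n) P) (hW : AEMeasurable W P')
    (h : ∀ t : ℝ, Tendsto (fun n => ∫ ω, Complex.exp ((t * A n ω : ℝ) * Complex.I) ∂P) atTop
      (𝓝 (∫ ω, Complex.exp ((t * W ω : ℝ) * Complex.I) ∂P'))) :
    TendstoInDistribution A atTop W (fun _ => P) P' := by
  refine ⟨hA, hW, ?_⟩
  refine ProbabilityMeasure.tendsto_iff_tendsto_charFun.2 fun t => ?_
  have := h t
  simp_rw [integral_exp_eq_charFun (hA _), integral_exp_eq_charFun hW] at this
  exact this

/-- Convergence of `a n` from approximation by `p s`, up to errors that vanish along `s`. -/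
theorem tendsto_of_approx {ι : Type*} {a : ℕ → ℂ} {p : Finset ι → ℂ} {d : Finset ι → ℝ} {c : ℂ}
    (hp : Tendsto p atTop (𝓝 c)) (hd : Tendsto d atTop (𝓝 0))
    (h : ∀ s, ∀ κ > 0, ∃ N : ℕ, ∀ n, N ≤ n → ‖a n - p s‖ ≤ d s + κ) : Tendsto a atTop (𝓝 c) := by
  rw [Metric.tendsto_atTop]
  intro ε hε
  obtain ⟨s, hs1, hs2⟩ := ((hp.eventually (Metric.ball_mem_nhds c (by positivity : 0 < ε / 3))).and
    (hd.eventually (gt_mem_nhds (by positivity : 0 < ε / 3)))).exists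
  obtain ⟨N, hN⟩ := h s (ε / 3) (by positivity)
  refine ⟨N, fun n hn => ?_⟩
  have h1 := hN n hn
  rw [dist_eq_norm] at hs1 ⊢
  linarith [norm_sub_le_norm_sub_add_norm_sub (a n) (p s) c]

end Convergence

/-! ### From finite rank to the limit theorems. -/

section Limits

variable {S : Type*} [MeasurableSpace S] {ν : Measure S} {Ω : Type*} [MeasurableSpace Ω]
  {P : Measure Ω} {f : S → S → ℝ} {Y : ℕ → Ω → S}

/-- The observations are measurable only up to null sets; measurable versions agree with all of them
simultaneously, almost surely. -/
theorem exists_isSample {X : ℕ → Ω → S} (hX_law : ∀ i, HasLaw (X i) ν P)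
    (hX_indep : iIndepFun X P) :
    ∃ Y : ℕ → Ω → S, IsSample P ν Y ∧ ∀ᵐ ω ∂P, (fun k => Y k ω) = fun k => X k ω := by
  have hm := fun i => (hX_law i).aemeasurable
  refine ⟨fun i => (hm i).mk (X i), ⟨fun i => (hm i).measurable_mk, fun i => ?_, ?_⟩, ?_⟩
  · rw [← (hX_law i).map_eq]
    exact Measure.map_congr (hm i).ae_eq_mk.symm
  · exact hX_indep.congr fun i => (hm i).ae_eq_mk
  · have : ∀ᵐ ω ∂P, ∀ i, X i ω = (hm i).mk (X i) ω := ae_all_iff.2 fun i => (hm i).ae_eq_mk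
    filter_upwards [this] with ω hω
    funext k
    exact (hω k).symm

theorem measurable_weightedStat (hfm : Measurable (Function.uncurry f)) (hY : IsSample P ν Y)
    (c : ℕ → ℕ → ℝ) (n : ℕ) : Measurable fun ω => weightedStat c f n fun k => Y k ω := by
  unfold weightedStat
  exact Finset.measurable_fun_sum _ fun j _ => Finset.measurable_fun_sum _ fun i _ =>
    (hfm.comp ((hY.measurable i).prodMk (hY.measurable j))).const_mul _

theorem measurable_cyclic (hfm : Measurable (Function.uncurry f)) (hY : IsSample P ν Y) (n : ℕ) :
    Measurable fun ω => cyclic f n fun k => Y k ω := by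
  unfold cyclic
  exact Finset.measurable_fun_sum _ fun j _ => Finset.measurable_fun_sum _ fun i _ =>
    hfm.comp ((hY.measurable _).prodMk (hY.measurable _))

variable [IsProbabilityMeasure P] {Ω' : Type*} [MeasurableSpace Ω'] {P' : Measure Ω'}
  [IsProbabilityMeasure P'] {ι : Type*} {lam : ι → ℝ} {η : ι → Ω' → ℝ} {W : Ω' → ℝ}

/-- For a fixed finite set `s` of eigenvalues the error for large `n` is at most `|t|` times the
distance of `f` from its truncation, plus `κ`. Both this distance and the distance of the finite
product from its limit vanish along `s`, so a diagonal choice suffices. -/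
theorem tendstoInDistribution_of_finite_rank (hη : ∀ q, IsStochasticArea (η q) P')
    (hind : iIndepFun η P') (hW : IsL2Sum (fun q ω => lam q * η q ω) W P')
    {v : ι ⊕ ι → S → ℝ} (hv : Tendsto (fun s : Finset ι => lpNorm (Function.uncurry f -
      Function.uncurry (pairKernel (fun q : s => lam q) fun r => v (r.map Subtype.val Subtype.val)))
        2 (ν.prod ν)) atTop (𝓝 0))
    {A : ℕ → Ω → ℝ} (hA : ∀ n, Measurable (A n))
    (h : ∀ (s : Finset ι) (t κ : ℝ), 0 < κ → ∃ N : ℕ, ∀ n, N ≤ n →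
      ‖∫ ω, Complex.exp ((t * ((n : ℝ)⁻¹ * A n ω) : ℝ) * Complex.I) ∂P -
          ((∏ q : s, (Real.cosh (t * lam q))⁻¹ : ℝ) : ℂ)‖ ≤
        |t| * lpNorm (Function.uncurry f - Function.uncurry (pairKernel (fun q : s => lam q)
          fun r => v (r.map Subtype.val Subtype.val))) 2 (ν.prod ν) + κ) :
    TendstoInDistribution (fun (n : ℕ) ω => (n : ℝ)⁻¹ * A n ω) atTop W (fun _ => P) P' := by
  refine tendstoInDistribution_of_integral_exp (fun n => ((hA n).const_mul _).aemeasurable)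
    hW.1.1.aemeasurable fun t => ?_
  have hd := hv.const_mul |t|
  rw [mul_zero] at hd
  refine tendsto_of_approx (tendsto_prod_inv_cosh hη hind hW t) hd fun s κ hκ => ?_
  obtain ⟨N, hN⟩ := h s t κ hκ
  refine ⟨N, fun n hn => ?_⟩
  rw [← Finset.prod_coe_sort]
  exact hN n hn

end Limits

end UStatistic

end

theorem corollary7p2
    {S : Type*} [MeasurableSpace S] (ν : Measure S) [IsProbabilityMeasure ν]
    {Ω : Type*} [MeasurableSpace Ω] (P : Measure Ω) [IsProbabilityMeasure P]
    (X : ℕ → Ω → S) (hX_law : ∀ i, HasLaw (X i) ν P) (hX_indep : iIndepFun X P)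
    (f : S → S → ℝ) (hf_meas : Measurable (Function.uncurry f))
    (hf : MemLp (Function.uncurry f) 2 (ν.prod ν))
    (hf_anti : ∀ᵐ p ∂(ν.prod ν), f p.1 p.2 = -f p.2 p.1)
    (hf_pair : ∀ᵐ p ∂(ν.prod ν), f p.1 p.2 = UStatistic.hoeffdingPair ν f p.1 p.2) :
    -- the eigenvalues with positive imaginary part form a finite or infinite sequence `i lam_q`
    (∃ (Q : ℕ∞) (lam : {q : ℕ // (q : ℕ∞) < Q} → ℝ),
      UStatistic.EnumeratesUpperEigenvalues
        (UStatistic.realKernelOperator ν f hf : Module.End ℂ (Lp ℂ 2 ν)) lam) ∧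
    -- and for every such sequence the five limit theorems hold
    ∀ {ι : Type*} [Countable ι] (lam : ι → ℝ),
      UStatistic.EnumeratesUpperEigenvalues
        (UStatistic.realKernelOperator ν f hf : Module.End ℂ (Lp ℂ 2 ν)) lam →
      ∀ {Ω' : Type*} [MeasurableSpace Ω'] (P' : Measure Ω') [IsProbabilityMeasure P']
        (η : ι → Ω' → ℝ),
        (∀ q, UStatistic.IsStochasticArea (η q) P') → iIndepFun η P' →
        ∃ W : Ω' → ℝ,
          UStatistic.IsL2Sum (fun q ω => lam q * η q ω) W P' ∧
          TendstoInDistribution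
            (fun (n : ℕ) ω => (n : ℝ)⁻¹ * UStatistic.standard f n (fun k => X k ω))
            atTop W (fun _ => P) P' ∧
          TendstoInDistribution
            (fun (n : ℕ) ω => (n : ℝ)⁻¹ * UStatistic.cyclic f n (fun k => X k ω))
            atTop W (fun _ => P) P' ∧
          TendstoInDistribution
            (fun (n : ℕ) ω => (n : ℝ)⁻¹ * UStatistic.biAlternating f n (fun k => X k ω))
            atTop W (fun _ => P) P' ∧
          TendstoInDistribution
            (fun (n : ℕ) ω => (n : ℝ)⁻¹ * UStatistic.alternatingPM f n (fun k => X k ω))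
            atTop W (fun _ => P) P' ∧
          TendstoInDistribution
            (fun (n : ℕ) ω => (n : ℝ)⁻¹ * UStatistic.alternatingMP f n (fun k => X k ω))
            atTop W (fun _ => P) P' := by
  refine ⟨UStatistic.exists_enumeration hf hf_anti, ?_⟩
  intro ι _ lam hlam Ω' _ P' _ η hη hind
  have hf0 := UStatistic.isDegenerate_of_antisymmetric hf hf_anti hf_pair
  obtain ⟨hlam2, v, hv, hvf⟩ := UStatistic.exists_pairKernel_expansion hf hf_anti hf0 hlam
  obtain ⟨W, hW⟩ := UStatistic.exists_isL2Sum hη hind hlam2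
  obtain ⟨Y, hY, hYX⟩ := UStatistic.exists_isSample hX_law hX_indep
  have hvs : ∀ s : Finset ι, UStatistic.IsCentredOrthonormal ν
      fun r : s ⊕ s => v (r.map Subtype.val Subtype.val) := fun s =>
    hv.comp_injective (Subtype.val_injective.sumMap Subtype.val_injective)
  -- All statistics other than the cyclic one are instances, with constant or alternating signs.
  have hsigned : ∀ δ ε : ℕ → ℝ, (∀ i, |δ i| = 1) → (∀ i, |ε i| = 1) →
      TendstoInDistribution (fun (n : ℕ) ω => (n : ℝ)⁻¹ *
        UStatistic.weightedStat (UStatistic.signWeight δ ε) f n fun k => X k ω)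
        atTop W (fun _ => P) P' := by
    intro δ ε hδ hε
    have h := UStatistic.tendstoInDistribution_of_finite_rank hη hind hW hvf
      (fun n => UStatistic.measurable_weightedStat hf_meas hY (UStatistic.signWeight δ ε) n)
      fun s t κ hκ => by
        obtain ⟨N, hN⟩ := UStatistic.exists_norm_integral_exp_signed_sub_le (Ω := Ω) (P := P)
          (fun q : s => lam q) (hvs s) hf_meas hf hf0 t hκ
        exact ⟨N, fun n hn => hN n hn Y δ ε hY hδ hε⟩
    refine h.congr (fun n => ?_) EventuallyEq.rfl
    filter_upwards [hYX] with ω hω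
    rw [hω]
  have hcyclic : TendstoInDistribution (fun (n : ℕ) ω => (n : ℝ)⁻¹ *
      UStatistic.cyclic f n (fun k => X k ω)) atTop W (fun _ => P) P' := by
    have h := UStatistic.tendstoInDistribution_of_finite_rank hη hind hW hvf
      (fun n => UStatistic.measurable_cyclic hf_meas hY n)
      fun s t κ hκ => UStatistic.exists_norm_integral_exp_cyclic_sub_le
          (fun q : s => lam q) (hvs s) hf_meas hf hf0 hf_anti hY t hκ
    refine h.congr (fun n => ?_) EventuallyEq.rfl
    filter_upwards [hYX] with ω hω
    rw [hω]
  simp_rw [UStatistic.standard_eq_weightedStat, UStatistic.biAlternating_eq_weightedStat,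
    UStatistic.alternatingPM_eq_weightedStat, UStatistic.alternatingMP_eq_weightedStat]
  exact ⟨W, hW, hsigned _ _ (by simp) (by simp), hcyclic, hsigned _ _ (by simp) (by simp),
    hsigned _ _ (by simp) (by simp), hsigned _ _ (by simp) (by simp)⟩
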